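/- Let $M_k\subseteq\mathbb B(H_k)$ and $N_k\subseteq\mathbb B(K_k)$ ($k=1,2$) be von Neumann algebras (for instance $K_k=L^2(N_k)$, the standard form of $N_k$), and let $0\le\alpha\le 1$. *Power means.* Let $A$ be a unital C*-algebra and $N\subseteq\mathbb B(K)$ a von Neumann algebra. A completely positive (CP) map $\Phi:A\to N$ gives the positive sesquilinear form $s_\Phi(x\otimes\xi,y\otimes\eta)=\langle\Phi(y^*x)\xi,\eta\rangle$ on the algebraic tensor product $A\odot K$. For positive sesquilinear forms $s,t$ on a complex vector space $V$, let $h:V\to\mathcal H$ be the canonical map into the Hilbert space obtained from $s+t$ by separation and completion, and let $S,T$ be the commuting positive operators on $\mathcal H$ with $s(x,y)=\langle S\,h(x),h(y)\rangle$ and $t(x,y)=\langle T\,h(x),h(y)\rangle$ (so $S+T=1$); the parallel sum is $(s:t)(x,y)=\langle ST(S+T)^{-1}h(x),h(y)\rangle$. Write $$u^\alpha=a+bu+\int_{(0,\infty)}\frac{u(1+\lambda)}{u+\lambda}\,d\mu(\lambda)\qquad(u\ge 0)$$ with $a,b\ge 0$ and a finite positive measure $\mu$ on $(0,\infty)$ (with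 $u^0=1$ for all $u\ge0$). The $\alpha$-power mean $\Phi\#_\alpha\Psi$ of two CP maps $\Phi,\Psi:A\to N$ is the CP map $A\to N$ with $$s_{\Phi\#_\alpha\Psi}=a\,s_\Phi+b\,s_\Psi+\int_{(0,\infty)}\frac{1+\lambda}{\lambda}\,\big[(\lambda s_\Phi):s_\Psi\big]\,d\mu(\lambda).$$ *Tensor products.* Let $M_1\otimes_{\min}M_2$ be the spatial C*-tensor product (the norm closure of $M_1\odot M_2$ in $\mathbb B(H_1\otimes H_2)$) and let $M_1\bar\otimes M_2$, $N_1\bar\otimes N_2$ be the von Neumann algebra tensor products. For CP maps $\Phi_k:M_k\to N_k$, let $\Phi_1\otimes\Phi_2:M_1\otimes_{\min}M_2\to N_1\bar\otimes N_2$ be the CP map with $(\Phi_1\otimes\Phi_2)(x_1\otimes x_2)=\Phi_1(x_1)\otimes\Phi_2(x_2)$. If $\Phi_1,\Phi_2$ are normal, let $\Phi_1\bar\otimes\Phi_2:M_1\bar\otimes M_2\to N_1\bar\otimes N_2$ be the normal CP map with the same values on elementary tensors. **Theorem.** Let $\Phi_k,\Psi_k:M_k\to N_k$ be CP maps, $k=1,2$.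 Then $$(\Phi_1\otimes\Phi_2)\,\#_\alpha\,(\Psi_1\otimes\Psi_2)=(\Phi_1\#_\alpha\Psi_1)\otimes(\Phi_2\#_\alpha\Psi_2)$$ as CP maps $M_1\otimes_{\min}M_2\to N_1\bar\otimes N_2$. If moreover $\Phi_1,\Phi_2,\Psi_1,\Psi_2$ are normal, then also $$(\Phi_1\bar\otimes\Phi_2)\,\#_\alpha\,(\Psi_1\bar\otimes\Psi_2)=(\Phi_1\#_\alpha\Psi_1)\bar\otimes(\Phi_2\#_\alpha\Psi_2)$$ as CP maps $M_1\bar\otimes M_2\to N_1\bar\otimes N_2$. -/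

import Mathlib

open scoped TensorProduct CStarAlgebra ComplexOrder NNReal
open UniformSpace MeasureTheory

noncomputable section

namespace CPMean

/-! ### Positive sesquilinear forms and the Pusz–Woronowicz functional calculus -/

section Forms

variable {V : Type*} [AddCommGroup V] [Module ℂ V]

/-- A positive sesquilinear form on `V`: linear in the first and conjugate-linear in the second
variable, with `0 ≤ α(x, x)` (in the order of `ℂ`: real and nonnegative). -/
structure PosForm (V : Type*) [AddCommGroup V] [Module ℂ V] where
  form : V →ₗ[ℂ] V →ₗ⋆[ℂ] ℂ
  nonneg : ∀ x, 0 ≤ form x x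

namespace PosForm

instance : CoeFun (PosForm V) (fun _ => V → V → ℂ) := ⟨fun α x y => α.form x y⟩

instance : Add (PosForm V) :=
  ⟨fun α β => ⟨α.form + β.form, fun x => add_nonneg (α.nonneg x) (β.nonneg x)⟩⟩

/-- The positive form `r • α`, for `r ≥ 0`. -/
def scale (r : ℝ≥0) (α : PosForm V) : PosForm V :=
  ⟨((r : ℝ) : ℂ) • α.form, fun x => by
    have h : (0 : ℂ) ≤ ((r : ℝ) : ℂ) := Complex.zero_le_real.mpr r.2
    simpa using mul_nonneg h (α.nonneg x)⟩

theorem conj_symm (α : PosForm V) (x y : V) : (starRingEnd ℂ) (α.form x y) = α.form y x := by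
  have hx := (Complex.nonneg_iff.1 (α.nonneg x)).2
  have hy := (Complex.nonneg_iff.1 (α.nonneg y)).2
  have h1 := (Complex.nonneg_iff.1 (α.nonneg (x + y))).2
  have h2 := (Complex.nonneg_iff.1 (α.nonneg (x + Complex.I • y))).2
  simp only [map_add, LinearMap.add_apply, map_smul, LinearMap.smul_apply, LinearMap.map_smulₛₗ,
    smul_eq_mul, Complex.add_im, Complex.conj_I] at h1 h2
  simp at h1 h2
  apply Complex.ext
  · simp; linarith
  · simp; linarith

/-- `V` with the semi-inner product given by the positive form `γ`. -/
@[nolint unusedArguments]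
def Space (_γ : PosForm V) : Type _ := V

instance (γ : PosForm V) : AddCommGroup γ.Space := inferInstanceAs (AddCommGroup V)
instance (γ : PosForm V) : Module ℂ γ.Space := inferInstanceAs (Module ℂ V)

/-- The semi-inner product; Mathlib's inner products are linear in the second variable. -/
@[reducible]
def core (γ : PosForm V) : PreInnerProductSpace.Core ℂ γ.Space where
  inner x y := γ.form y x
  conj_inner_symm x y := γ.conj_symm x y
  re_inner_nonneg x := (Complex.nonneg_iff.1 (γ.nonneg x)).1
  add_left x y z := map_add (γ.form z) x y
  smul_left x y r := (γ.form y).map_smulₛₗ r x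

instance (γ : PosForm V) : SeminormedAddCommGroup γ.Space :=
  @InnerProductSpace.Core.toSeminormedAddCommGroup ℂ γ.Space _ _ _ γ.core

instance (γ : PosForm V) : InnerProductSpace ℂ γ.Space :=
  InnerProductSpace.ofCore γ.core

/-- The Hilbert space of `γ`, by separation and completion. -/
def Hilbert (γ : PosForm V) : Type _ := Completion γ.Space

instance (γ : PosForm V) : NormedAddCommGroup γ.Hilbert :=
  inferInstanceAs (NormedAddCommGroup (Completion γ.Space))
instance (γ : PosForm V) : InnerProductSpace ℂ γ.Hilbert :=
  inferInstanceAs (InnerProductSpace ℂ (Completion γ.Space))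
instance (γ : PosForm V) : CompleteSpace γ.Hilbert :=
  inferInstanceAs (CompleteSpace (Completion γ.Space))

/-- The canonical map from `V` onto a dense subspace of the Hilbert space of `γ`. -/
def h (γ : PosForm V) (x : V) : γ.Hilbert := ((show γ.Space from x : γ.Space) : Completion γ.Space)

theorem denseRange_h (γ : PosForm V) : DenseRange γ.h := Completion.denseRange_coe (α := γ.Space)

theorem inner_h (γ : PosForm V) (x y : V) : inner ℂ (γ.h y) (γ.h x) = γ.form x y :=
  Completion.inner_coe (𝕜 := ℂ) (E := γ.Space) y x

theorem norm_sq_space (γ : PosForm V) (x : V) :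
    ‖(show γ.Space from x)‖ ^ 2 = (γ.form x x).re :=
  InnerProductSpace.norm_sq_eq_re_inner (𝕜 := ℂ) (E := γ.Space) x

/-- If `α(x, x) ≤ γ(x, x)` for all `x`, the contraction `h_γ(x) ↦ h_α(x)` of Hilbert spaces. -/
def contraction (γ α : PosForm V) (hle : ∀ x, (α.form x x).re ≤ (γ.form x x).re) :
    γ.Hilbert →L[ℂ] α.Hilbert :=
  ContinuousLinearMap.completion
    (LinearMap.mkContinuous
      ({ toFun := fun x => x, map_add' := fun _ _ => rfl, map_smul' := fun _ _ => rfl } :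
        γ.Space →ₗ[ℂ] α.Space) 1 (fun x => by
          rw [one_mul]
          have h1 := γ.norm_sq_space x
          have h2 := α.norm_sq_space x
          have h3 := hle x
          exact le_of_sq_le_sq (h2.le.trans (h3.trans h1.ge)) (norm_nonneg _)))

theorem le_add_left_re (α β : PosForm V) (x : V) :
    (α.form x x).re ≤ ((α + β).form x x).re := by
  have h := (Complex.nonneg_iff.1 (β.nonneg x)).1
  change _ ≤ (α.form x x + β.form x x).re
  rw [Complex.add_re]; linarith

/-- The bounded positive operator `A` on the Hilbert space of `α + β` that represents `α`,
that is, `α(x, y) = ⟨A h(x), h(y)⟩` (see `repr_left`). -/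
def reprOp (α β : PosForm V) : (α + β).Hilbert →L[ℂ] (α + β).Hilbert :=
  let T := contraction (α + β) α (le_add_left_re α β)
  (ContinuousLinearMap.adjoint T).comp T

theorem contraction_h (γ α : PosForm V) (hle : ∀ x, (α.form x x).re ≤ (γ.form x x).re) (x : V) :
    contraction γ α hle (γ.h x) = α.h x :=
  ContinuousLinearMap.completion_apply_coe _ _

theorem repr_left (α β : PosForm V) (x y : V) :
    inner ℂ ((α + β).h y) (reprOp α β ((α + β).h x)) = α.form x y := by
  rw [reprOp]
  simp only [ContinuousLinearMap.comp_apply]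
  rw [ContinuousLinearMap.adjoint_inner_right, contraction_h, contraction_h, inner_h]

/-- `B = 1 - A` represents `β`, so that `(h, A)`, `(h, 1 - A)` are compatible representations. -/
theorem repr_right (α β : PosForm V) (x y : V) :
    inner ℂ ((α + β).h y) ((1 - reprOp α β) ((α + β).h x)) = β.form x y := by
  rw [sub_apply, inner_sub_right, repr_left]
  change inner ℂ ((α + β).h y) ((α + β).h x) - _ = _
  rw [inner_h]
  change α.form x y + β.form x y - α.form x y = β.form x y
  ring

/-- The Pusz–Woronowicz functional calculus `f(α, β)(x, y) = ⟨f(A, B) h(x), h(y)⟩`, for a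
homogeneous function `f` that is continuous on the quadrant, computed in the compatible
representation `(h, A)`, `(h, B)` of `α`, `β` on the Hilbert space of `α + β`. There
`A + B = 1`, so that `f(A, B)` is the function `t ↦ f(t, 1 - t)` of the self-adjoint operator
`A`. -/
def pwCalculus (f : ℝ → ℝ → ℝ) (α β : PosForm V) (x y : V) : ℂ :=
  inner ℂ ((α + β).h y) (cfc (fun t : ℝ => f t (1 - t)) (reprOp α β) ((α + β).h x))

/-- The parallel sum `α : β`, the functional calculus of `f(r, s) = r s / (r + s)`. -/
def parallelSum (α β : PosForm V) : V → V → ℂ :=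
  pwCalculus (fun r s => r * s / (r + s)) α β

end PosForm

/-- `a, b ≥ 0` and the finite positive measure `μ` on `(0, ∞)` represent the function `f` on
`[0, ∞)`: `f(t) = a + b t + ∫ t (1 + l) / (t + l) dμ(l)`. -/
structure IsLoewnerRep (f : ℝ → ℝ) (a b : ℝ) (μ : Measure ℝ) : Prop where
  a_nonneg : 0 ≤ a
  b_nonneg : 0 ≤ b
  finite : IsFiniteMeasure μ
  pos : μ (Set.Iic 0) = 0
  repr : ∀ t, 0 ≤ t → f t = a + b * t + ∫ l in Set.Ioi 0, t * (1 + l) / (t + l) ∂μ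

/-- The form connection
`a α(x, y) + b β(x, y) + ∫ (1 + l) / l [(l α) : β](x, y) dμ(l)`, the integral over `(0, ∞)`. -/
def formConnection (a b : ℝ) (μ : Measure ℝ) (α β : PosForm V) (x y : V) : ℂ :=
  (a : ℂ) * α x y + (b : ℂ) * β x y +
    ∫ l in Set.Ioi (0 : ℝ),
      (((1 + l) / l : ℝ) : ℂ) * PosForm.parallelSum (PosForm.scale l.toNNReal α) β x y ∂μ

end Forms

/-! ### C⋆-algebras of operators -/

section Algebras

variable {H : Type*} [NormedAddCommGroup H] [InnerProductSpace ℂ H] [CompleteSpace H]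

/-- The type of elements of a ⋆-algebra `S` of bounded operators. -/
def OpAlg (S : StarSubalgebra ℂ (H →L[ℂ] H)) : Type _ := S

/-- A norm-closed unital ⋆-algebra of bounded operators is a C⋆-algebra. -/
instance (S : StarSubalgebra ℂ (H →L[ℂ] H)) [IsClosed (S : Set (H →L[ℂ] H))] :
    CStarAlgebra (OpAlg S) := inferInstanceAs (CStarAlgebra S)

/-- The order is the one of operators. -/
instance (S : StarSubalgebra ℂ (H →L[ℂ] H)) : PartialOrder (OpAlg S) :=
  inferInstanceAs (PartialOrder S)

/-- The inclusion of `S` into the algebra of all bounded operators. -/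
def OpAlg.val {S : StarSubalgebra ℂ (H →L[ℂ] H)} [IsClosed (S : Set (H →L[ℂ] H))] :
    OpAlg S →⋆ₐ[ℂ] (H →L[ℂ] H) where
  toFun x := x.1
  map_one' := rfl
  map_mul' _ _ := rfl
  map_zero' := rfl
  map_add' _ _ := rfl
  commutes' _ := rfl
  map_star' _ := rfl

instance (S : StarSubalgebra ℂ (H →L[ℂ] H)) [hS : IsClosed (S : Set (H →L[ℂ] H))] :
    StarOrderedRing (OpAlg S) := by
  refine StarOrderedRing.of_nonneg_iff' (fun {x y} hxy z => ?_) (fun x => ?_)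
  · exact add_le_add_right (show (x.1 : H →L[ℂ] H) ≤ y.1 from hxy) (z.1 : H →L[ℂ] H)
  · constructor
    · intro hx
      have hx' : (0 : H →L[ℂ] H) ≤ x.1 := hx
      have hsa : IsSelfAdjoint x := Subtype.ext (IsSelfAdjoint.of_nonneg hx')
      have hspec : SpectrumRestricts x ContinuousMap.realToNNReal := by
        rw [SpectrumRestricts.nnreal_iff]
        intro r hr
        have h1 := (spectrum.algebraMap_mem_iff ℂ).2 hr
        have h2 := (StarSubalgebra.mem_spectrum_iff S (a := x)).1 h1
        exact spectrum_nonneg_of_nonneg hx' ((spectrum.algebraMap_mem_iff ℂ).1 h2)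
      obtain ⟨s, hs, -, h⟩ := CFC.exists_sqrt_of_isSelfAdjoint_of_quasispectrumRestricts hsa
        (quasispectrumRestricts_iff_spectrumRestricts.2 hspec)
      exact ⟨s, by rw [hs.star_eq, h]⟩
    · rintro ⟨s, rfl⟩
      exact star_mul_self_nonneg (s.1 : H →L[ℂ] H)

instance (M : VonNeumannAlgebra H) :
    IsClosed (M.toStarSubalgebra : Set (H →L[ℂ] H)) := by
  have h : (M.toStarSubalgebra : Set (H →L[ℂ] H)) =
      Set.centralizer (Set.centralizer (M.toStarSubalgebra : Set (H →L[ℂ] H))) :=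
    M.centralizer_centralizer'.symm
  rw [h]
  exact Set.isClosed_centralizer _

/-- The type of elements of a von Neumann algebra. -/
abbrev Elem (M : VonNeumannAlgebra H) : Type _ := OpAlg M.toStarSubalgebra

end Algebras

/-! ### Connections and power means of completely positive maps -/

section Connection

variable {A : Type*} [CStarAlgebra A] [PartialOrder A] [StarOrderedRing A]
variable {K : Type*} [NormedAddCommGroup K] [InnerProductSpace ℂ K] [CompleteSpace K]
variable {N : VonNeumannAlgebra K}

/-- The value of a map into a von Neumann algebra, as an operator. -/
abbrev op (Φ : A →CP Elem N) (x : A) : K →L[ℂ] K := (Φ x).val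

/-- The conjugate-linear functional `y ⊗ η ↦ ⟨Φ(y⋆ x) ξ, η⟩`. -/
def cpFormAux (Φ : A →CP Elem N) (x : A) (ξ : K) : A ⊗[ℂ] K →ₗ⋆[ℂ] ℂ :=
  TensorProduct.lift (LinearMap.mk₂'ₛₗ (starRingEnd ℂ) (starRingEnd ℂ)
    (fun (y : A) (η : K) => inner ℂ η (op Φ (star y * x) ξ))
    (fun y y' η => by simp [op, add_mul])
    (fun c y η => by simp [op])
    (fun y η η' => by simp)
    (fun c y η => by simp [mul_comm]))

/-- The sesquilinear form `s_Φ(x ⊗ ξ, y ⊗ η) = ⟨Φ(y⋆ x) ξ, η⟩` on the algebraic tensor product. -/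
def cpSesq (Φ : A →CP Elem N) : A ⊗[ℂ] K →ₗ[ℂ] A ⊗[ℂ] K →ₗ⋆[ℂ] ℂ :=
  TensorProduct.lift (LinearMap.mk₂ ℂ (cpFormAux Φ)
    (fun x x' ξ => by
      apply TensorProduct.ext'
      intro y η
      simp [cpFormAux, op, mul_add])
    (fun c x ξ => by
      apply TensorProduct.ext'
      intro y η
      simp [cpFormAux, op])
    (fun x ξ ξ' => by
      apply TensorProduct.ext'
      intro y η
      simp [cpFormAux])
    (fun c x ξ => by
      apply TensorProduct.ext'
      intro y η
      simp [cpFormAux]))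

theorem cpSesq_tmul (Φ : A →CP Elem N) (x y : A) (ξ η : K) :
    cpSesq Φ (x ⊗ₜ ξ) (y ⊗ₜ η) = inner ℂ η (op Φ (star y * x) ξ) := rfl

theorem exists_eq_star_mul {B : Type*} [NonUnitalCStarAlgebra B] [PartialOrder B]
    [StarOrderedRing B] {x : B} (hx : 0 ≤ x) : ∃ y, x = star y * y :=
  CStarAlgebra.nonneg_iff_eq_star_mul_self.1 hx

theorem cpSesq_nonneg (Φ : A →CP Elem N) (ζ : A ⊗[ℂ] K) : 0 ≤ cpSesq Φ ζ ζ := by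
  obtain ⟨n, x, ξ, rfl⟩ : ∃ (n : ℕ) (x : Fin n → A) (ξ : Fin n → K), ζ = ∑ i, x i ⊗ₜ ξ i := by
    obtain ⟨S, hS⟩ := TensorProduct.exists_finset ζ
    refine ⟨S.card, fun i => (S.equivFin.symm i).1.1, fun i => (S.equivFin.symm i).1.2, ?_⟩
    rw [hS, ← Finset.sum_coe_sort]
    exact (Equiv.sum_comp S.equivFin.symm (fun p : S => p.1.1 ⊗ₜ[ℂ] p.1.2)).symm
  let X : CStarMatrix (Fin n) (Fin n) A := CStarMatrix.ofMatrix fun i j => star (x i) * x j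
  let Z : CStarMatrix (Fin n) (Fin n) A :=
    CStarMatrix.ofMatrix fun k i => if (k : ℕ) = 0 then x i else 0
  have hX : 0 ≤ X := by
    have : X = star Z * Z := by
      ext i j
      rcases n with _ | n
      · exact i.elim0
      · have hZ : ∀ k l, Z k l = if (k : ℕ) = 0 then x l else 0 := fun _ _ => rfl
        rw [CStarMatrix.mul_apply, Fin.sum_univ_succ]
        simp only [CStarMatrix.star_apply, hZ]
        simp
        rfl
    rw [this]
    exact star_mul_self_nonneg Z
  obtain ⟨Y, hY⟩ := exists_eq_star_mul (Φ.map_cstarMatrix_nonneg' n X hX)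
  have hY' : ∀ i j, Φ (star (x i) * x j) = ∑ k, star (Y k i) * Y k j := fun i j => by
    have h := congrFun (congrFun hY i) j
    rw [CStarMatrix.mul_apply] at h
    exact h
  have key : cpSesq Φ (∑ i, x i ⊗ₜ ξ i) (∑ i, x i ⊗ₜ ξ i) =
      ∑ k, inner ℂ (∑ i, (Y k i).val (ξ i)) (∑ i, (Y k i).val (ξ i)) := by
    simp only [map_sum, LinearMap.sum_apply, cpSesq_tmul, op, hY', sum_inner, inner_sum,
      sum_apply, map_mul, map_star, mul_apply_eq_comp,
      ContinuousLinearMap.star_eq_adjoint, ContinuousLinearMap.adjoint_inner_right]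
    calc _ = ∑ i, ∑ k, ∑ j, inner ℂ ((Y k i).val (ξ i)) ((Y k j).val (ξ j)) :=
          Finset.sum_congr rfl fun i _ => Finset.sum_comm
      _ = ∑ k, ∑ i, ∑ j, inner ℂ ((Y k i).val (ξ i)) ((Y k j).val (ξ j)) := Finset.sum_comm
      _ = _ := Finset.sum_congr rfl fun k _ => Finset.sum_comm
  rw [key]
  exact Finset.sum_nonneg fun k _ =>
    Complex.nonneg_iff.2 ⟨inner_self_nonneg (𝕜 := ℂ), (inner_self_im (𝕜 := ℂ) _).symm⟩

/-- The positive sesquilinear form of a completely positive map. -/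
def cpForm (Φ : A →CP Elem N) : PosForm (A ⊗[ℂ] K) := ⟨cpSesq Φ, cpSesq_nonneg Φ⟩

instance : Zero (A →CP Elem N) :=
  ⟨{ (0 : A →ₗ[ℂ] Elem N) with
      map_cstarMatrix_nonneg' := fun k M _ => by
        have : M.map (0 : A →ₗ[ℂ] Elem N) = 0 := by ext i j; rfl
        exact this.ge }⟩

/-- `Θ` is the connection `Φ σ_f Ψ`: its form is the connection of the forms of `Φ` and `Ψ`
for the data `a`, `b`, `μ` that represent `f`. -/
def IsConnection (f : ℝ → ℝ) (Φ Ψ Θ : A →CP Elem N) : Prop :=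
  ∃ (a b : ℝ) (μ : Measure ℝ), IsLoewnerRep f a b μ ∧
    ∀ ζ ζ', cpForm Θ ζ ζ' = formConnection a b μ (cpForm Φ) (cpForm Ψ) ζ ζ'

open Classical in
/-- The connection `Φ σ_f Ψ`, the completely positive map whose form is the connection of the
forms of `Φ` and `Ψ` (it exists and is unique for every operator monotone `f ≥ 0`). -/
def connection (f : ℝ → ℝ) (Φ Ψ : A →CP Elem N) : A →CP Elem N :=
  if h : ∃ Θ, IsConnection f Φ Ψ Θ then h.choose else 0

/-- The `α`-power mean `Φ #_α Ψ`, the connection of the operator monotone function `t ↦ t ^ α`. -/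
def powerMean (α : ℝ) (Φ Ψ : A →CP Elem N) : A →CP Elem N :=
  connection (fun t => t ^ α) Φ Ψ

end Connection

/-! ### Tensor products -/

section Tensor

/-- The Hilbert space tensor product. -/
def HTensor (H₁ H₂ : Type*) [NormedAddCommGroup H₁] [InnerProductSpace ℂ H₁]
    [NormedAddCommGroup H₂] [InnerProductSpace ℂ H₂] : Type _ := Completion (H₁ ⊗[ℂ] H₂)

section Spaces

variable {H₁ H₂ : Type*} [NormedAddCommGroup H₁] [InnerProductSpace ℂ H₁]
  [NormedAddCommGroup H₂] [InnerProductSpace ℂ H₂]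

instance : NormedAddCommGroup (HTensor H₁ H₂) :=
  inferInstanceAs (NormedAddCommGroup (Completion (H₁ ⊗[ℂ] H₂)))
instance : InnerProductSpace ℂ (HTensor H₁ H₂) :=
  inferInstanceAs (InnerProductSpace ℂ (Completion (H₁ ⊗[ℂ] H₂)))
instance : CompleteSpace (HTensor H₁ H₂) :=
  inferInstanceAs (CompleteSpace (Completion (H₁ ⊗[ℂ] H₂)))

/-- The elementary tensor `ξ ⊗ η` in the Hilbert space tensor product. -/
def HTensor.tmul (ξ : H₁) (η : H₂) : HTensor H₁ H₂ :=
  ((ξ ⊗ₜ[ℂ] η : H₁ ⊗[ℂ] H₂) : Completion (H₁ ⊗[ℂ] H₂))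

/-- The tensor product `a ⊗ b` of bounded operators on the Hilbert space tensor product. -/
def opTensor (a : H₁ →L[ℂ] H₁) (b : H₂ →L[ℂ] H₂) : HTensor H₁ H₂ →L[ℂ] HTensor H₁ H₂ :=
  (TensorProduct.mapL a b).completion

theorem opTensor_tmul (a : H₁ →L[ℂ] H₁) (b : H₂ →L[ℂ] H₂) (ξ : H₁) (η : H₂) :
    opTensor a b (HTensor.tmul ξ η) = HTensor.tmul (a ξ) (b η) :=
  ContinuousLinearMap.completion_apply_coe _ _

end Spaces

variable {H₁ H₂ K₁ K₂ : Type*}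
  [NormedAddCommGroup H₁] [InnerProductSpace ℂ H₁] [CompleteSpace H₁]
  [NormedAddCommGroup H₂] [InnerProductSpace ℂ H₂] [CompleteSpace H₂]
  [NormedAddCommGroup K₁] [InnerProductSpace ℂ K₁] [CompleteSpace K₁]
  [NormedAddCommGroup K₂] [InnerProductSpace ℂ K₂] [CompleteSpace K₂]

/-- The elementary tensors `a ⊗ b` with `a ∈ M₁` and `b ∈ M₂`. -/
def elementary (M₁ : VonNeumannAlgebra H₁) (M₂ : VonNeumannAlgebra H₂) :
    Set (HTensor H₁ H₂ →L[ℂ] HTensor H₁ H₂) :=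
  {z | ∃ a ∈ M₁, ∃ b ∈ M₂, z = opTensor a b}

/-- The spatial (minimal) C⋆-tensor product of `M₁` and `M₂`: the norm closure of the ⋆-algebra
generated by the elementary tensors (which is their linear span). -/
def cstarTensor (M₁ : VonNeumannAlgebra H₁) (M₂ : VonNeumannAlgebra H₂) :
    StarSubalgebra ℂ (HTensor H₁ H₂ →L[ℂ] HTensor H₁ H₂) :=
  (StarAlgebra.adjoin ℂ (elementary M₁ M₂)).topologicalClosure

instance (M₁ : VonNeumannAlgebra H₁) (M₂ : VonNeumannAlgebra H₂) :
    IsClosed (cstarTensor M₁ M₂ : Set (HTensor H₁ H₂ →L[ℂ] HTensor H₁ H₂)) :=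
  StarSubalgebra.isClosed_topologicalClosure _

/-- The von Neumann algebra tensor product of `M₁` and `M₂`: the double commutant of the
⋆-algebra generated by the elementary tensors. -/
def vnTensor (M₁ : VonNeumannAlgebra H₁) (M₂ : VonNeumannAlgebra H₂) :
    VonNeumannAlgebra (HTensor H₁ H₂) where
  toStarSubalgebra := StarSubalgebra.centralizer ℂ
    (StarSubalgebra.centralizer ℂ (elementary M₁ M₂) :
      Set (HTensor H₁ H₂ →L[ℂ] HTensor H₁ H₂))
  centralizer_centralizer' := by
    simp

theorem opTensor_mem_cstarTensor {M₁ : VonNeumannAlgebra H₁} {M₂ : VonNeumannAlgebra H₂}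
    (a : Elem M₁) (b : Elem M₂) :
    opTensor a.val b.val ∈ cstarTensor M₁ M₂ :=
  StarSubalgebra.le_topologicalClosure _
    (StarAlgebra.subset_adjoin ℂ _ ⟨_, a.2, _, b.2, rfl⟩)

theorem opTensor_mem_vnTensor {M₁ : VonNeumannAlgebra H₁} {M₂ : VonNeumannAlgebra H₂}
    (a : Elem M₁) (b : Elem M₂) :
    opTensor a.val b.val ∈ (vnTensor M₁ M₂).toStarSubalgebra := by
  have h : opTensor a.val b.val ∈ elementary M₁ M₂ := ⟨_, a.2, _, b.2, rfl⟩
  refine StarSubalgebra.mem_centralizer_iff ℂ |>.2 fun g hg => ?_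
  have h1 := (StarSubalgebra.mem_centralizer_iff ℂ).1 hg _ h
  have h2 := (StarSubalgebra.mem_centralizer_iff ℂ).1 (star_mem hg) _ h
  exact ⟨h1.1.symm, h2.1.symm⟩

variable {M₁ : VonNeumannAlgebra H₁} {M₂ : VonNeumannAlgebra H₂}
  {N₁ : VonNeumannAlgebra K₁} {N₂ : VonNeumannAlgebra K₂}

/-- `Φ`, defined on the C⋆-tensor product, satisfies `Φ(x₁ ⊗ x₂) = Φ₁(x₁) ⊗ Φ₂(x₂)`. -/
def IsCstarTensorMap (Φ₁ : Elem M₁ →CP Elem N₁) (Φ₂ : Elem M₂ →CP Elem N₂)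
    (Φ : OpAlg (cstarTensor M₁ M₂) →CP Elem (vnTensor N₁ N₂)) : Prop :=
  ∀ (x₁ : Elem M₁) (x₂ : Elem M₂),
    op Φ ⟨_, opTensor_mem_cstarTensor x₁ x₂⟩ = opTensor (op Φ₁ x₁) (op Φ₂ x₂)

open Classical in
/-- The tensor product `Φ₁ ⊗ Φ₂` of completely positive maps, on the C⋆-tensor product: the
completely positive map with `(Φ₁ ⊗ Φ₂)(x₁ ⊗ x₂) = Φ₁(x₁) ⊗ Φ₂(x₂)` (it always exists and is
unique). -/
def cstarTensorMap (Φ₁ : Elem M₁ →CP Elem N₁) (Φ₂ : Elem M₂ →CP Elem N₂) :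
    OpAlg (cstarTensor M₁ M₂) →CP Elem (vnTensor N₁ N₂) :=
  if h : ∃ Φ, IsCstarTensorMap Φ₁ Φ₂ Φ then h.choose else 0

/-- `ω` is an ultraweakly continuous functional on `M`:
`ω(x) = ∑ ⟨x ξₙ, ηₙ⟩` with `∑ ‖ξₙ‖² < ∞` and `∑ ‖ηₙ‖² < ∞`. -/
def IsUltraweak (M : VonNeumannAlgebra H₁) (ω : Elem M → ℂ) : Prop :=
  ∃ ξ η : ℕ → H₁, (Summable fun n => ‖ξ n‖ ^ 2) ∧ (Summable fun n => ‖η n‖ ^ 2) ∧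
    ∀ x : Elem M, HasSum (fun n => inner ℂ (η n) (x.val (ξ n))) (ω x)

/-- A completely positive map between von Neumann algebras is normal if it is continuous for the
ultraweak topologies: it pulls ultraweakly continuous functionals back to such functionals. -/
def IsNormal (Φ : Elem M₁ →CP Elem N₁) : Prop :=
  ∀ ω : Elem N₁ → ℂ, IsUltraweak N₁ ω → IsUltraweak M₁ (fun x => ω (Φ x))

/-- `Φ`, defined on the von Neumann algebra tensor product, is normal and satisfies
`Φ(x₁ ⊗ x₂) = Φ₁(x₁) ⊗ Φ₂(x₂)`. -/
def IsNormalTensorMap (Φ₁ : Elem M₁ →CP Elem N₁) (Φ₂ : Elem M₂ →CP Elem N₂)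
    (Φ : Elem (vnTensor M₁ M₂) →CP Elem (vnTensor N₁ N₂)) : Prop :=
  IsNormal Φ ∧ ∀ (x₁ : Elem M₁) (x₂ : Elem M₂),
    op Φ ⟨_, opTensor_mem_vnTensor x₁ x₂⟩ = opTensor (op Φ₁ x₁) (op Φ₂ x₂)

open Classical in
/-- The tensor product `Φ₁ ⊗ Φ₂` of normal completely positive maps, on the von Neumann algebra
tensor product: the normal completely positive map with
`(Φ₁ ⊗ Φ₂)(x₁ ⊗ x₂) = Φ₁(x₁) ⊗ Φ₂(x₂)` (it exists and is unique for normal `Φ₁`, `Φ₂`). -/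
def normalTensorMap (Φ₁ : Elem M₁ →CP Elem N₁) (Φ₂ : Elem M₂ →CP Elem N₂) :
    Elem (vnTensor M₁ M₂) →CP Elem (vnTensor N₁ N₂) :=
  if h : ∃ Φ, IsNormalTensorMap Φ₁ Φ₂ Φ then h.choose else 0

end Tensor

end CPMean

end

noncomputable section

namespace CPMean

/-! ### The functional calculus of a pair of forms -/

namespace PosForm

variable {V : Type*} [AddCommGroup V] [Module ℂ V]

/-! On the Hilbert space of `φ + ψ` a pair of positive forms is governed by one operator `0 ≤ C ≤
1`: `C` represents `φ` and `1 - C` represents `ψ`. Every parallel sum `(l φ) : ψ` can be computed on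
this same space, so the integral that defines the power mean collapses to the operator `C ^ (1 - α)
* (1 - C) ^ α` (`PosForm.formConnection_eq`). Hence the mean does not depend on the representing
measure. This operator is compatible with left multiplication by `A` and with the commutant of `N`,
so its square root yields a dilation and the mean exists as a completely positive map
(`exists_isConnection_rpow`, `cpForm_powerMean`).

For the tensor products, let `C₁`, `C₂` belong to the two pairs `(Φ₁, Ψ₁)`, `(Φ₂, Ψ₂)` and `C` to
the pair of tensor product maps. The form of a tensor product map is, on elementary tensors, the
product of the forms. This gives an operator `T` with dense range from the tensor product of the two
Hilbert spaces to the third, with `T⋆ C T = C₁ ⊗ C₂` and `T⋆ (1 - C) T = (1 - C₁) ⊗ (1 - C₂)`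
(`exists_tensor_intertwiner`). In general `T` is not an isometry: `T⋆ T` is the sum of these two
operators and lacks the cross terms of `1`. But the two operators commute, and this forces `C` to
commute with `T T⋆`, so that products of conjugates are under control: each multiplication costs one
factor `T⋆ T`.

For `α = k / (n + 1)` the `(n + 1)`-st power of `C ^ (1 - α) * (1 - C) ^ α` is a monomial in `C` and
`1 - C`. So the conjugate of this operator by `T` and the tensor product of its analogues for `C₁`
and `C₂` are positive operators with the same `(n + 1)`-st power, hence equal
(`conjOp_cfc_powerFun_div`). Norm continuity in `α` on the open interval gives the other exponents
(`inner_cfc_powerFun_tensor`), and the matrix coefficients give the identity on elementary tensors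
(`op_powerMean_tensor`).

The rest is existence, uniqueness and density. Tensor products of Stinespring families are bounded
for the spatial norm (`norm_stineTensor_le`) and so extend to the spatial tensor product. Normality
of `Φ` is expressed by vectors: each `⟨ζ, Φ(x) ζ⟩` is a vector functional of the amplification of
the identity representation. A positive functional dominated by one of this kind is again of this
kind (`exists_vector_of_le`). Hence power means of normal maps are normal, and maps extend along the
ultrastrong limits supplied by the density theorem (`exists_isUWMap_extension`). -/

/-- The canonical map into the Hilbert space of a form, as a linear map. -/
def hLin (γ : PosForm V) : V →ₗ[ℂ] γ.Hilbert where
  toFun := γ.h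
  map_add' x y := Completion.coe_add (α := γ.Space) x y
  map_smul' c x := Completion.coe_smul (X := γ.Space) c x

@[simp] theorem hLin_apply (γ : PosForm V) (x : V) : γ.hLin x = γ.h x := rfl

theorem h_add (γ : PosForm V) (x y : V) : γ.h (x + y) = γ.h x + γ.h y := γ.hLin.map_add x y

theorem h_smul (γ : PosForm V) (c : ℂ) (x : V) : γ.h (c • x) = c • γ.h x := γ.hLin.map_smul c x

theorem h_zero (γ : PosForm V) : γ.h 0 = 0 := γ.hLin.map_zero

theorem norm_sq_h (γ : PosForm V) (x : V) : ‖γ.h x‖ ^ 2 = (γ.form x x).re := by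
  rw [← inner_h, ← inner_self_eq_norm_sq (𝕜 := ℂ)]; rfl

theorem add_form (α β : PosForm V) (x y : V) : (α + β).form x y = α.form x y + β.form x y := rfl

/-- Vectors of the Hilbert space of a form are determined by their inner products with the image
of the canonical map. -/
theorem ext_inner_h {γ : PosForm V} {u v : γ.Hilbert}
    (huv : ∀ y, inner ℂ (γ.h y) u = inner ℂ (γ.h y) v) : u = v :=
  ext_inner_left ℂ fun w => γ.denseRange_h.induction_on w
    (isClosed_eq (by fun_prop) (by fun_prop)) huv

theorem clm_ext_h {γ : PosForm V} {E : Type*} [NormedAddCommGroup E] [NormedSpace ℂ E]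
    {S T : γ.Hilbert →L[ℂ] E} (hST : ∀ x, S (γ.h x) = T (γ.h x)) : S = T :=
  ContinuousLinearMap.ext fun u => γ.denseRange_h.induction_on u
    (isClosed_eq S.continuous T.continuous) hST

theorem reprOp_nonneg (α β : PosForm V) : 0 ≤ reprOp α β := by
  rw [ContinuousLinearMap.nonneg_iff_isPositive]
  exact ContinuousLinearMap.isPositive_adjoint_comp_self _

theorem isSelfAdjoint_reprOp (α β : PosForm V) : IsSelfAdjoint (reprOp α β) :=
  .of_nonneg (reprOp_nonneg α β)

/-- The complement `1 - reprOp α β` represents the positive form `β` on a dense set of vectors. -/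
theorem reprOp_le_one (α β : PosForm V) : reprOp α β ≤ 1 := by
  rw [ContinuousLinearMap.le_def]
  rw [ContinuousLinearMap.isPositive_iff']
  refine ⟨(IsSelfAdjoint.one _).sub (isSelfAdjoint_reprOp α β), fun u => ?_⟩
  refine (α + β).denseRange_h.induction_on u
    (isClosed_le continuous_const (by fun_prop)) fun x => ?_
  have h2 := inner_conj_symm (𝕜 := ℂ) ((1 - reprOp α β) ((α + β).h x)) ((α + β).h x)
  rw [show inner ℂ ((1 - reprOp α β) ((α + β).h x)) ((α + β).h x) = β.form x x by
    rw [← h2, repr_right, conj_symm]]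
  exact β.nonneg x

theorem spectrum_reprOp (α β : PosForm V) : spectrum ℝ (reprOp α β) ⊆ Set.Icc 0 1 := fun t ht =>
  ⟨spectrum_nonneg_of_nonneg (reprOp_nonneg α β) ht,
    (le_algebraMap_iff_spectrum_le (r := (1 : ℝ)) (isSelfAdjoint_reprOp α β)).1
      (by simpa using reprOp_le_one α β) t ht⟩

/-- The two representing operators add up to `1`, so the denominator of `r s / (r + s)` disappears.
-/
theorem parallelSum_eq (α β : PosForm V) (x y : V) : parallelSum α β x y =
    inner ℂ ((α + β).h y) ((reprOp α β * (1 - reprOp α β)) ((α + β).h x)) := by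
  have h1 : (fun t : ℝ => t * (1 - t) / (t + (1 - t))) = fun t => t * (1 - t) := by
    ext t; simp
  have hA := isSelfAdjoint_reprOp α β
  rw [parallelSum, pwCalculus, h1, cfc_mul (fun t : ℝ => t) (fun t => 1 - t), cfc_id' ℝ _,
    cfc_sub (fun _ : ℝ => (1 : ℝ)) (fun t => t), cfc_id' ℝ _, cfc_const_one ℝ _]

/-! ### Symmetries of a pair of forms -/

section Commutation

variable {α β : PosForm V}

/-- The bounded operator on the Hilbert space of `γ` induced by a linear map of `V` that preserves
`γ`. -/
def lift (γ : PosForm V) (D : V →ₗ[ℂ] V) (hD : ∀ x, γ.form (D x) (D x) = γ.form x x) :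
    γ.Hilbert →L[ℂ] γ.Hilbert :=
  ContinuousLinearMap.completion
    (LinearMap.mkContinuous (show γ.Space →ₗ[ℂ] γ.Space from D) 1 (fun x => by
      rw [one_mul]
      have h1 := γ.norm_sq_space x
      have h2 := γ.norm_sq_space (D x)
      rw [hD x] at h2
      exact le_of_sq_le_sq (h2.trans h1.symm).le (norm_nonneg _)))

theorem lift_h (γ : PosForm V) (D : V →ₗ[ℂ] V) (hD : ∀ x, γ.form (D x) (D x) = γ.form x x)
    (x : V) : γ.lift D hD (γ.h x) = γ.h (D x) :=
  ContinuousLinearMap.completion_apply_coe _ _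

/-- The operator induced by a linear map of `V` which has an adjoint with respect to both forms
commutes with the functional calculus. -/
theorem commute_lift_cfc {D D' : V →ₗ[ℂ] V}
    (hα : ∀ x y, α.form (D x) y = α.form x (D' y)) (hβ : ∀ x y, β.form (D x) y = β.form x (D' y))
    (hD : ∀ x, (α + β).form (D x) (D x) = (α + β).form x x) (f : ℝ → ℝ) :
    Commute (cfc f (reprOp α β)) ((α + β).lift D hD) := by
  -- The adjoint of the lift of `D` sends `h y` to `h (D' y)`. No bound on `D'` is needed, as it is
  -- applied only to vectors of `V`.
  have key : ∀ (y : V) (u : (α + β).Hilbert),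
      inner ℂ ((α + β).h y) ((α + β).lift D hD u) = inner ℂ ((α + β).h (D' y)) u := by
    intro y u
    refine (α + β).denseRange_h.induction_on u (isClosed_eq (by fun_prop) (by fun_prop)) ?_
    intro x
    rw [lift_h, inner_h, inner_h, add_form, add_form, hα, hβ]
  refine (isSelfAdjoint_reprOp α β).commute_cfc ?_ f
  refine clm_ext_h fun x => ext_inner_h fun y => ?_
  change inner ℂ _ (reprOp α β ((α + β).lift D hD _)) =
    inner ℂ _ ((α + β).lift D hD (reprOp α β _))
  rw [lift_h, repr_left, key, repr_left, hα]

/-- Adjoint relations for two forms pass to every function of the operator that represents them.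
This serves twice: for left multiplication by unitaries of `A` and for unitaries of the commutant of
`N`. -/
theorem inner_cfc_reprOp_adjoint {D D' : V →ₗ[ℂ] V}
    (hα : ∀ x y, α.form (D x) y = α.form x (D' y)) (hβ : ∀ x y, β.form (D x) y = β.form x (D' y))
    (hD : ∀ x, (α + β).form (D x) (D x) = (α + β).form x x) (f : ℝ → ℝ) (x y : V) :
    inner ℂ ((α + β).h y) (cfc f (reprOp α β) ((α + β).h (D x))) =
      inner ℂ ((α + β).h (D' y)) (cfc f (reprOp α β) ((α + β).h x)) := by
  have key : ∀ (u : (α + β).Hilbert),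
      inner ℂ ((α + β).h y) ((α + β).lift D hD u) = inner ℂ ((α + β).h (D' y)) u := by
    intro u
    refine (α + β).denseRange_h.induction_on u (isClosed_eq (by fun_prop) (by fun_prop)) ?_
    intro x
    rw [lift_h, inner_h, inner_h, add_form, add_form, hα, hβ]
  rw [← key, ← lift_h (α + β) D hD]
  congr 1
  exact congrArg (fun T : (α + β).Hilbert →L[ℂ] (α + β).Hilbert => T ((α + β).h x))
    (commute_lift_cfc hα hβ hD f).eq

end Commutation

end PosForm

/-! ### Change of representation -/

section Conjugation

variable {E F : Type*} [NormedAddCommGroup E] [InnerProductSpace ℂ E] [CompleteSpace E]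
  [NormedAddCommGroup F] [InnerProductSpace ℂ F] [CompleteSpace F]

open ContinuousLinearMap (adjoint)

/-- The operator `T⋆ X T`. -/
def conjOp (T : E →L[ℂ] F) (X : F →L[ℂ] F) : E →L[ℂ] E := adjoint T ∘L X ∘L T

theorem conjOp_apply (T : E →L[ℂ] F) (X : F →L[ℂ] F) (u : E) :
    conjOp T X u = adjoint T (X (T u)) := rfl

theorem inner_conjOp (T : E →L[ℂ] F) (X : F →L[ℂ] F) (u v : E) :
    inner ℂ u (conjOp T X v) = inner ℂ (T u) (X (T v)) := by
  rw [conjOp_apply, ContinuousLinearMap.adjoint_inner_right]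

theorem conjOp_nonneg (T : E →L[ℂ] F) {X : F →L[ℂ] F} (hX : 0 ≤ X) : 0 ≤ conjOp T X := by
  rw [ContinuousLinearMap.nonneg_iff_isPositive] at hX ⊢
  exact hX.adjoint_conj T

theorem injective_adjoint {T : E →L[ℂ] F} (hT : DenseRange T) :
    Function.Injective (adjoint T) := fun u v huv =>
  ext_inner_left ℂ fun w => hT.induction_on w
    (isClosed_eq (by fun_prop) (by fun_prop)) fun x => by
      rw [← ContinuousLinearMap.adjoint_inner_right, huv,
        ContinuousLinearMap.adjoint_inner_right]

/-- With `P = T T⋆`, multiplying the given commutation by `T` on the left and `T⋆` on the right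
yields `P (C P - P C) P = 0`. Density of the range makes `T⋆`, hence `P`, injective, so the left `P`
cancels; the right one cancels after taking adjoints. -/
theorem commute_of_commute_conjOp {T : E →L[ℂ] F} (hT : DenseRange T) {C : F →L[ℂ] F}
    (hC : Commute (conjOp T C) (conjOp T 1)) : Commute C (T ∘L adjoint T) := by
  set P : F →L[ℂ] F := T ∘L adjoint T with hP
  have hPs : star P = P := by
    rw [ContinuousLinearMap.star_eq_adjoint, hP, ContinuousLinearMap.adjoint_comp,
      ContinuousLinearMap.adjoint_adjoint]
  have hPinj : ∀ Z : F →L[ℂ] F, P * Z = 0 → Z = 0 := by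
    intro Z hZ
    ext u
    apply injective_adjoint hT
    rw [zero_apply, map_zero]
    have h1 : P (Z u) = 0 := congrArg (fun S : F →L[ℂ] F => S u) hZ
    have h2 : inner ℂ (Z u) (P (Z u)) = (0 : ℂ) := by rw [h1, inner_zero_right]
    rw [hP, ContinuousLinearMap.comp_apply, ← ContinuousLinearMap.adjoint_inner_left] at h2
    exact inner_self_eq_zero.1 h2
  have h1 : P * (C * P - P * C) * P = 0 := by
    have h2 : P * (C * P) * P = P * (P * C) * P := by
      ext u
      have := congrArg (fun S : E →L[ℂ] E => T (S (adjoint T u))) hC.eq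
      exact this
    rw [mul_sub, sub_mul, h2, sub_self]
  have h2 : (C * P - P * C) * P = 0 := hPinj _ (by rw [← mul_assoc, h1])
  have h3 : star (C * P - P * C) = 0 := hPinj _ (by
    have := congrArg star h2
    rwa [star_mul, star_zero, hPs] at this)
  exact sub_eq_zero.1 (star_eq_zero.1 h3)

/-- In `T⋆ X (T T⋆) Y T` the middle factor moves to the left of `X`, where it completes a factor `T⋆
T`. -/
theorem conjOp_mul_conjOp {T : E →L[ℂ] F} {X : F →L[ℂ] F} (hX : Commute X (T ∘L adjoint T))
    (Y : F →L[ℂ] F) : conjOp T X * conjOp T Y = conjOp T 1 * conjOp T (X * Y) := by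
  ext u
  have := congrArg (fun S : F →L[ℂ] F => adjoint T (S (Y (T u)))) hX.eq
  exact this

theorem commute_conjOp_one {T : E →L[ℂ] F} {X : F →L[ℂ] F}
    (hX : Commute X (T ∘L adjoint T)) : Commute (conjOp T X) (conjOp T 1) := by
  rw [commute_iff_eq, conjOp_mul_conjOp hX, mul_one]

theorem conjOp_pow_mul {T : E →L[ℂ] F} {X : F →L[ℂ] F} (hX : Commute X (T ∘L adjoint T))
    (Y : F →L[ℂ] F) (n j : ℕ) :
    conjOp T X ^ j * (conjOp T 1 ^ n * conjOp T Y) = conjOp T 1 ^ (n + j) * conjOp T (X ^ j * Y) := by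
  induction j with
  | zero => simp
  | succ j ih =>
    rw [pow_succ', mul_assoc, ih, ← mul_assoc, ((commute_conjOp_one hX).pow_right _).eq, mul_assoc,
      conjOp_mul_conjOp hX, ← mul_assoc, ← pow_succ, pow_succ' X, mul_assoc X, add_assoc]

theorem conjOp_pow_succ {T : E →L[ℂ] F} {X : F →L[ℂ] F} (hX : Commute X (T ∘L adjoint T))
    (n : ℕ) : conjOp T X ^ (n + 1) = conjOp T 1 ^ n * conjOp T (X ^ (n + 1)) := by
  have := conjOp_pow_mul hX X 0 n
  rwa [pow_zero, one_mul, ← pow_succ, zero_add, ← pow_succ] at this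

/-- A product of `n + 1` conjugates has `n` inner factors `T T⋆`, whence the exponent `n` of `T⋆ T`.
The later comparison of powers cancels no such factor: it reads this identity once in each
direction. -/
theorem conjOp_pow_mul_pow {T : E →L[ℂ] F} {X Y : F →L[ℂ] F}
    (hX : Commute X (T ∘L adjoint T)) (hY : Commute Y (T ∘L adjoint T)) {j k n : ℕ}
    (hn : j + k = n + 1) :
    conjOp T X ^ j * conjOp T Y ^ k = conjOp T 1 ^ n * conjOp T (X ^ j * Y ^ k) := by
  cases k with
  | zero =>
    obtain rfl : j = n + 1 := by simpa using hn
    simp [conjOp_pow_succ hX]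
  | succ k =>
    rw [conjOp_pow_succ hY, conjOp_pow_mul hX]
    congr 2
    omega

end Conjugation

/-- A linear map defined on a dense image, if bounded, extends to the whole space. -/
theorem exists_clm_of_denseRange {W E F : Type*} [AddCommGroup W] [Module ℂ W]
    [NormedAddCommGroup E] [NormedSpace ℂ E] [NormedAddCommGroup F] [NormedSpace ℂ F]
    [CompleteSpace F] (e : W →ₗ[ℂ] E) (f : W →ₗ[ℂ] F) (he : DenseRange e) (c : ℝ)
    (hc : ∀ w, ‖f w‖ ≤ c * ‖e w‖) : ∃ T : E →L[ℂ] F, ∀ w, T (e w) = f w :=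
  ⟨f.extendOfNorm e, f.extendOfNorm_eq he ⟨c, hc⟩⟩

/-! ### Comparison with an arbitrary representation of the two forms -/

namespace PosForm

variable {V W : Type*} [AddCommGroup V] [Module ℂ V] [AddCommGroup W] [Module ℂ W]
variable {E : Type*} [NormedAddCommGroup E] [InnerProductSpace ℂ E] [CompleteSpace E]

/-- Any representation of a pair of forms by two operators is intertwined with the standard
one. -/
theorem exists_intertwiner (α β : PosForm V) (e : W →ₗ[ℂ] E) (he : DenseRange e)
    (i : W →ₗ[ℂ] V) (hi : DenseRange fun w => (α + β).h (i w)) (A B : E →L[ℂ] E)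
    (hA : ∀ v w, α.form (i v) (i w) = inner ℂ (e w) (A (e v)))
    (hB : ∀ v w, β.form (i v) (i w) = inner ℂ (e w) (B (e v))) :
    ∃ T : E →L[ℂ] (α + β).Hilbert, DenseRange T ∧ (∀ w, T (e w) = (α + β).h (i w)) ∧
      conjOp T 1 = A + B ∧ conjOp T (reprOp α β) = A ∧ conjOp T (1 - reprOp α β) = B := by
  -- The constant is chosen to avoid a square root: `‖A + B‖ ≤ (‖A + B‖ + 1) ^ 2`.
  obtain ⟨T, hT⟩ := exists_clm_of_denseRange e ((α + β).hLin ∘ₗ i) he (‖A + B‖ + 1) (fun w => by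
    refine le_of_sq_le_sq ?_ (by positivity)
    change ‖(α + β).h (i w)‖ ^ 2 ≤ _
    rw [norm_sq_h, add_form, hA, hB, ← inner_add_right, mul_pow]
    refine (Complex.re_le_norm _).trans ((norm_inner_le_norm _ _).trans ?_)
    have h1 : ‖A (e w) + B (e w)‖ ≤ ‖A + B‖ * ‖e w‖ := (A + B).le_opNorm (e w)
    nlinarith [mul_le_mul_of_nonneg_left h1 (norm_nonneg (e w)), sq_nonneg (‖e w‖),
      norm_nonneg (A + B), mul_nonneg (norm_nonneg (A + B)) (sq_nonneg ‖e w‖),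
      mul_nonneg (sq_nonneg ‖A + B‖) (sq_nonneg ‖e w‖)])
  have hT' : ∀ w, T (e w) = (α + β).h (i w) := hT
  have key : ∀ (X : (α + β).Hilbert →L[ℂ] (α + β).Hilbert) (Y : E →L[ℂ] E),
      (∀ v w, inner ℂ ((α + β).h (i w)) (X ((α + β).h (i v))) = inner ℂ (e w) (Y (e v))) →
      conjOp T X = Y := by
    intro X Y hXY
    ext u
    refine he.induction_on u (isClosed_eq (by fun_prop) (by fun_prop)) fun v => ?_
    refine ext_inner_left ℂ fun w => he.induction_on w
      (isClosed_eq (by fun_prop) (by fun_prop)) fun w => ?_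
    rw [inner_conjOp, hT', hT', hXY]
  refine ⟨T, ?_, hT', ?_, ?_, ?_⟩
  · refine hi.mono ?_
    rintro _ ⟨w, rfl⟩
    exact ⟨e w, hT' w⟩
  · refine key _ _ fun v w => ?_
    change inner ℂ _ ((α + β).h (i v)) = _
    rw [inner_h, add_form, hA, hB, ← inner_add_right]; rfl
  · exact key _ _ fun v w => by rw [repr_left, hA]
  · exact key _ _ fun v w => by rw [repr_right, hB]

/-- If `T` intertwines the two representations and `C` is the standard operator, then `A * B = (A +
B) * (T⋆ C (1 - C) T)` by `conjOp_mul_conjOp`. The left inverse `D` of `A + B` isolates the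
conjugate of the parallel sum. -/
theorem parallelSum_eq_of_representation (α β : PosForm V) (e : W →ₗ[ℂ] E) (he : DenseRange e)
    (i : W →ₗ[ℂ] V) (hi : DenseRange fun w => (α + β).h (i w)) (A B D : E →L[ℂ] E)
    (hA : ∀ v w, α.form (i v) (i w) = inner ℂ (e w) (A (e v)))
    (hB : ∀ v w, β.form (i v) (i w) = inner ℂ (e w) (B (e v)))
    (hAB : Commute A B) (hD : D * (A + B) = 1) (v w : W) :
    parallelSum α β (i v) (i w) = inner ℂ (e w) ((D * A * B) (e v)) := by
  obtain ⟨T, hTd, hT, h1, hTA, hTB⟩ := exists_intertwiner α β e he i hi A B hA hB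
  have hc : Commute (reprOp α β) (T ∘L ContinuousLinearMap.adjoint T) :=
    commute_of_commute_conjOp hTd (by
      rw [h1, hTA]; exact (Commute.refl A).add_right hAB)
  have h2 := conjOp_mul_conjOp hc (1 - reprOp α β)
  rw [hTA, hTB, h1] at h2
  rw [parallelSum_eq, ← hT, ← hT, ← inner_conjOp, mul_assoc, h2, ← mul_assoc, hD, one_mul]

end PosForm

/-! ### The integral representation of the power functions -/

section Loewner

/-- For `0 < α < 1` take `a = b = 0` and the density `c * l ^ (α - 1) / (l + 1)` on the half-line.
Its denominator cancels the factor `1 + l` of the kernel, and `μ` is finite because the density is,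
up to `c`, the integrand of the power representation at `t = 1`. -/
theorem exists_isLoewnerRep_rpow {α : ℝ} (hα : α ∈ Set.Icc (0 : ℝ) 1) :
    ∃ (a b : ℝ) (μ : Measure ℝ), IsLoewnerRep (fun t => t ^ α) a b μ := by
  rcases eq_or_lt_of_le hα.1 with rfl | h0
  -- At `α = 0` the constant alone works, including at `t = 0`, since `0 ^ (0 : ℝ) = 1`.
  · exact ⟨1, 0, 0, zero_le_one, le_rfl, inferInstance, rfl, by simp⟩
  rcases eq_or_lt_of_le hα.2 with rfl | h1
  · exact ⟨0, 1, 0, le_rfl, zero_le_one, inferInstance, rfl, by simp⟩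
  have hp : α ∈ Set.Ioo (0 : ℝ) 1 := ⟨h0, h1⟩
  set c : ℝ := (∫ t in Set.Ioi 0, Real.rpowIntegrand₀₁ α t 1)⁻¹ with hc
  have hc0 : 0 ≤ c := (inv_pos.2 (Real.integral_rpowIntegrand₀₁_one_pos hp)).le
  let w : ℝ → ℝ≥0 := fun l => (c * (l ^ (α - 1) / (l + 1))).toNNReal
  have hw : Measurable w := by fun_prop
  have hint : IntegrableOn (fun l : ℝ => c * (l ^ (α - 1) / (l + 1))) (Set.Ioi 0) := by
    refine Integrable.const_mul ?_ c
    refine (Real.integrableOn_rpowIntegrand₀₁_Ioi hp zero_le_one).congr_fun (fun l hl => ?_)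
      measurableSet_Ioi
    rw [Real.rpowIntegrand₀₁_eqOn_pow_div hp zero_le_one hl]
    simp
  refine ⟨0, 0, (volume.restrict (Set.Ioi 0)).withDensity (fun l => w l), le_rfl, le_rfl,
    ?_, ?_, ?_⟩
  · exact isFiniteMeasure_withDensity_ofReal hint.2
  · refine withDensity_absolutelyContinuous _ _ ?_
    rw [Measure.restrict_apply measurableSet_Iic,
      Set.Iic_inter_Ioi, Set.Ioc_self, measure_empty]
  · intro t ht
    rw [zero_mul, zero_add, zero_add, Real.rpow_eq_const_mul_integral hp ht, ← hc,
      setIntegral_withDensity_eq_setIntegral_smul hw _ measurableSet_Ioi,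
      Measure.restrict_restrict measurableSet_Ioi, Set.inter_self, ← integral_const_mul]
    refine setIntegral_congr_fun measurableSet_Ioi fun l hl => ?_
    have hl : 0 < l := hl
    have h2 : 0 ≤ c * (l ^ (α - 1) / (l + 1)) := by positivity
    simp only [NNReal.smul_def, w, Real.coe_toNNReal _ h2, smul_eq_mul,
      Real.rpowIntegrand₀₁_eq_pow_div hp hl.le ht]
    have h3 : l + 1 ≠ 0 := by positivity
    have h4 : t + l ≠ 0 := by positivity
    have h5 : l + t ≠ 0 := by positivity
    field_simp
    ring

theorem scaled_denominator_pos {l t : ℝ} (hl : 0 < l) (ht : t ∈ Set.Icc (0 : ℝ) 1) :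
    0 < l * t + (1 - t) := by
  rcases eq_or_lt_of_le ht.1 with rfl | h
  · simp
  · have := mul_pos hl h
    linarith [ht.2]

/-- Denominator minus numerator is `l * t ^ 2 + (1 - t) ^ 2`. The bound is uniform in `l` and `t`,
so the finite measure `μ` gives domination both for scalars and in the functional calculus. -/
theorem connection_kernel_bound {l t : ℝ} (hl : 0 < l) (ht : t ∈ Set.Icc (0 : ℝ) 1) :
    ‖(1 + l) * t * (1 - t) / (l * t + (1 - t))‖ ≤ 1 := by
  have h := scaled_denominator_pos hl ht
  have h1 : 0 ≤ 1 - t := by linarith [ht.2]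
  have h2 := ht.1
  rw [Real.norm_of_nonneg (by positivity), div_le_one h]
  nlinarith [mul_nonneg hl.le (sq_nonneg t), sq_nonneg (1 - t)]

theorem continuousOn_connection_kernel :
    ContinuousOn (Function.uncurry fun l t : ℝ => (1 + l) * t * (1 - t) / (l * t + (1 - t)))
      (Set.Ioi 0 ×ˢ Set.Icc 0 1) := by
  refine ContinuousOn.div (by fun_prop) (by fun_prop) ?_
  rintro ⟨l, t⟩ ⟨hl, ht⟩
  exact (scaled_denominator_pos hl ht).ne'

/-- The homogeneous function `t ↦ t ^ (1 - α) (1 - t) ^ α` of the power mean, restricted to the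
segment `(t, 1 - t)`. -/
def powerFun (α t : ℝ) : ℝ := t ^ (1 - α) * (1 - t) ^ α

theorem continuous_powerFun {α : ℝ} (hα : α ∈ Set.Icc (0 : ℝ) 1) : Continuous (powerFun α) := by
  have h1 : 0 ≤ 1 - α := by linarith [hα.2]
  exact (continuous_id.rpow_const fun _ => Or.inr h1).mul
    ((continuous_const.sub continuous_id).rpow_const fun _ => Or.inr hα.1)

theorem powerFun_nonneg {α t : ℝ} (ht : t ∈ Set.Icc (0 : ℝ) 1) : 0 ≤ powerFun α t :=
  mul_nonneg (Real.rpow_nonneg ht.1 _) (Real.rpow_nonneg (by linarith [ht.2]) _)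

theorem powerFun_le_one {α t : ℝ} (hα : α ∈ Set.Icc (0 : ℝ) 1) (ht : t ∈ Set.Icc (0 : ℝ) 1) :
    powerFun α t ≤ 1 :=
  mul_le_one₀ (Real.rpow_le_one ht.1 ht.2 (by linarith [hα.2]))
    (Real.rpow_nonneg (by linarith [ht.2]) _)
    (Real.rpow_le_one (by linarith [ht.2]) (by linarith [ht.1]) hα.1)

/-- For `t > 0` this is the integral representation at `(1 - t) / t`, multiplied by `t`. The point
`t = 0`, where that quotient is meaningless, follows by continuity of both sides; the integral is
continuous by dominated convergence. -/
theorem IsLoewnerRep.powerFun_eq {α a b : ℝ} {μ : Measure ℝ} (hα : α ∈ Set.Icc (0 : ℝ) 1)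
    (h : IsLoewnerRep (fun t => t ^ α) a b μ) {t : ℝ} (ht : t ∈ Set.Icc (0 : ℝ) 1) :
    a * t + b * (1 - t) + ∫ l in Set.Ioi 0, (1 + l) * t * (1 - t) / (l * t + (1 - t)) ∂μ =
      powerFun α t := by
  have hμ := h.finite
  have key : Set.EqOn (fun t => a * t + b * (1 - t) +
      ∫ l in Set.Ioi 0, (1 + l) * t * (1 - t) / (l * t + (1 - t)) ∂μ) (powerFun α)
      (Set.Ioc 0 1) := by
    intro t ht
    have h0 : 0 < t := ht.1
    have h1 : 0 ≤ 1 - t := by linarith [ht.2]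
    have h2 := h.repr ((1 - t) / t) (by positivity)
    have h3 : powerFun α t = t * ((1 - t) / t) ^ α := by
      rw [powerFun, Real.div_rpow h1 h0.le, Real.rpow_sub h0, Real.rpow_one]
      ring
    have h7 : ∫ l in Set.Ioi 0, (1 + l) * t * (1 - t) / (l * t + (1 - t)) ∂μ =
        t * ∫ l in Set.Ioi 0, (1 - t) / t * (1 + l) / ((1 - t) / t + l) ∂μ := by
      rw [← integral_const_mul]
      refine setIntegral_congr_fun measurableSet_Ioi fun l hl => ?_
      have hl : 0 < l := hl
      have h4 := scaled_denominator_pos hl ⟨h0.le, ht.2⟩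
      have h6 : (1 - t) / t + l = (l * t + (1 - t)) / t := by field_simp; ring
      simp only [h6]
      field_simp
    simp only [h3, h2, h7]
    field_simp
  refine key.of_subset_closure ?_ (continuous_powerFun hα).continuousOn Set.Ioc_subset_Icc_self
    (by rw [closure_Ioc zero_ne_one]) ht
  refine ContinuousOn.add (by fun_prop) ?_
  refine continuousOn_of_dominated (bound := fun _ => 1) ?_ ?_ (integrable_const _) ?_
  · intro t _
    exact (Measurable.aestronglyMeasurable (by fun_prop))
  · intro t ht
    exact ae_restrict_of_forall_mem measurableSet_Ioi fun l hl => connection_kernel_bound hl ht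
  · refine ae_restrict_of_forall_mem measurableSet_Ioi fun l hl => ?_
    exact continuousOn_connection_kernel.comp (f := fun t => (l, t)) (by fun_prop)
      fun t ht => ⟨hl, ht⟩

end Loewner

/-! ### The power mean of two forms as a function of one operator -/

namespace PosForm

variable {V : Type*} [AddCommGroup V] [Module ℂ V]

/-- The operators `l • C` and `1 - C` represent `l α` and `β` on the Hilbert space of `α + β`, and
their sum is invertible because the spectrum of `C` lies in `[0, 1]`. So one Hilbert space serves
for all `l`. -/
theorem parallelSum_scale (α β : PosForm V) {l : ℝ} (hl : 0 < l) (x y : V) :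
    parallelSum (scale l.toNNReal α) β x y =
      inner ℂ ((α + β).h y)
        (cfc (fun t : ℝ => l * t * (1 - t) / (l * t + (1 - t))) (reprOp α β) ((α + β).h x)) := by
  set C := reprOp α β with hC
  have hsa := isSelfAdjoint_reprOp α β
  have hl' : ((l.toNNReal : ℝ≥0) : ℝ) = l := Real.coe_toNNReal _ hl.le
  have hden : ∀ t ∈ spectrum ℝ C, l * t + (1 - t) ≠ 0 := fun t ht =>
    (scaled_denominator_pos hl (spectrum_reprOp α β ht)).ne'
  have hcont : ContinuousOn (fun t : ℝ => (l * t + (1 - t))⁻¹) (spectrum ℝ C) :=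
    ContinuousOn.inv₀ (by fun_prop) hden
  have e1 : cfc (fun t : ℝ => l * t) C = l • C := by
    rw [cfc_const_mul l (fun t => t) C, cfc_id' ℝ C]
  have e2 : cfc (fun t : ℝ => 1 - t) C = 1 - C := by
    rw [cfc_sub (fun _ : ℝ => (1 : ℝ)) (fun t => t) C, cfc_id' ℝ C, cfc_const_one ℝ C]
  have e3 : cfc (fun t : ℝ => l * t + (1 - t)) C = l • C + (1 - C) := by
    rw [cfc_add C (fun t : ℝ => l * t) (fun t => 1 - t), e1, e2]
  have e4 : cfc (fun t : ℝ => (l * t + (1 - t))⁻¹) C * (l • C + (1 - C)) = 1 := by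
    rw [← e3, ← cfc_mul (fun t : ℝ => (l * t + (1 - t))⁻¹) (fun t => l * t + (1 - t)) C hcont
      (by fun_prop)]
    exact (cfc_congr fun t ht => inv_mul_cancel₀ (hden t ht)).trans (cfc_const_one ℝ C)
  have e5 : cfc (fun t : ℝ => l * t * (1 - t) / (l * t + (1 - t))) C =
      cfc (fun t : ℝ => (l * t + (1 - t))⁻¹) C * (l • C) * (1 - C) := by
    rw [← e1, ← e2, ← cfc_mul (fun t : ℝ => (l * t + (1 - t))⁻¹) (fun t => l * t) C hcont
        (by fun_prop),
      ← cfc_mul (fun t : ℝ => (l * t + (1 - t))⁻¹ * (l * t)) (fun t => 1 - t) C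
        (hcont.mul (by fun_prop)) (by fun_prop)]
    exact cfc_congr fun t _ => by ring
  rw [e5]
  refine parallelSum_eq_of_representation (scale l.toNNReal α) β (α + β).hLin (α + β).denseRange_h
    LinearMap.id (denseRange_h _) (l • C) (1 - C) _ ?_ ?_ ?_ e4 x y
  · intro v w
    change (((l.toNNReal : ℝ≥0) : ℝ) : ℂ) * α.form v w = inner ℂ ((α + β).h w) (l • C ((α + β).h v))
    rw [hl', hC, ← repr_left α β, inner_smul_right_eq_smul, Complex.real_smul]
  · intro v w
    exact (repr_right α β v w).symm
  · exact ((Commute.one_right C).sub_right (Commute.refl C)).smul_left l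

/-- Once all the parallel sums are functions of the same `C`, the integral over `l` can be taken
inside the functional calculus, where it is a scalar integral. The right-hand side no longer
mentions `a`, `b`, `μ`. -/
theorem formConnection_eq {α a b : ℝ} {μ : Measure ℝ} (hα : α ∈ Set.Icc (0 : ℝ) 1)
    (h : IsLoewnerRep (fun t => t ^ α) a b μ) (φ ψ : PosForm V) (x y : V) :
    formConnection a b μ φ ψ x y =
      inner ℂ ((φ + ψ).h y) (cfc (powerFun α) (reprOp φ ψ) ((φ + ψ).h x)) := by
  have hμ := h.finite
  set C := reprOp φ ψ with hC
  have hsa := isSelfAdjoint_reprOp φ ψ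
  have hsp := spectrum_reprOp φ ψ
  have hk := continuousOn_connection_kernel.mono (Set.prod_mono_right (s := Set.Ioi 0) hsp)
  have hb : ∀ᵐ l ∂(μ.restrict (Set.Ioi (0 : ℝ))), ∀ t ∈ spectrum ℝ C,
      ‖(1 + l) * t * (1 - t) / (l * t + (1 - t))‖ ≤ (fun _ : ℝ => (1 : ℝ)) l :=
    ae_restrict_of_forall_mem measurableSet_Ioi fun l hl t ht => connection_kernel_bound hl (hsp ht)
  have hbi : HasFiniteIntegral (fun _ : ℝ => (1 : ℝ)) (μ.restrict (Set.Ioi 0)) :=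
    (integrable_const (1 : ℝ)).2
  have hI := cfc_setIntegral (μ := μ) measurableSet_Ioi
    (fun l t : ℝ => (1 + l) * t * (1 - t) / (l * t + (1 - t))) (fun _ => 1) C hk hb hbi
  have hint := integrableOn_cfc (μ := μ) measurableSet_Ioi
    (fun l t : ℝ => (1 + l) * t * (1 - t) / (l * t + (1 - t))) (fun _ => 1) C hk hb hbi
  -- Continuity of the integral in `t` is read off from the closed form, by difference.
  have hcI : ContinuousOn (fun t => ∫ l in Set.Ioi 0, (1 + l) * t * (1 - t) / (l * t + (1 - t)) ∂μ)
      (spectrum ℝ C) := by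
    have : ContinuousOn (fun t => powerFun α t - (a * t + b * (1 - t))) (spectrum ℝ C) :=
      ((continuous_powerFun hα).sub (by fun_prop)).continuousOn
    refine this.congr fun t ht => ?_
    simp only
    rw [← h.powerFun_eq hα (hsp ht)]
    ring
  have e : cfc (powerFun α) C = a • C + b • (1 - C) +
      ∫ l in Set.Ioi 0, cfc (fun t => (1 + l) * t * (1 - t) / (l * t + (1 - t))) C ∂μ := by
    rw [← hI, cfc_congr (g := fun t => (a * t + b * (1 - t)) +
      ∫ l in Set.Ioi 0, (1 + l) * t * (1 - t) / (l * t + (1 - t)) ∂μ)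
      fun t ht => (h.powerFun_eq hα (hsp ht)).symm,
      cfc_add C (fun t => a * t + b * (1 - t)) _ (by fun_prop) hcI,
      cfc_add C (fun t => a * t) (fun t => b * (1 - t)), cfc_const_mul a (fun t => t) C,
      cfc_const_mul b (fun t => 1 - t) C, cfc_sub (fun _ : ℝ => (1 : ℝ)) (fun t => t) C,
      cfc_id' ℝ C, cfc_const_one ℝ C]
  -- A matrix coefficient is a bounded functional of the operator, so it commutes with the
  -- operator-valued integral.
  let ev : ((φ + ψ).Hilbert →L[ℂ] (φ + ψ).Hilbert) →L[ℂ] ℂ :=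
    (innerSL ℂ ((φ + ψ).h y)).comp (ContinuousLinearMap.apply ℂ _ ((φ + ψ).h x))
  have hev : ∀ T, ev T = inner ℂ ((φ + ψ).h y) (T ((φ + ψ).h x)) := fun T => rfl
  rw [← hev, e, map_add, map_add, ← ContinuousLinearMap.integral_comp_comm _ hint, formConnection]
  congr 1
  · congr 1
    · change (a : ℂ) * φ.form x y = _
      rw [hev, ← repr_left φ ψ]
      change _ = inner ℂ _ (a • C _)
      rw [inner_smul_right_eq_smul, Complex.real_smul]
    · change (b : ℂ) * ψ.form x y = _
      rw [hev, ← repr_right φ ψ]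
      change _ = inner ℂ _ (b • (1 - C) _)
      rw [inner_smul_right_eq_smul, Complex.real_smul]
  · refine setIntegral_congr_fun measurableSet_Ioi fun l hl => ?_
    have hl : 0 < l := hl
    have hc' : ContinuousOn (fun t : ℝ => l * t * (1 - t) / (l * t + (1 - t))) (spectrum ℝ C) :=
      ContinuousOn.div (by fun_prop) (by fun_prop)
        fun t ht => (scaled_denominator_pos hl (hsp ht)).ne'
    have e6 : cfc (fun t => (1 + l) * t * (1 - t) / (l * t + (1 - t))) C =
        ((1 + l) / l) • cfc (fun t : ℝ => l * t * (1 - t) / (l * t + (1 - t))) C := by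
      rw [← cfc_const_mul _ _ C hc']
      exact cfc_congr fun t _ => by field_simp
    simp only [hev, e6, parallelSum_scale φ ψ hl]
    change _ = inner ℂ _ (((1 + l) / l) • cfc _ C ((φ + ψ).h x))
    rw [inner_smul_right_eq_smul, Complex.real_smul]

end PosForm

/-! ### Positivity of operator matrices -/

section Matrices

variable {H : Type*} [NormedAddCommGroup H] [InnerProductSpace ℂ H] [CompleteSpace H]
  {S : StarSubalgebra ℂ (H →L[ℂ] H)} [IsClosed (S : Set (H →L[ℂ] H))] {n : ℕ}

/-- The action of an operator matrix on tuples of vectors. -/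
def matAct (X : CStarMatrix (Fin n) (Fin n) (OpAlg S)) (ξ : Fin n → H) (i : Fin n) : H :=
  ∑ j, (X i j).val (ξ j)

theorem matAct_mul (X Y : CStarMatrix (Fin n) (Fin n) (OpAlg S)) (ξ : Fin n → H) :
    matAct (X * Y) ξ = matAct X (matAct Y ξ) := by
  ext i
  simp only [matAct, CStarMatrix.mul_apply, map_sum, map_mul, sum_apply, mul_apply_eq_comp]
  exact Finset.sum_comm

theorem sum_inner_matAct_star (Y : CStarMatrix (Fin n) (Fin n) (OpAlg S)) (ξ η : Fin n → H) :
    ∑ i, inner ℂ (ξ i) (matAct (star Y) η i) = ∑ i, inner ℂ (matAct Y ξ i) (η i) := by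
  simp only [matAct, CStarMatrix.star_apply, inner_sum, sum_inner, map_star,
    ContinuousLinearMap.star_eq_adjoint, ContinuousLinearMap.adjoint_inner_right]
  exact Finset.sum_comm

theorem sum_inner_star_mul_self (Y : CStarMatrix (Fin n) (Fin n) (OpAlg S)) (ξ : Fin n → H) :
    ∑ i, inner ℂ (ξ i) (matAct (star Y * Y) ξ i) =
      ((∑ i, ‖matAct Y ξ i‖ ^ 2 : ℝ) : ℂ) := by
  rw [matAct_mul, sum_inner_matAct_star]
  push_cast
  exact Finset.sum_congr rfl fun i _ => inner_self_eq_norm_sq_to_K _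

theorem sum_inner_matAct_nonneg {X : CStarMatrix (Fin n) (Fin n) (OpAlg S)} (hX : 0 ≤ X)
    (ξ : Fin n → H) : 0 ≤ ∑ i, inner ℂ (ξ i) (matAct X ξ i) := by
  obtain ⟨Y, rfl⟩ := exists_eq_star_mul hX
  rw [sum_inner_star_mul_self]
  exact Complex.zero_le_real.2 (Finset.sum_nonneg fun _ _ => sq_nonneg _)

theorem matAct_single (X : CStarMatrix (Fin n) (Fin n) (OpAlg S)) (i j : Fin n) (x : H) :
    matAct X (Pi.single j x) i = (X i j).val x := by
  rw [matAct, Finset.sum_eq_single j]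
  · simp
  · intro k _ hk
    simp [Pi.single_eq_of_ne hk]
  · simp

theorem eq_zero_of_matAct {X : CStarMatrix (Fin n) (Fin n) (OpAlg S)}
    (hX : ∀ ξ, matAct X ξ = 0) : X = 0 := by
  refine CStarMatrix.ext fun i j => Subtype.ext (ContinuousLinearMap.ext fun x => ?_)
  have := congrFun (hX (Pi.single j x)) i
  rw [matAct_single] at this
  exact this

/-- A positive sesquilinear form over `ℂ` is Hermitian; tuples with one nonzero entry detect the
matrix entries. -/
theorem isSelfAdjoint_of_sum_inner {X : CStarMatrix (Fin n) (Fin n) (OpAlg S)}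
    (hX : ∀ ξ : Fin n → H, 0 ≤ ∑ i, inner ℂ (ξ i) (matAct X ξ i)) : IsSelfAdjoint X := by
  let q : PosForm (Fin n → H) :=
    ⟨LinearMap.mk₂'ₛₗ (RingHom.id ℂ) (starRingEnd ℂ) (fun ξ η => ∑ i, inner ℂ (η i) (matAct X ξ i))
      (fun ξ ξ' η => by simp [matAct, Finset.sum_add_distrib])
      (fun c ξ η => by simp [matAct, Finset.mul_sum])
      (fun ξ η η' => by simp [Finset.sum_add_distrib])
      (fun c ξ η => by simp [Finset.mul_sum, mul_comm]), hX⟩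
  have hq : ∀ ξ η, q.form ξ η = ∑ i, inner ℂ (η i) (matAct X ξ i) := fun _ _ => rfl
  have hs : ∀ i j x y, q.form (Pi.single j x) (Pi.single i y) = inner ℂ y ((X i j).val x) := by
    intro i j x y
    rw [hq, Finset.sum_eq_single i]
    · rw [matAct_single]; simp
    · intro k _ hk
      simp [Pi.single_eq_of_ne hk]
    · simp
  refine CStarMatrix.ext fun i j => Subtype.ext (ContinuousLinearMap.ext fun x => ?_)
  refine ext_inner_left ℂ fun y => ?_
  change inner ℂ y ((star (X j i)).val x) = inner ℂ y ((X i j).val x)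
  rw [map_star, ContinuousLinearMap.star_eq_adjoint, ContinuousLinearMap.adjoint_inner_right,
    ← inner_conj_symm, ← hs, ← hs, q.conj_symm]

theorem exists_negPart {B : Type*} [NonUnitalCStarAlgebra B] [PartialOrder B] [StarOrderedRing B]
    {X : B} (hX : IsSelfAdjoint X) :
    ∃ Y, 0 ≤ Y ∧ Y * X * Y = -(Y * Y * Y) ∧ (Y = 0 → 0 ≤ X) := by
  refine ⟨X⁻, CFC.negPart_nonneg X, ?_, (CFC.negPart_eq_zero_iff X hX).1⟩
  nth_rw 2 [← CFC.posPart_sub_negPart X hX]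
  rw [mul_sub, CFC.negPart_mul_posPart, zero_sub, neg_mul]

/-- This links the abstract C⋆-order on matrices with quadratic forms. With `Y` the negative part,
write `Y * Y * Y = star Z * Z`; the form of `X` at `Y ξ` equals `-‖Z ξ‖ ^ 2` and is nonnegative. So
`Z = 0`, hence `Y = 0`. -/
theorem cstarMatrix_nonneg_of_sum_inner {X : CStarMatrix (Fin n) (Fin n) (OpAlg S)}
    (hX : ∀ ξ : Fin n → H, 0 ≤ ∑ i, inner ℂ (ξ i) (matAct X ξ i)) : 0 ≤ X := by
  have hsa := isSelfAdjoint_of_sum_inner hX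
  obtain ⟨Y, hYn, hYX, hY0⟩ := exists_negPart hsa
  have hYs : star Y = Y := (IsSelfAdjoint.of_nonneg hYn).star_eq
  obtain ⟨Z, hZ⟩ := exists_eq_star_mul (star_left_conjugate_nonneg hYn Y)
  rw [hYs] at hZ
  have h1 : Y * X * Y = -(star Z * Z) := by rw [← hZ, hYX]
  have h2 : ∀ ξ, matAct Z ξ = 0 := by
    intro ξ
    have h3 := hX (matAct Y ξ)
    rw [← sum_inner_matAct_star, hYs, ← matAct_mul, ← matAct_mul, h1] at h3
    have h4 : ∀ i, matAct (-(star Z * Z)) ξ i = -matAct (star Z * Z) ξ i := by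
      intro i
      simp [matAct]
    simp only [h4, inner_neg_right, Finset.sum_neg_distrib, sum_inner_star_mul_self] at h3
    rw [← Complex.ofReal_neg, Complex.zero_le_real] at h3
    have h5 : ∑ i, ‖matAct Z ξ i‖ ^ 2 = 0 :=
      le_antisymm (by linarith) (Finset.sum_nonneg fun _ _ => sq_nonneg _)
    ext i
    have h6 := (Finset.sum_eq_zero_iff_of_nonneg (fun _ _ => sq_nonneg _)).1 h5 i
      (Finset.mem_univ i)
    simpa using h6
  rw [eq_zero_of_matAct h2, mul_zero] at hZ
  have h3 : Y * Y = 0 := by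
    rw [← CStarRing.star_mul_self_eq_zero_iff, star_mul, hYs, ← mul_assoc, hZ, zero_mul]
  have h4 : Y = 0 := by
    rw [← CStarRing.star_mul_self_eq_zero_iff, hYs, h3]
  exact hY0 h4

end Matrices

theorem PosForm.form_eq_of_tmul {A K : Type*} [AddCommGroup A] [Module ℂ A] [AddCommGroup K]
    [Module ℂ K] (α γ : PosForm (A ⊗[ℂ] K)) (G : γ.Hilbert →L[ℂ] γ.Hilbert)
    (h : ∀ x ξ y η, α.form (x ⊗ₜ ξ) (y ⊗ₜ η) =
      inner ℂ (γ.h (y ⊗ₜ η)) (G (γ.h (x ⊗ₜ ξ)))) (ζ ζ' : A ⊗[ℂ] K) :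
    α.form ζ ζ' = inner ℂ (γ.h ζ') (G (γ.h ζ)) := by
  induction ζ with
  | zero => rw [h_zero, map_zero, map_zero, inner_zero_right, LinearMap.zero_apply]
  | add x y hx hy => rw [h_add, map_add, map_add, inner_add_right, LinearMap.add_apply, hx, hy]
  | tmul x ξ =>
    induction ζ' with
    | zero => rw [h_zero, map_zero, inner_zero_left]
    | add x y hx hy => rw [h_add, map_add, inner_add_left, hx, hy]
    | tmul y η => exact h x ξ y η

/-! ### Completely positive maps from dilations -/

section Dilation

variable {A : Type*} [CStarAlgebra A] [PartialOrder A] [StarOrderedRing A]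
variable {K : Type*} [NormedAddCommGroup K] [InnerProductSpace ℂ K] [CompleteSpace K]
variable {E : Type*} [NormedAddCommGroup E] [InnerProductSpace ℂ E] [CompleteSpace E]
variable {N : VonNeumannAlgebra K}

open ContinuousLinearMap (adjoint)

/-- The completely positive map `x ↦ V(1)⋆ V(x)` of a family of operators with
`V(w)⋆ V(x) = V(1)⋆ V(w⋆ x)`. -/
def cpOfDilation (V : A →ₗ[ℂ] K →L[ℂ] E)
    (hV : ∀ w x, adjoint (V w) ∘L V x = adjoint (V 1) ∘L V (star w * x))
    (hN : ∀ x, adjoint (V 1) ∘L V x ∈ N.toStarSubalgebra) : A →CP Elem N where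
  toFun x := ⟨adjoint (V 1) ∘L V x, hN x⟩
  map_add' x y := Subtype.ext (by
    ext ξ
    change adjoint (V 1) (V (x + y) ξ) = adjoint (V 1) (V x ξ) + adjoint (V 1) (V y ξ)
    simp)
  map_smul' c x := Subtype.ext (by
    ext ξ
    change adjoint (V 1) (V (c • x) ξ) = c • adjoint (V 1) (V x ξ)
    simp)
  map_cstarMatrix_nonneg' n X hX := by
    obtain ⟨Y, rfl⟩ := exists_eq_star_mul hX
    refine cstarMatrix_nonneg_of_sum_inner fun ξ => ?_
    -- The dilation relation turns the quadratic form at `star Y * Y` into the sum over `k` of the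
    -- squared norms of `∑ i, V (Y k i) (ξ i)`.
    have key : ∑ i, inner ℂ (ξ i) (matAct ((star Y * Y).map
        fun x => (⟨adjoint (V 1) ∘L V x, hN x⟩ : Elem N)) ξ i) =
        ∑ k, inner ℂ (∑ i, V (Y k i) (ξ i)) (∑ i, V (Y k i) (ξ i)) := by
      have h1 : ∀ i j, inner ℂ (ξ i) ((adjoint (V 1) ∘L V ((star Y * Y) i j)) (ξ j)) =
          ∑ k, inner ℂ (V (Y k i) (ξ i)) (V (Y k j) (ξ j)) := by
        intro i j
        rw [CStarMatrix.mul_apply, map_sum, ContinuousLinearMap.comp_apply, sum_apply,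
          map_sum, inner_sum]
        refine Finset.sum_congr rfl fun k _ => ?_
        rw [CStarMatrix.star_apply, ← ContinuousLinearMap.comp_apply, ← hV,
          ContinuousLinearMap.comp_apply, ContinuousLinearMap.adjoint_inner_right]
      calc _ = ∑ i, ∑ j, inner ℂ (ξ i) ((adjoint (V 1) ∘L V ((star Y * Y) i j)) (ξ j)) :=
            Finset.sum_congr rfl fun i _ => by rw [matAct, inner_sum]; rfl
        _ = ∑ i, ∑ j, ∑ k, inner ℂ (V (Y k i) (ξ i)) (V (Y k j) (ξ j)) :=
            Finset.sum_congr rfl fun i _ => Finset.sum_congr rfl fun j _ => h1 i j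
        _ = ∑ i, ∑ k, ∑ j, inner ℂ (V (Y k i) (ξ i)) (V (Y k j) (ξ j)) :=
            Finset.sum_congr rfl fun i _ => Finset.sum_comm
        _ = ∑ k, ∑ i, ∑ j, inner ℂ (V (Y k i) (ξ i)) (V (Y k j) (ξ j)) := Finset.sum_comm
        _ = _ := Finset.sum_congr rfl fun k _ => by
            rw [sum_inner]
            exact Finset.sum_congr rfl fun i _ => by rw [inner_sum]
    refine le_of_le_of_eq (Finset.sum_nonneg fun k _ => ?_) key.symm
    exact Complex.nonneg_iff.2 ⟨inner_self_nonneg (𝕜 := ℂ), (inner_self_im (𝕜 := ℂ) _).symm⟩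

theorem op_cpOfDilation (V : A →ₗ[ℂ] K →L[ℂ] E)
    (hV : ∀ w x, adjoint (V w) ∘L V x = adjoint (V 1) ∘L V (star w * x))
    (hN : ∀ x, adjoint (V 1) ∘L V x ∈ N.toStarSubalgebra) (x : A) :
    op (cpOfDilation V hV hN) x = adjoint (V 1) ∘L V x := rfl

theorem op_ext {Φ Ψ : A →CP Elem N} (h : ∀ x, op Φ x = op Ψ x) : Φ = Ψ :=
  DFunLike.ext _ _ fun x => Subtype.ext (h x)

theorem cpForm_tmul (Φ : A →CP Elem N) (x y : A) (ξ η : K) :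
    (cpForm Φ).form (x ⊗ₜ ξ) (y ⊗ₜ η) = inner ℂ η (op Φ (star y * x) ξ) := rfl

/-- The operators `ξ ↦ h(x ⊗ ξ)` of a form on `A ⊗ K`. -/
def formFamily (γ : PosForm (A ⊗[ℂ] K))
    (hγ : ∀ x, ∃ c, ∀ ξ, ‖γ.h (x ⊗ₜ ξ)‖ ≤ c * ‖ξ‖) : A →ₗ[ℂ] K →L[ℂ] γ.Hilbert where
  toFun x := LinearMap.mkContinuousOfExistsBound (γ.hLin ∘ₗ TensorProduct.mk ℂ A K x) (hγ x)
  map_add' x y := by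
    ext ξ
    change γ.h ((x + y) ⊗ₜ ξ) = γ.h (x ⊗ₜ ξ) + γ.h (y ⊗ₜ ξ)
    rw [TensorProduct.add_tmul, PosForm.h_add]
  map_smul' c x := by
    ext ξ
    change γ.h ((c • x) ⊗ₜ ξ) = c • γ.h (x ⊗ₜ ξ)
    rw [← TensorProduct.smul_tmul', PosForm.h_smul]

theorem re_cpForm_tmul_le (Φ : A →CP Elem N) (x : A) (ξ : K) :
    ((cpForm Φ).form (x ⊗ₜ ξ) (x ⊗ₜ ξ)).re ≤ ‖op Φ (star x * x)‖ * ‖ξ‖ ^ 2 := by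
  rw [cpForm_tmul]
  refine (Complex.re_le_norm _).trans ((norm_inner_le_norm _ _).trans ?_)
  nlinarith [mul_le_mul_of_nonneg_left ((op Φ (star x * x)).le_opNorm ξ) (norm_nonneg ξ)]

theorem cpForm_bound (Φ : A →CP Elem N) (x : A) :
    ∃ c, ∀ ξ, ‖(cpForm Φ).h (x ⊗ₜ[ℂ] ξ)‖ ≤ c * ‖ξ‖ := by
  refine ⟨√(‖op Φ (star x * x)‖), fun ξ => le_of_sq_le_sq ?_ (by positivity)⟩
  rw [PosForm.norm_sq_h, mul_pow, Real.sq_sqrt (by positivity)]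
  exact re_cpForm_tmul_le Φ x ξ

theorem cpForm_add_bound (Φ Ψ : A →CP Elem N) (x : A) :
    ∃ c, ∀ ξ, ‖(cpForm Φ + cpForm Ψ).h (x ⊗ₜ[ℂ] ξ)‖ ≤ c * ‖ξ‖ := by
  refine ⟨√(‖op Φ (star x * x)‖ + ‖op Ψ (star x * x)‖), fun ξ =>
    le_of_sq_le_sq ?_ (by positivity)⟩
  rw [PosForm.norm_sq_h, mul_pow, Real.sq_sqrt (by positivity), PosForm.add_form, Complex.add_re,
    add_mul]
  exact add_le_add (re_cpForm_tmul_le Φ x ξ) (re_cpForm_tmul_le Ψ x ξ)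

/-- The Stinespring family `ξ ↦ h(x ⊗ ξ)` of a completely positive map. -/
def stine (Φ : A →CP Elem N) : A →ₗ[ℂ] K →L[ℂ] (cpForm Φ).Hilbert :=
  formFamily (cpForm Φ) (cpForm_bound Φ)

theorem stine_apply (Φ : A →CP Elem N) (x : A) (ξ : K) :
    stine Φ x ξ = (cpForm Φ).h (x ⊗ₜ ξ) := rfl

theorem inner_stine (Φ : A →CP Elem N) (w x : A) (η ξ : K) :
    inner ℂ (stine Φ w η) (stine Φ x ξ) = inner ℂ η (op Φ (star w * x) ξ) := by
  rw [stine_apply, stine_apply, PosForm.inner_h, cpForm_tmul]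

theorem adjoint_stine_comp (Φ : A →CP Elem N) (w x : A) :
    adjoint (stine Φ w) ∘L stine Φ x = op Φ (star w * x) := by
  ext ξ
  refine ext_inner_left ℂ fun η => ?_
  rw [ContinuousLinearMap.comp_apply, ContinuousLinearMap.adjoint_inner_right, inner_stine]

theorem cpSesq_mul_left (Φ : A →CP Elem N) (a : A) (ζ ζ' : A ⊗[ℂ] K) :
    (cpForm Φ).form (LinearMap.rTensor K (LinearMap.mulLeft ℂ a) ζ) ζ' =
      (cpForm Φ).form ζ (LinearMap.rTensor K (LinearMap.mulLeft ℂ (star a)) ζ') := by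
  induction ζ with
  | zero => simp
  | add x y hx hy => simp only [map_add, LinearMap.add_apply, hx, hy]
  | tmul x ξ =>
    induction ζ' with
    | zero => simp
    | add x y hx hy => simp only [map_add, hx, hy]
    | tmul y η =>
      simp only [LinearMap.rTensor_tmul, LinearMap.mulLeft_apply, cpForm_tmul, star_mul, star_star,
        mul_assoc]

/-- An operator of the commutant passes through the values `Φ(y⋆ x)`. -/
theorem cpSesq_commutant (Φ : A →CP Elem N) {c : K →L[ℂ] K} (hc : c ∈ N.commutant)
    (ζ ζ' : A ⊗[ℂ] K) :
    (cpForm Φ).form (LinearMap.lTensor A (c : K →ₗ[ℂ] K) ζ) ζ' =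
      (cpForm Φ).form ζ (LinearMap.lTensor A (adjoint c : K →ₗ[ℂ] K) ζ') := by
  induction ζ with
  | zero => simp
  | add x y hx hy => simp only [map_add, LinearMap.add_apply, hx, hy]
  | tmul x ξ =>
    induction ζ' with
    | zero => simp
    | add x y hx hy => simp only [map_add, hx, hy]
    | tmul y η =>
      simp only [LinearMap.lTensor_tmul, cpForm_tmul, ContinuousLinearMap.coe_coe]
      rw [ContinuousLinearMap.adjoint_inner_left]
      have := VonNeumannAlgebra.mem_commutant_iff.1 hc _ (Φ (star y * x)).2
      exact congrArg (fun T : K →L[ℂ] K => inner ℂ η (T ξ)) this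

/-- An operator that commutes with the unitaries of the commutant is in the von Neumann algebra. -/
theorem mem_of_commute_unitary {T : K →L[ℂ] K}
    (hT : ∀ u ∈ unitary (K →L[ℂ] K), u ∈ N.commutant → u * T = T * u) :
    T ∈ N.toStarSubalgebra := by
  -- The commutant is a C⋆-algebra, so it is spanned by its unitaries; the bicommutant theorem then
  -- concludes.
  have h1 : ∀ c : Elem N.commutant, c.val * T = T * c.val := by
    intro c
    have hc : c ∈ Submodule.span ℂ (unitary (Elem N.commutant) : Set (Elem N.commutant)) := by
      rw [CStarAlgebra.span_unitary]; trivial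
    induction hc using Submodule.span_induction with
    | mem u hu =>
      exact hT _ (Unitary.map_mem (OpAlg.val : Elem N.commutant →⋆ₐ[ℂ] _) hu) u.2
    | zero => simp
    | add x y _ _ hx hy => rw [map_add, add_mul, mul_add, hx, hy]
    | smul a x _ hx => rw [map_smul, smul_mul_assoc, mul_smul_comm, hx]
  have h2 : T ∈ N.commutant.commutant :=
    VonNeumannAlgebra.mem_commutant_iff.2 fun c hc => h1 ⟨c, hc⟩
  rwa [VonNeumannAlgebra.commutant_commutant] at h2

/-! ### Existence of the power mean of completely positive maps -/

section PowerMean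

variable (Φ Ψ : A →CP Elem N)

/-- Left multiplication by a unitary of `A` preserves both forms, so it commutes with the functional
calculus. Both sides are linear in `a`, and unitaries span `A`. -/
theorem inner_cfc_mul_left (f : ℝ → ℝ) (a : A) (ζ ζ' : A ⊗[ℂ] K) :
    inner ℂ ((cpForm Φ + cpForm Ψ).h ζ') (cfc f (PosForm.reprOp (cpForm Φ) (cpForm Ψ))
        ((cpForm Φ + cpForm Ψ).h (LinearMap.rTensor K (LinearMap.mulLeft ℂ a) ζ))) =
      inner ℂ ((cpForm Φ + cpForm Ψ).h (LinearMap.rTensor K (LinearMap.mulLeft ℂ (star a)) ζ'))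
        (cfc f (PosForm.reprOp (cpForm Φ) (cpForm Ψ)) ((cpForm Φ + cpForm Ψ).h ζ)) := by
  have ha : a ∈ Submodule.span ℂ (unitary A : Set A) := by
    rw [CStarAlgebra.span_unitary]; trivial
  induction ha using Submodule.span_induction with
  | mem u hu =>
    refine PosForm.inner_cfc_reprOp_adjoint (cpSesq_mul_left Φ u) (cpSesq_mul_left Ψ u)
      (fun x => ?_) f ζ ζ'
    have h1 : LinearMap.rTensor K (LinearMap.mulLeft ℂ (star u))
        (LinearMap.rTensor K (LinearMap.mulLeft ℂ u) x) = x := by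
      rw [← LinearMap.comp_apply, ← LinearMap.rTensor_comp, ← LinearMap.mulLeft_mul,
        Unitary.star_mul_self_of_mem hu, LinearMap.mulLeft_one, LinearMap.rTensor_id,
        LinearMap.id_apply]
    rw [PosForm.add_form, PosForm.add_form, cpSesq_mul_left, cpSesq_mul_left, h1]
  | zero =>
    have h0 : LinearMap.mulLeft ℂ (0 : A) = 0 := by ext; simp
    simp only [star_zero, h0, LinearMap.rTensor_zero, LinearMap.zero_apply]
    simp only [← PosForm.hLin_apply, map_zero, inner_zero_left, inner_zero_right]
  | add x y _ _ hx hy =>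
    have h0 : ∀ a b : A, LinearMap.mulLeft ℂ (a + b) =
      LinearMap.mulLeft ℂ a + LinearMap.mulLeft ℂ b := fun a b => by ext; simp [add_mul]
    simp only [star_add, h0, LinearMap.rTensor_add, LinearMap.add_apply, PosForm.h_add, map_add,
      inner_add_left, inner_add_right, hx, hy]
  | smul c x _ hx =>
    have h0 : ∀ (c : ℂ) (b : A), LinearMap.mulLeft ℂ (c • b) =
      c • LinearMap.mulLeft ℂ b := fun a b => by ext; simp
    simp only [star_smul, h0, LinearMap.rTensor_smul, LinearMap.smul_apply, PosForm.h_smul,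
      map_smul, inner_smul_left, inner_smul_right, hx, RCLike.star_def, Complex.conj_conj]

theorem inner_cfc_commutant (f : ℝ → ℝ) {u : K →L[ℂ] K} (hu : u ∈ unitary (K →L[ℂ] K))
    (huN : u ∈ N.commutant) (ζ ζ' : A ⊗[ℂ] K) :
    inner ℂ ((cpForm Φ + cpForm Ψ).h ζ') (cfc f (PosForm.reprOp (cpForm Φ) (cpForm Ψ))
        ((cpForm Φ + cpForm Ψ).h (LinearMap.lTensor A (u : K →ₗ[ℂ] K) ζ))) =
      inner ℂ ((cpForm Φ + cpForm Ψ).h (LinearMap.lTensor A (adjoint u : K →ₗ[ℂ] K) ζ'))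
        (cfc f (PosForm.reprOp (cpForm Φ) (cpForm Ψ)) ((cpForm Φ + cpForm Ψ).h ζ)) := by
  refine PosForm.inner_cfc_reprOp_adjoint (cpSesq_commutant Φ huN) (cpSesq_commutant Ψ huN)
      (fun x => ?_) f ζ ζ'
  have h1 : (adjoint u : K →ₗ[ℂ] K) ∘ₗ (u : K →ₗ[ℂ] K) = LinearMap.id := by
    ext ξ
    exact congrArg (fun T : K →L[ℂ] K => T ξ) (Unitary.star_mul_self_of_mem hu)
  have h2 : LinearMap.lTensor A (adjoint u : K →ₗ[ℂ] K)
      (LinearMap.lTensor A (u : K →ₗ[ℂ] K) x) = x := by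
    rw [← LinearMap.comp_apply, ← LinearMap.lTensor_comp, h1, LinearMap.lTensor_id,
      LinearMap.id_apply]
  rw [PosForm.add_form, PosForm.add_form, cpSesq_commutant _ huN, cpSesq_commutant _ huN, h2]

variable {α : ℝ}

/-- With `R` the square root of `cfc (powerFun α) C`, take `V(x) ξ = R h(x ⊗ ξ)`. -/
theorem exists_powerMean_dilation (hα : α ∈ Set.Icc (0 : ℝ) 1) :
    ∃ V : A →ₗ[ℂ] K →L[ℂ] (cpForm Φ + cpForm Ψ).Hilbert, ∀ w x (η ξ : K),
      inner ℂ (V w η) (V x ξ) = inner ℂ ((cpForm Φ + cpForm Ψ).h (w ⊗ₜ η))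
        (cfc (powerFun α) (PosForm.reprOp (cpForm Φ) (cpForm Ψ))
          ((cpForm Φ + cpForm Ψ).h (x ⊗ₜ ξ))) := by
  set γ := cpForm Φ + cpForm Ψ with hγ
  set C := PosForm.reprOp (cpForm Φ) (cpForm Ψ) with hC
  have hsa : IsSelfAdjoint C := PosForm.isSelfAdjoint_reprOp _ _
  have hg := continuous_powerFun hα
  set R := cfc (fun t => √(powerFun α t)) C with hR
  have hRR : R * R = cfc (powerFun α) C := by
    rw [hR, ← cfc_mul (fun t => √(powerFun α t)) (fun t => √(powerFun α t)) C
      (by fun_prop) (by fun_prop)]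
    exact cfc_congr fun t ht => Real.mul_self_sqrt
      (powerFun_nonneg (PosForm.spectrum_reprOp _ _ ht))
  have hRs : IsSelfAdjoint R := cfc_predicate _ _
  refine ⟨(ContinuousLinearMap.compL ℂ K γ.Hilbert γ.Hilbert R : (K →L[ℂ] γ.Hilbert) →ₗ[ℂ] _) ∘ₗ
      formFamily γ (cpForm_add_bound Φ Ψ), fun w x η ξ => ?_⟩
  change inner ℂ (R (γ.h (w ⊗ₜ η))) (R (γ.h (x ⊗ₜ ξ))) = _
  rw [← ContinuousLinearMap.adjoint_inner_right, ← ContinuousLinearMap.star_eq_adjoint,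
    hRs.star_eq, ← hRR]
  rfl

/-- The family `V` of `exists_powerMean_dilation` defines the mean as `x ↦ V(1)⋆ V(x)`.
Compatibility with left multiplication is the dilation relation; compatibility with the unitaries of
the commutant puts the values in `N`. -/
theorem exists_isConnection_rpow (hα : α ∈ Set.Icc (0 : ℝ) 1) :
    ∃ Θ, IsConnection (fun t => t ^ α) Φ Ψ Θ := by
  obtain ⟨V, hV⟩ := exists_powerMean_dilation Φ Ψ hα
  have hV' : ∀ w x (η ξ : K), inner ℂ η ((adjoint (V w) ∘L V x) ξ) =
      inner ℂ ((cpForm Φ + cpForm Ψ).h (w ⊗ₜ η))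
        (cfc (powerFun α) (PosForm.reprOp (cpForm Φ) (cpForm Ψ))
          ((cpForm Φ + cpForm Ψ).h (x ⊗ₜ ξ))) := by
    intro w x η ξ
    rw [ContinuousLinearMap.comp_apply, ContinuousLinearMap.adjoint_inner_right, hV]
  have h1 : ∀ w x, adjoint (V w) ∘L V x = adjoint (V 1) ∘L V (star w * x) := by
    intro w x
    ext ξ
    refine ext_inner_left ℂ fun η => ?_
    rw [hV', hV']
    have := inner_cfc_mul_left Φ Ψ (powerFun α) (star w) (x ⊗ₜ ξ) (1 ⊗ₜ η)
    simp only [LinearMap.rTensor_tmul, LinearMap.mulLeft_apply, star_star, mul_one] at this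
    exact this.symm
  have h2 : ∀ x, adjoint (V 1) ∘L V x ∈ N.toStarSubalgebra := by
    intro x
    refine mem_of_commute_unitary fun u hu huN => ?_
    ext ξ
    refine ext_inner_left ℂ fun η => ?_
    have := inner_cfc_commutant Φ Ψ (powerFun α) hu huN (x ⊗ₜ ξ) (1 ⊗ₜ η)
    simp only [LinearMap.lTensor_tmul, ContinuousLinearMap.coe_coe] at this
    change inner ℂ η (u ((adjoint (V 1) ∘L V x) ξ)) = inner ℂ η ((adjoint (V 1) ∘L V x) (u ξ))
    rw [← ContinuousLinearMap.adjoint_inner_left, hV', hV']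
    exact this.symm
  obtain ⟨a, b, μ, hrep⟩ := exists_isLoewnerRep_rpow hα
  refine ⟨cpOfDilation V h1 h2, a, b, μ, hrep, fun ζ ζ' => ?_⟩
  refine (PosForm.form_eq_of_tmul (cpForm (cpOfDilation V h1 h2)) (cpForm Φ + cpForm Ψ) _
    (fun x ξ y η => ?_) ζ ζ').trans (PosForm.formConnection_eq hα hrep _ _ ζ ζ').symm
  rw [← hV', h1]
  rfl

/-- This is the working description of `powerMean`: whatever map and whatever data `a`, `b`, `μ` the
definition selects, the form is the same. -/
theorem cpForm_powerMean (hα : α ∈ Set.Icc (0 : ℝ) 1) (ζ ζ' : A ⊗[ℂ] K) :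
    (cpForm (powerMean α Φ Ψ)).form ζ ζ' =
      inner ℂ ((cpForm Φ + cpForm Ψ).h ζ')
        (cfc (powerFun α) (PosForm.reprOp (cpForm Φ) (cpForm Ψ))
          ((cpForm Φ + cpForm Ψ).h ζ)) := by
  have h := exists_isConnection_rpow Φ Ψ hα
  have hs : IsConnection (fun t => t ^ α) Φ Ψ (powerMean α Φ Ψ) := by
    rw [powerMean, connection, dif_pos h]
    exact h.choose_spec
  obtain ⟨a, b, μ, hrep, hform⟩ := hs
  exact (hform ζ ζ').trans (PosForm.formConnection_eq hα hrep _ _ ζ ζ')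

end PowerMean

end Dilation

/-! ### Norm estimates on algebraic tensor products -/

section Gram

variable {H : Type*} [NormedAddCommGroup H] [InnerProductSpace ℂ H] [CompleteSpace H]
  {S : StarSubalgebra ℂ (H →L[ℂ] H)} [IsClosed (S : Set (H →L[ℂ] H))] {n : ℕ}
variable {K : Type*} [NormedAddCommGroup K] [InnerProductSpace ℂ K] [CompleteSpace K]
variable {E L L' : Type*} [NormedAddCommGroup E] [InnerProductSpace ℂ E]
  [NormedAddCommGroup L] [InnerProductSpace ℂ L] [NormedAddCommGroup L'] [InnerProductSpace ℂ L']
variable {N : VonNeumannAlgebra K}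

theorem exists_fin_sum_tmul {A B : Type*} [AddCommGroup A] [Module ℂ A] [AddCommGroup B]
    [Module ℂ B] (ζ : A ⊗[ℂ] B) :
    ∃ (n : ℕ) (x : Fin n → A) (ξ : Fin n → B), ζ = ∑ i, x i ⊗ₜ ξ i := by
  obtain ⟨s, hs⟩ := TensorProduct.exists_finset ζ
  refine ⟨s.card, fun i => (s.equivFin.symm i).1.1, fun i => (s.equivFin.symm i).1.2, ?_⟩
  rw [hs, ← Finset.sum_coe_sort]
  exact (Equiv.sum_comp s.equivFin.symm (fun p : s => p.1.1 ⊗ₜ[ℂ] p.1.2)).symm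

/-- The matrix `∑ ⟨cᵢ e_p, cⱼ e_q⟩ aᵢ⋆ aⱼ` over `S`. -/
def gramMatrix {m : ℕ} (a : Fin m → OpAlg S) (c : Fin m → L →ₗ[ℂ] L') (e : Fin n → L) :
    CStarMatrix (Fin n) (Fin n) (OpAlg S) :=
  CStarMatrix.ofMatrix fun p q =>
    ∑ i, ∑ j, (inner ℂ (c i (e p)) (c j (e q)) : ℂ) • (star (a i) * a j)

theorem gramMatrix_apply {m : ℕ} (a : Fin m → OpAlg S) (c : Fin m → L →ₗ[ℂ] L') (e : Fin n → L)
    (p q : Fin n) : gramMatrix a c e p q =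
      ∑ i, ∑ j, (inner ℂ (c i (e p)) (c j (e q)) : ℂ) • (star (a i) * a j) := rfl

-- The elements `a i` enter the norm only through `T` applied to the entries of a Gram matrix over
-- `S`. An inequality of such norms is therefore positivity of a matrix, which a completely positive
-- map transports.
omit [CompleteSpace K] in
theorem norm_sq_sum_map {m : ℕ} (U : OpAlg S → K →ₗ[ℂ] E) (T : OpAlg S →ₗ[ℂ] K →L[ℂ] K)
    (hU : ∀ w x η ξ, inner ℂ (U w η) (U x ξ) = inner ℂ η (T (star w * x) ξ))
    (a : Fin m → OpAlg S) (c : Fin m → L →ₗ[ℂ] L') (ξ : Fin n → K) (e : Fin n → L) :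
    ((‖∑ i, TensorProduct.map (U (a i)) (c i) (∑ p, ξ p ⊗ₜ[ℂ] e p)‖ ^ 2 : ℝ) : ℂ) =
      ∑ p, inner ℂ (ξ p) (∑ q, T (gramMatrix a c e p q) (ξ q)) := by
  have h1 : ∑ i, TensorProduct.map (U (a i)) (c i) (∑ p, ξ p ⊗ₜ[ℂ] e p) =
      ∑ p, ∑ i, U (a i) (ξ p) ⊗ₜ[ℂ] c i (e p) := by
    rw [Finset.sum_comm]
    simp only [map_sum, TensorProduct.map_tmul]
  rw [h1, Complex.ofReal_pow]
  refine (inner_self_eq_norm_sq_to_K (𝕜 := ℂ) (E := E ⊗[ℂ] L') _).symm.trans ?_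
  rw [sum_inner]
  refine Finset.sum_congr rfl fun p _ => ?_
  rw [inner_sum, inner_sum]
  refine Finset.sum_congr rfl fun q _ => ?_
  rw [gramMatrix_apply, map_sum, sum_apply, sum_inner, inner_sum]
  refine Finset.sum_congr rfl fun i _ => ?_
  rw [map_sum, sum_apply, inner_sum, inner_sum]
  refine Finset.sum_congr rfl fun j _ => ?_
  rw [map_smul, TensorProduct.inner_tmul, hU]
  change _ = inner ℂ (ξ p) ((inner ℂ (c i (e p)) (c j (e q)) : ℂ) • T (star (a i) * a j) (ξ q))
  rw [inner_smul_right, mul_comm]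

/-- A completely positive map preserves norm estimates of sums of elementary tensors. -/
theorem norm_sum_stine_le {m : ℕ} (Φ : OpAlg S →CP Elem N) (a : Fin m → OpAlg S)
    (c : Fin m → L →ₗ[ℂ] L') (d : L →ₗ[ℂ] L') (k : ℝ) (hk : 0 ≤ k)
    (h : ∀ θ : H ⊗[ℂ] L, ‖∑ i, TensorProduct.map ((a i).val : H →ₗ[ℂ] H) (c i) θ‖ ≤
      k * ‖TensorProduct.map LinearMap.id d θ‖) (ζ : K ⊗[ℂ] L) :
    ‖∑ i, TensorProduct.map (stine Φ (a i)).toLinearMap (c i) ζ‖ ≤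
      k * ‖TensorProduct.map (stine Φ 1).toLinearMap d ζ‖ := by
  obtain ⟨n, ξ, e, rfl⟩ := exists_fin_sum_tmul ζ
  let T₀ : OpAlg S →ₗ[ℂ] H →L[ℂ] H := (OpAlg.val : OpAlg S →⋆ₐ[ℂ] _).toAlgHom.toLinearMap
  have hT₀ : ∀ w x (η ξ : H), inner ℂ (w.val η) (x.val ξ) = inner ℂ η (T₀ (star w * x) ξ) := by
    intro w x η ξ
    change _ = inner ℂ η ((OpAlg.val (star w * x)) ξ)
    rw [map_mul, map_star, mul_apply_eq_comp, ContinuousLinearMap.star_eq_adjoint,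
      ContinuousLinearMap.adjoint_inner_right]
  let T₁ : OpAlg S →ₗ[ℂ] K →L[ℂ] K :=
    (OpAlg.val : Elem N →⋆ₐ[ℂ] _).toAlgHom.toLinearMap ∘ₗ Φ.toLinearMap
  have hT₁ : ∀ w x (η ξ : K), inner ℂ (stine Φ w η) (stine Φ x ξ) =
      inner ℂ η (T₁ (star w * x) ξ) := inner_stine Φ
  let X := gramMatrix a c e
  let Y := gramMatrix (fun _ : Fin 1 => (1 : OpAlg S)) (fun _ => d) e
  -- The assumed estimate on `H ⊗ L` is exactly the positivity of this matrix; applying `Φ`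
  -- entrywise yields the estimate on `K ⊗ L`.
  have hpos : 0 ≤ ((k ^ 2 : ℝ) : ℂ) • Y - X := by
    refine cstarMatrix_nonneg_of_sum_inner fun η => ?_
    have h1 := norm_sq_sum_map (fun a => (a.val : H →ₗ[ℂ] H)) T₀ hT₀ a c η e
    have h2 := norm_sq_sum_map (fun a => (a.val : H →ₗ[ℂ] H)) T₀ hT₀ (fun _ : Fin 1 => 1)
      (fun _ => d) η e
    have h3 : ∑ i, inner ℂ (η i) (matAct (((k ^ 2 : ℝ) : ℂ) • Y - X) η i) =
        ((k ^ 2 : ℝ) : ℂ) * (∑ i, inner ℂ (η i) (∑ j, T₀ (Y i j) (η j))) -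
          ∑ i, inner ℂ (η i) (∑ j, T₀ (X i j) (η j)) := by
      rw [Finset.mul_sum, ← Finset.sum_sub_distrib]
      refine Finset.sum_congr rfl fun i _ => ?_
      rw [← inner_smul_right, ← inner_sub_right, Finset.smul_sum, ← Finset.sum_sub_distrib]
      rfl
    rw [h3, ← h1, ← h2]
    have h4 := h (∑ p, η p ⊗ₜ[ℂ] e p)
    simp only [Finset.univ_unique, Finset.sum_singleton, map_one]
    rw [← Complex.ofReal_mul, ← Complex.ofReal_sub, Complex.zero_le_real, sub_nonneg, ← mul_pow]
    exact pow_le_pow_left₀ (norm_nonneg _) h4 2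
  have h5 := sum_inner_matAct_nonneg (Φ.map_cstarMatrix_nonneg' n _ hpos) ξ
  have h1 := norm_sq_sum_map (fun a => (stine Φ a).toLinearMap) T₁ hT₁ a c ξ e
  have h2 := norm_sq_sum_map (fun a => (stine Φ a).toLinearMap) T₁ hT₁ (fun _ : Fin 1 => 1)
    (fun _ => d) ξ e
  have h3 : ∑ i, inner ℂ (ξ i) (matAct ((((k ^ 2 : ℝ) : ℂ) • Y - X).map Φ.toLinearMap) ξ i) =
      ((k ^ 2 : ℝ) : ℂ) * (∑ i, inner ℂ (ξ i) (∑ j, T₁ (Y i j) (ξ j))) -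
        ∑ i, inner ℂ (ξ i) (∑ j, T₁ (X i j) (ξ j)) := by
    rw [Finset.mul_sum, ← Finset.sum_sub_distrib]
    refine Finset.sum_congr rfl fun i _ => ?_
    rw [← inner_smul_right, ← inner_sub_right, Finset.smul_sum, ← Finset.sum_sub_distrib, matAct]
    congr 1
    refine Finset.sum_congr rfl fun j _ => ?_
    have : T₁ (((k ^ 2 : ℝ) : ℂ) • Y i j - X i j) =
      ((k ^ 2 : ℝ) : ℂ) • T₁ (Y i j) - T₁ (X i j) := by rw [map_sub, map_smul]
    exact congrArg (fun S : K →L[ℂ] K => S (ξ j)) this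
  rw [h3, ← h1, ← h2] at h5
  simp only [Finset.univ_unique, Finset.sum_singleton] at h5
  rw [← Complex.ofReal_mul, ← Complex.ofReal_sub, Complex.zero_le_real, sub_nonneg,
    ← mul_pow] at h5
  exact le_of_sq_le_sq h5 (by positivity)

end Gram

/-! ### The norm estimate for two maps -/

section TwoMaps

variable {H₁ H₂ K₁ K₂ : Type*}
  [NormedAddCommGroup H₁] [InnerProductSpace ℂ H₁] [CompleteSpace H₁]
  [NormedAddCommGroup H₂] [InnerProductSpace ℂ H₂] [CompleteSpace H₂]
  [NormedAddCommGroup K₁] [InnerProductSpace ℂ K₁] [CompleteSpace K₁]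
  [NormedAddCommGroup K₂] [InnerProductSpace ℂ K₂] [CompleteSpace K₂]
variable {M₁ : VonNeumannAlgebra H₁} {M₂ : VonNeumannAlgebra H₂}
  {N₁ : VonNeumannAlgebra K₁} {N₂ : VonNeumannAlgebra K₂}

theorem norm_sum_map_comm {E F E' F' : Type*}
    [NormedAddCommGroup E] [InnerProductSpace ℂ E] [NormedAddCommGroup F] [InnerProductSpace ℂ F]
    [NormedAddCommGroup E'] [InnerProductSpace ℂ E']
    [NormedAddCommGroup F'] [InnerProductSpace ℂ F'] {ι : Type*} [Fintype ι]
    (f : ι → E →ₗ[ℂ] E') (g : ι → F →ₗ[ℂ] F') (θ : E ⊗[ℂ] F) :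
    ‖∑ i, TensorProduct.map (g i) (f i) (TensorProduct.comm ℂ E F θ)‖ =
      ‖∑ i, TensorProduct.map (f i) (g i) θ‖ := by
  simp only [TensorProduct.map_comm]
  rw [← map_sum, TensorProduct.norm_comm]

/-- The tensor product of two Stinespring families is bounded by the spatial norm. -/
theorem norm_sum_stine_tensor_le {m : ℕ} (Φ₁ : Elem M₁ →CP Elem N₁) (Φ₂ : Elem M₂ →CP Elem N₂)
    (a : Fin m → Elem M₁) (b : Fin m → Elem M₂) (k : ℝ) (hk : 0 ≤ k)
    (h : ∀ θ : H₁ ⊗[ℂ] H₂, ‖∑ i, TensorProduct.map ((a i).val : H₁ →ₗ[ℂ] H₁)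
      ((b i).val : H₂ →ₗ[ℂ] H₂) θ‖ ≤ k * ‖θ‖) (ζ : K₁ ⊗[ℂ] K₂) :
    ‖∑ i, TensorProduct.map (stine Φ₁ (a i)).toLinearMap (stine Φ₂ (b i)).toLinearMap ζ‖ ≤
      k * ‖TensorProduct.map (stine Φ₁ 1).toLinearMap (stine Φ₂ 1).toLinearMap ζ‖ := by
  -- The factors are treated one at a time: first `H₂` is replaced through `Φ₂`, with the operators
  -- `a i` as coefficients, then `H₁` through `Φ₁`, with the Stinespring operators of `Φ₂` as
  -- coefficients. The flip of tensor factors links the stages.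
  have h1 := norm_sum_stine_le Φ₂ b (fun i => ((a i).val : H₁ →ₗ[ℂ] H₁)) LinearMap.id k hk
    (fun θ => by
      have := norm_sum_map_comm (fun i => ((b i).val : H₂ →ₗ[ℂ] H₂))
        (fun i => ((a i).val : H₁ →ₗ[ℂ] H₁)) θ
      rw [TensorProduct.map_id, LinearMap.id_apply, ← this, ← TensorProduct.norm_comm θ]
      exact h _)
  refine norm_sum_stine_le Φ₁ a (fun i => (stine Φ₂ (b i)).toLinearMap)
    (stine Φ₂ 1).toLinearMap k hk (fun θ => ?_) ζ
  have h2 := norm_sum_map_comm (fun i => ((a i).val : H₁ →ₗ[ℂ] H₁))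
    (fun i => (stine Φ₂ (b i)).toLinearMap) θ
  have h3 := norm_sum_map_comm (fun _ : Fin 1 => (LinearMap.id : H₁ →ₗ[ℂ] H₁))
    (fun _ => (stine Φ₂ 1).toLinearMap) θ
  simp only [Finset.univ_unique, Finset.sum_singleton] at h3
  rw [← h2, ← h3]
  exact h1 _

end TwoMaps

/-! ### Operators on Hilbert space tensor products -/

section HilbertTensor

open ContinuousLinearMap (adjoint)

variable {E₁ E₂ F₁ F₂ G₁ G₂ X : Type*}
  [NormedAddCommGroup E₁] [InnerProductSpace ℂ E₁] [NormedAddCommGroup E₂] [InnerProductSpace ℂ E₂]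
  [NormedAddCommGroup F₁] [InnerProductSpace ℂ F₁] [NormedAddCommGroup F₂] [InnerProductSpace ℂ F₂]
  [NormedAddCommGroup G₁] [InnerProductSpace ℂ G₁] [NormedAddCommGroup G₂] [InnerProductSpace ℂ G₂]
  [NormedAddCommGroup X] [NormedSpace ℂ X]

/-- The inclusion of the algebraic tensor product in the Hilbert space tensor product. -/
def toHT : E₁ ⊗[ℂ] E₂ →ₗ[ℂ] HTensor E₁ E₂ :=
  (Completion.toComplL (𝕜 := ℂ) (E := E₁ ⊗[ℂ] E₂)).toLinearMap

theorem toHT_tmul (ξ : E₁) (η : E₂) : toHT (ξ ⊗ₜ[ℂ] η) = HTensor.tmul ξ η := rfl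

theorem norm_toHT (ζ : E₁ ⊗[ℂ] E₂) : ‖toHT ζ‖ = ‖ζ‖ := Completion.norm_coe ζ

theorem denseRange_toHT : DenseRange (toHT (E₁ := E₁) (E₂ := E₂)) :=
  Completion.denseRange_coe (α := E₁ ⊗[ℂ] E₂)

theorem inner_htmul (ξ ξ' : E₁) (η η' : E₂) :
    inner ℂ (HTensor.tmul ξ η) (HTensor.tmul ξ' η') = inner ℂ ξ ξ' * inner ℂ η η' :=
  Completion.inner_coe (𝕜 := ℂ) (E := E₁ ⊗[ℂ] E₂) _ _

theorem norm_htmul (ξ : E₁) (η : E₂) : ‖HTensor.tmul ξ η‖ = ‖ξ‖ * ‖η‖ := by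
  rw [← toHT_tmul, norm_toHT, TensorProduct.norm_tmul]

theorem ht_clm_ext {S T : HTensor E₁ E₂ →L[ℂ] X}
    (h : ∀ ξ η, S (HTensor.tmul ξ η) = T (HTensor.tmul ξ η)) : S = T := by
  ext u
  refine denseRange_toHT.induction_on u (isClosed_eq S.continuous T.continuous) fun ζ => ?_
  have : S.toLinearMap ∘ₗ toHT = T.toLinearMap ∘ₗ toHT := TensorProduct.ext' h
  exact LinearMap.congr_fun this ζ

theorem ht_ext_inner {u v : HTensor E₁ E₂}
    (h : ∀ ξ η, inner ℂ (HTensor.tmul ξ η) u = inner ℂ (HTensor.tmul ξ η) v) : u = v := by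
  refine ext_inner_left ℂ fun w => ?_
  rw [← inner_conj_symm w u, ← inner_conj_symm w v]
  have : innerSL ℂ u = innerSL ℂ v := ht_clm_ext fun ξ η => by
    change inner ℂ u _ = inner ℂ v _
    rw [← inner_conj_symm, h, inner_conj_symm]
  exact congrArg _ (congrArg (fun S : HTensor E₁ E₂ →L[ℂ] ℂ => S w) this)

/-- The tensor product of two bounded operators. -/
def htMap (f : E₁ →L[ℂ] F₁) (g : E₂ →L[ℂ] F₂) : HTensor E₁ E₂ →L[ℂ] HTensor F₁ F₂ :=
  (TensorProduct.mapL f g).completion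

theorem htMap_toHT (f : E₁ →L[ℂ] F₁) (g : E₂ →L[ℂ] F₂) (ζ : E₁ ⊗[ℂ] E₂) :
    htMap f g (toHT ζ) = toHT (TensorProduct.map f.toLinearMap g.toLinearMap ζ) :=
  (ContinuousLinearMap.completion_apply_coe (TensorProduct.mapL f g) ζ).trans (by
    rw [TensorProduct.mapL_apply]; rfl)

theorem htMap_tmul (f : E₁ →L[ℂ] F₁) (g : E₂ →L[ℂ] F₂) (ξ : E₁) (η : E₂) :
    htMap f g (HTensor.tmul ξ η) = HTensor.tmul (f ξ) (g η) := htMap_toHT f g (ξ ⊗ₜ η)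

theorem htMap_comp (f : F₁ →L[ℂ] G₁) (g : F₂ →L[ℂ] G₂) (f' : E₁ →L[ℂ] F₁) (g' : E₂ →L[ℂ] F₂) :
    htMap f g ∘L htMap f' g' = htMap (f ∘L f') (g ∘L g') :=
  ht_clm_ext fun ξ η => by
    simp only [ContinuousLinearMap.comp_apply, htMap_tmul]

theorem opTensor_mul (a a' : E₁ →L[ℂ] E₁) (b b' : E₂ →L[ℂ] E₂) :
    opTensor a b * opTensor a' b' = opTensor (a * a') (b * b') := htMap_comp a b a' b'

theorem opTensor_one : opTensor (1 : E₁ →L[ℂ] E₁) (1 : E₂ →L[ℂ] E₂) = 1 :=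
  ht_clm_ext fun ξ η => by rw [opTensor_tmul]; rfl

theorem adjoint_htMap [CompleteSpace E₁] [CompleteSpace E₂] [CompleteSpace F₁] [CompleteSpace F₂]
    (f : E₁ →L[ℂ] F₁) (g : E₂ →L[ℂ] F₂) :
    adjoint (htMap f g) = htMap (adjoint f) (adjoint g) :=
  ht_clm_ext fun ξ η => ht_ext_inner fun ξ' η' => by
    rw [ContinuousLinearMap.adjoint_inner_right, htMap_tmul, htMap_tmul, inner_htmul, inner_htmul,
      ContinuousLinearMap.adjoint_inner_right, ContinuousLinearMap.adjoint_inner_right]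

theorem star_opTensor [CompleteSpace E₁] [CompleteSpace E₂]
    (a : E₁ →L[ℂ] E₁) (b : E₂ →L[ℂ] E₂) : star (opTensor a b) = opTensor (star a) (star b) :=
  adjoint_htMap a b

theorem htmul_add_left (ξ ξ' : E₁) (η : E₂) :
    HTensor.tmul (ξ + ξ') η = HTensor.tmul ξ η + HTensor.tmul ξ' η := by
  simp only [← toHT_tmul, TensorProduct.add_tmul, map_add]

theorem htmul_add_right (ξ : E₁) (η η' : E₂) :
    HTensor.tmul ξ (η + η') = HTensor.tmul ξ η + HTensor.tmul ξ η' := by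
  simp only [← toHT_tmul, TensorProduct.tmul_add, map_add]

theorem htmul_smul_left (c : ℂ) (ξ : E₁) (η : E₂) :
    HTensor.tmul (c • ξ) η = c • HTensor.tmul ξ η := by
  simp only [← toHT_tmul, ← TensorProduct.smul_tmul', map_smul]

theorem htmul_smul_right (c : ℂ) (ξ : E₁) (η : E₂) :
    HTensor.tmul ξ (c • η) = c • HTensor.tmul ξ η := by
  simp only [← toHT_tmul, TensorProduct.tmul_smul, map_smul]

/-- The tensor product of operators as a bilinear map. -/
def htMapBilin : (E₁ →L[ℂ] F₁) →ₗ[ℂ] (E₂ →L[ℂ] F₂) →ₗ[ℂ] HTensor E₁ E₂ →L[ℂ] HTensor F₁ F₂ :=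
  LinearMap.mk₂ ℂ htMap
    (fun f f' g => ht_clm_ext fun ξ η => by
      simp only [htMap_tmul, add_apply, htmul_add_left])
    (fun c f g => ht_clm_ext fun ξ η => by
      change _ = c • htMap f g _
      simp only [htMap_tmul, smul_apply, htmul_smul_left])
    (fun f g g' => ht_clm_ext fun ξ η => by
      simp only [htMap_tmul, add_apply, htmul_add_right])
    (fun c f g => ht_clm_ext fun ξ η => by
      change _ = c • htMap f g _
      simp only [htMap_tmul, smul_apply, htmul_smul_right])

end HilbertTensor

/-! ### The tensor product of completely positive maps on the spatial tensor product -/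

section Spatial

open ContinuousLinearMap (adjoint)

variable {H₁ H₂ K₁ K₂ : Type*}
  [NormedAddCommGroup H₁] [InnerProductSpace ℂ H₁] [CompleteSpace H₁]
  [NormedAddCommGroup H₂] [InnerProductSpace ℂ H₂] [CompleteSpace H₂]
  [NormedAddCommGroup K₁] [InnerProductSpace ℂ K₁] [CompleteSpace K₁]
  [NormedAddCommGroup K₂] [InnerProductSpace ℂ K₂] [CompleteSpace K₂]
variable {M₁ : VonNeumannAlgebra H₁} {M₂ : VonNeumannAlgebra H₂}
  {N₁ : VonNeumannAlgebra K₁} {N₂ : VonNeumannAlgebra K₂}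

/-- The inclusion of a concrete algebra as a linear map. -/
def OpAlg.valₗ {H : Type*} [NormedAddCommGroup H] [InnerProductSpace ℂ H] [CompleteSpace H]
    (S : StarSubalgebra ℂ (H →L[ℂ] H)) [IsClosed (S : Set (H →L[ℂ] H))] :
    OpAlg S →ₗ[ℂ] H →L[ℂ] H := (OpAlg.val : OpAlg S →⋆ₐ[ℂ] _).toAlgHom.toLinearMap

theorem OpAlg.valₗ_apply {H : Type*} [NormedAddCommGroup H] [InnerProductSpace ℂ H]
    [CompleteSpace H] (S : StarSubalgebra ℂ (H →L[ℂ] H)) [IsClosed (S : Set (H →L[ℂ] H))]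
    (x : OpAlg S) : OpAlg.valₗ S x = x.val := rfl

theorem OpAlg.norm_val {H : Type*} [NormedAddCommGroup H] [InnerProductSpace ℂ H]
    [CompleteSpace H] {S : StarSubalgebra ℂ (H →L[ℂ] H)} [IsClosed (S : Set (H →L[ℂ] H))]
    (x : OpAlg S) : ‖x.val‖ = ‖x‖ := rfl

theorem OpAlg.val_injective {H : Type*} [NormedAddCommGroup H] [InnerProductSpace ℂ H]
    [CompleteSpace H] {S : StarSubalgebra ℂ (H →L[ℂ] H)} [IsClosed (S : Set (H →L[ℂ] H))] :
    Function.Injective (OpAlg.val : OpAlg S → H →L[ℂ] H) := Subtype.val_injective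

theorem OpAlg.continuous_val {H : Type*} [NormedAddCommGroup H] [InnerProductSpace ℂ H]
    [CompleteSpace H] {S : StarSubalgebra ℂ (H →L[ℂ] H)} [IsClosed (S : Set (H →L[ℂ] H))] :
    Continuous (OpAlg.val : OpAlg S → H →L[ℂ] H) :=
  AddMonoidHomClass.continuous_of_bound (OpAlg.valₗ S) 1 fun x => by
    rw [one_mul, OpAlg.valₗ_apply, OpAlg.norm_val]

variable (M₁ M₂) in
/-- The algebraic tensor product of `M₁` and `M₂`, represented on the tensor product of the
Hilbert spaces. -/
def spatialRep : Elem M₁ ⊗[ℂ] Elem M₂ →ₗ[ℂ] HTensor H₁ H₂ →L[ℂ] HTensor H₁ H₂ :=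
  TensorProduct.lift (htMapBilin.compl₁₂ (OpAlg.valₗ _) (OpAlg.valₗ _))

theorem spatialRep_tmul (a : Elem M₁) (b : Elem M₂) :
    spatialRep M₁ M₂ (a ⊗ₜ b) = opTensor a.val b.val := rfl

theorem exists_spatialRep_mul (z w : Elem M₁ ⊗[ℂ] Elem M₂) :
    ∃ v, spatialRep M₁ M₂ v = spatialRep M₁ M₂ z * spatialRep M₁ M₂ w := by
  induction z with
  | zero => exact ⟨0, by simp⟩
  | add z z' hz hz' =>
    obtain ⟨v, hv⟩ := hz
    obtain ⟨v', hv'⟩ := hz'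
    exact ⟨v + v', by rw [map_add, map_add, add_mul, hv, hv']⟩
  | tmul a b =>
    induction w with
    | zero => exact ⟨0, by simp⟩
    | add z z' hz hz' =>
      obtain ⟨v, hv⟩ := hz
      obtain ⟨v', hv'⟩ := hz'
      exact ⟨v + v', by rw [map_add, map_add, mul_add, hv, hv']⟩
    | tmul a' b' =>
      refine ⟨(a * a') ⊗ₜ (b * b'), ?_⟩
      rw [spatialRep_tmul, spatialRep_tmul, spatialRep_tmul, opTensor_mul, map_mul, map_mul]

theorem exists_spatialRep_star (z : Elem M₁ ⊗[ℂ] Elem M₂) :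
    ∃ v, spatialRep M₁ M₂ v = star (spatialRep M₁ M₂ z) := by
  induction z with
  | zero => exact ⟨0, by simp⟩
  | add z z' hz hz' =>
    obtain ⟨v, hv⟩ := hz
    obtain ⟨v', hv'⟩ := hz'
    exact ⟨v + v', by rw [map_add, map_add, star_add, hv, hv']⟩
  | tmul a b =>
    refine ⟨star a ⊗ₜ star b, ?_⟩
    rw [spatialRep_tmul, spatialRep_tmul, star_opTensor, map_star, map_star]

theorem spatialRep_one : spatialRep M₁ M₂ (1 ⊗ₜ 1) = 1 := by
  rw [spatialRep_tmul, map_one, map_one, opTensor_one]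

theorem spatialRep_mem_cstarTensor (z : Elem M₁ ⊗[ℂ] Elem M₂) :
    spatialRep M₁ M₂ z ∈ cstarTensor M₁ M₂ := by
  induction z with
  | zero => rw [map_zero]; exact zero_mem _
  | add z z' hz hz' => rw [map_add]; exact add_mem hz hz'
  | tmul a b => exact opTensor_mem_cstarTensor a b

/-- The span of the elementary tensors contains `1` and is closed under products and adjoints, so it
is the generated ⋆-algebra. -/
theorem exists_spatialRep_of_mem_adjoin {x : HTensor H₁ H₂ →L[ℂ] HTensor H₁ H₂}
    (hx : x ∈ StarAlgebra.adjoin ℂ (elementary M₁ M₂)) : ∃ z, spatialRep M₁ M₂ z = x := by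
  induction hx using StarAlgebra.adjoin_induction with
  | mem x hx =>
    obtain ⟨a, ha, b, hb, rfl⟩ := hx
    exact ⟨(⟨a, ha⟩ : Elem M₁) ⊗ₜ (⟨b, hb⟩ : Elem M₂), rfl⟩
  | algebraMap c =>
    exact ⟨c • (1 ⊗ₜ 1), by rw [map_smul, spatialRep_one, Algebra.algebraMap_eq_smul_one]⟩
  | add x y _ _ hx hy =>
    obtain ⟨v, rfl⟩ := hx
    obtain ⟨w, rfl⟩ := hy
    exact ⟨v + w, map_add _ _ _⟩
  | mul x y _ _ hx hy =>
    obtain ⟨v, rfl⟩ := hx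
    obtain ⟨w, rfl⟩ := hy
    exact exists_spatialRep_mul v w
  | star x _ hx =>
    obtain ⟨v, rfl⟩ := hx
    exact exists_spatialRep_star v

variable (M₁ M₂) in
/-- The map of the algebraic tensor product into the spatial tensor product. -/
def toSpatial : Elem M₁ ⊗[ℂ] Elem M₂ →ₗ[ℂ] OpAlg (cstarTensor M₁ M₂) where
  toFun z := ⟨spatialRep M₁ M₂ z, spatialRep_mem_cstarTensor z⟩
  map_add' _ _ := Subtype.ext (map_add (spatialRep M₁ M₂) _ _)
  map_smul' _ _ := Subtype.ext (map_smul (spatialRep M₁ M₂) _ _)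

theorem val_toSpatial (z : Elem M₁ ⊗[ℂ] Elem M₂) :
    (toSpatial M₁ M₂ z).val = spatialRep M₁ M₂ z := rfl

theorem toSpatial_tmul (a : Elem M₁) (b : Elem M₂) : toSpatial M₁ M₂ (a ⊗ₜ b) =
    ⟨_, opTensor_mem_cstarTensor a b⟩ := rfl

theorem toSpatial_one : toSpatial M₁ M₂ (1 ⊗ₜ 1) = 1 := OpAlg.val_injective (by
  rw [val_toSpatial, spatialRep_one, map_one])

theorem denseRange_toSpatial : DenseRange (toSpatial M₁ M₂) := by
  intro x
  have hx : x.val ∈ closure (StarAlgebra.adjoin ℂ (elementary M₁ M₂) :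
    Set (HTensor H₁ H₂ →L[ℂ] HTensor H₁ H₂)) := x.2
  rw [Metric.mem_closure_iff] at hx ⊢
  intro ε hε
  obtain ⟨y, hy, hxy⟩ := hx ε hε
  obtain ⟨z, rfl⟩ := exists_spatialRep_of_mem_adjoin hy
  refine ⟨_, ⟨z, rfl⟩, ?_⟩
  rwa [dist_eq_norm, ← OpAlg.norm_val, map_sub, val_toSpatial, ← dist_eq_norm]

/-- The tensor product of the Stinespring families of two maps. -/
def stineTensor (Φ₁ : Elem M₁ →CP Elem N₁) (Φ₂ : Elem M₂ →CP Elem N₂) :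
    Elem M₁ ⊗[ℂ] Elem M₂ →ₗ[ℂ]
      HTensor K₁ K₂ →L[ℂ] HTensor (cpForm Φ₁).Hilbert (cpForm Φ₂).Hilbert :=
  TensorProduct.lift (htMapBilin.compl₁₂ (stine Φ₁) (stine Φ₂))

theorem stineTensor_tmul (Φ₁ : Elem M₁ →CP Elem N₁) (Φ₂ : Elem M₂ →CP Elem N₂)
    (a : Elem M₁) (b : Elem M₂) :
    stineTensor Φ₁ Φ₂ (a ⊗ₜ b) = htMap (stine Φ₁ a) (stine Φ₂ b) := rfl

/-- Boundedness for the spatial norm is what lets the tensor product of two Stinespring families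
extend to the closure of the algebraic tensor product. -/
theorem norm_stineTensor_le (Φ₁ : Elem M₁ →CP Elem N₁) (Φ₂ : Elem M₂ →CP Elem N₂)
    (z : Elem M₁ ⊗[ℂ] Elem M₂) :
    ‖stineTensor Φ₁ Φ₂ z‖ ≤ ‖htMap (stine Φ₁ 1) (stine Φ₂ 1)‖ * ‖toSpatial M₁ M₂ z‖ := by
  refine ContinuousLinearMap.opNorm_le_bound _ (by positivity) fun u => ?_
  refine denseRange_toHT.induction_on u (isClosed_le (by fun_prop) (by fun_prop)) fun ζ => ?_
  obtain ⟨m, a, b, rfl⟩ := exists_fin_sum_tmul z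
  have h1 : ∀ θ : H₁ ⊗[ℂ] H₂, (toSpatial M₁ M₂ (∑ i, a i ⊗ₜ b i)).val (toHT θ) =
      toHT (∑ i, TensorProduct.map ((a i).val : H₁ →ₗ[ℂ] H₁) ((b i).val : H₂ →ₗ[ℂ] H₂) θ) := by
    intro θ
    rw [val_toSpatial, map_sum, sum_apply, map_sum]
    exact Finset.sum_congr rfl fun i _ => htMap_toHT (a i).val (b i).val θ
  have h2 : stineTensor Φ₁ Φ₂ (∑ i, a i ⊗ₜ b i) (toHT ζ) =
      toHT (∑ i, TensorProduct.map (stine Φ₁ (a i)).toLinearMap (stine Φ₂ (b i)).toLinearMap ζ) := by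
    rw [map_sum, sum_apply, map_sum]
    exact Finset.sum_congr rfl fun i _ => htMap_toHT _ _ ζ
  have h3 := norm_sum_stine_tensor_le Φ₁ Φ₂ a b ‖toSpatial M₁ M₂ (∑ i, a i ⊗ₜ b i)‖
    (norm_nonneg _) (fun θ => by
      rw [← norm_toHT, ← h1, ← norm_toHT θ, ← OpAlg.norm_val]
      exact ContinuousLinearMap.le_opNorm _ _) ζ
  rw [h2, norm_toHT]
  refine h3.trans ?_
  rw [← norm_toHT (TensorProduct.map _ _ ζ), ← htMap_toHT, mul_comm ‖htMap _ _‖, mul_assoc]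
  exact mul_le_mul_of_nonneg_left (ContinuousLinearMap.le_opNorm _ _) (norm_nonneg _)

theorem exists_spatialStine (Φ₁ : Elem M₁ →CP Elem N₁) (Φ₂ : Elem M₂ →CP Elem N₂) :
    ∃ V : OpAlg (cstarTensor M₁ M₂) →L[ℂ]
      (HTensor K₁ K₂ →L[ℂ] HTensor (cpForm Φ₁).Hilbert (cpForm Φ₂).Hilbert),
      ∀ z, V (toSpatial M₁ M₂ z) = stineTensor Φ₁ Φ₂ z :=
  exists_clm_of_denseRange _ _ denseRange_toSpatial _ (norm_stineTensor_le Φ₁ Φ₂)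

theorem star_toSpatial_tmul (a : Elem M₁) (b : Elem M₂) : star (toSpatial M₁ M₂ (a ⊗ₜ b)) =
    toSpatial M₁ M₂ (star a ⊗ₜ star b) := OpAlg.val_injective (by
  rw [map_star, val_toSpatial, val_toSpatial, spatialRep_tmul, spatialRep_tmul, star_opTensor,
    map_star, map_star])

theorem toSpatial_tmul_mul (a a' : Elem M₁) (b b' : Elem M₂) : toSpatial M₁ M₂ (a ⊗ₜ b) *
    toSpatial M₁ M₂ (a' ⊗ₜ b') = toSpatial M₁ M₂ ((a * a') ⊗ₜ (b * b')) :=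
  OpAlg.val_injective (by
    rw [map_mul, val_toSpatial, val_toSpatial, val_toSpatial, spatialRep_tmul, spatialRep_tmul,
      spatialRep_tmul, opTensor_mul, map_mul, map_mul])

/-- The relation `V(w)⋆ V(x) = V(1)⋆ V(w⋆ x)` need only be checked on a total set. -/
theorem dilation_of_tmul {A P Q K E : Type*} [CStarAlgebra A]
    [AddCommMonoid P] [Module ℂ P] [AddCommMonoid Q] [Module ℂ Q]
    [NormedAddCommGroup K] [InnerProductSpace ℂ K] [CompleteSpace K]
    [NormedAddCommGroup E] [InnerProductSpace ℂ E] [CompleteSpace E]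
    (V : A →L[ℂ] K →L[ℂ] E) (s : P ⊗[ℂ] Q →ₗ[ℂ] A) (hs : DenseRange s)
    (h : ∀ a b a' b', adjoint (V (s (a ⊗ₜ b))) ∘L V (s (a' ⊗ₜ b')) =
      adjoint (V 1) ∘L V (star (s (a ⊗ₜ b)) * s (a' ⊗ₜ b'))) (w x : A) :
    adjoint (V w) ∘L V x = adjoint (V 1) ∘L V (star w * x) := by
  refine hs.induction_on₂ (isClosed_eq ?_ ?_) (fun z z' => ?_) w x
  · exact ((adjoint.continuous.comp (V.continuous.comp continuous_fst)).clm_comp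
      (V.continuous.comp continuous_snd))
  · exact continuous_const.clm_comp
      (V.continuous.comp ((continuous_fst.star).mul continuous_snd))
  · induction z with
    | zero =>
      rw [s.map_zero, V.map_zero, map_zero, star_zero, zero_mul, V.map_zero,
        ContinuousLinearMap.zero_comp, ContinuousLinearMap.comp_zero]
    | add z₁ z₂ h₁ h₂ =>
      rw [s.map_add, V.map_add, map_add, ContinuousLinearMap.add_comp, h₁, h₂, star_add, add_mul,
        V.map_add, ContinuousLinearMap.comp_add]
    | tmul a b =>
      induction z' with
      | zero =>
        rw [s.map_zero, V.map_zero, mul_zero, V.map_zero,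
          ContinuousLinearMap.comp_zero, ContinuousLinearMap.comp_zero]
      | add z₁ z₂ h₁ h₂ =>
        rw [s.map_add, V.map_add, ContinuousLinearMap.comp_add, h₁, h₂, mul_add, V.map_add,
          ContinuousLinearMap.comp_add]
      | tmul a' b' => exact h a b a' b'

theorem adjoint_stineTensor_comp (Φ₁ : Elem M₁ →CP Elem N₁) (Φ₂ : Elem M₂ →CP Elem N₂)
    (a a' : Elem M₁) (b b' : Elem M₂) :
    adjoint (stineTensor Φ₁ Φ₂ (a ⊗ₜ b)) ∘L stineTensor Φ₁ Φ₂ (a' ⊗ₜ b') =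
      opTensor (op Φ₁ (star a * a')) (op Φ₂ (star b * b')) := by
  rw [stineTensor_tmul, stineTensor_tmul, adjoint_htMap, htMap_comp, adjoint_stine_comp,
    adjoint_stine_comp]
  rfl

end Spatial

/-! ### Existence and uniqueness of the tensor product map on the spatial tensor product -/

section Spatial

open ContinuousLinearMap (adjoint)

variable {H₁ H₂ K₁ K₂ : Type*}
  [NormedAddCommGroup H₁] [InnerProductSpace ℂ H₁] [CompleteSpace H₁]
  [NormedAddCommGroup H₂] [InnerProductSpace ℂ H₂] [CompleteSpace H₂]
  [NormedAddCommGroup K₁] [InnerProductSpace ℂ K₁] [CompleteSpace K₁]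
  [NormedAddCommGroup K₂] [InnerProductSpace ℂ K₂] [CompleteSpace K₂]
variable {M₁ : VonNeumannAlgebra H₁} {M₂ : VonNeumannAlgebra H₂}
  {N₁ : VonNeumannAlgebra K₁} {N₂ : VonNeumannAlgebra K₂}

theorem exists_star_toSpatial_mul (Φ₁ : Elem M₁ →CP Elem N₁) (Φ₂ : Elem M₂ →CP Elem N₂)
    (a : Elem M₁) (b : Elem M₂) (a' : Elem M₁) (b' : Elem M₂) :
    ∃ p, star (toSpatial M₁ M₂ (a ⊗ₜ b)) * toSpatial M₁ M₂ (a' ⊗ₜ b') = toSpatial M₁ M₂ p ∧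
      adjoint (stineTensor Φ₁ Φ₂ (a ⊗ₜ b)) ∘L stineTensor Φ₁ Φ₂ (a' ⊗ₜ b') =
        adjoint (stineTensor Φ₁ Φ₂ (1 ⊗ₜ 1)) ∘L stineTensor Φ₁ Φ₂ p := by
  refine ⟨(star a * a') ⊗ₜ (star b * b'), ?_, ?_⟩
  · rw [star_toSpatial_tmul, toSpatial_tmul_mul]
  · rw [adjoint_stineTensor_comp, adjoint_stineTensor_comp, star_one, one_mul, star_one, one_mul]

theorem comp_mem_of_tmul {A P Q K E : Type*} [NormedAddCommGroup A] [NormedSpace ℂ A]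
    [AddCommMonoid P] [Module ℂ P] [AddCommMonoid Q] [Module ℂ Q]
    [NormedAddCommGroup K] [InnerProductSpace ℂ K] [CompleteSpace K]
    [NormedAddCommGroup E] [InnerProductSpace ℂ E]
    (V : A →L[ℂ] K →L[ℂ] E) (T : E →L[ℂ] K) (s : P ⊗[ℂ] Q →ₗ[ℂ] A) (hs : DenseRange s)
    (S : StarSubalgebra ℂ (K →L[ℂ] K)) (hS : IsClosed (S : Set (K →L[ℂ] K)))
    (h : ∀ a b, T ∘L V (s (a ⊗ₜ b)) ∈ S) (x : A) : T ∘L V x ∈ S := by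
  refine hs.induction_on x (hS.preimage (continuous_const.clm_comp V.continuous)) fun z => ?_
  induction z with
  | zero =>
    rw [s.map_zero, V.map_zero, ContinuousLinearMap.comp_zero]
    exact zero_mem _
  | add z₁ z₂ h₁ h₂ =>
    rw [s.map_add, V.map_add, ContinuousLinearMap.comp_add]
    exact add_mem h₁ h₂
  | tmul a b => exact h a b

/-- The extended family `V` satisfies the dilation relation on elementary tensors, hence everywhere
by density, and `x ↦ V(1)⋆ V(x)` is the required map. -/
theorem exists_isCstarTensorMap (Φ₁ : Elem M₁ →CP Elem N₁) (Φ₂ : Elem M₂ →CP Elem N₂) :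
    ∃ Φ, IsCstarTensorMap Φ₁ Φ₂ Φ := by
  obtain ⟨V, hV⟩ := exists_spatialStine Φ₁ Φ₂
  have h0 : V 1 = stineTensor Φ₁ Φ₂ (1 ⊗ₜ 1) := by rw [← toSpatial_one, hV]
  have h1 : ∀ w x, adjoint (V w) ∘L V x = adjoint (V 1) ∘L V (star w * x) := by
    refine dilation_of_tmul V (toSpatial M₁ M₂) ?_ ?_
    · exact denseRange_toSpatial
    intro a b a' b'
    obtain ⟨p, hp, hp'⟩ := exists_star_toSpatial_mul Φ₁ Φ₂ a b a' b'
    have e1 := congrArg₂ (fun X Y => adjoint X ∘L Y) (hV (a ⊗ₜ b)) (hV (a' ⊗ₜ b'))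
    have e2 := congrArg₂ (fun X Y => adjoint X ∘L Y) h0 ((congrArg V hp).trans (hV p))
    exact e1.trans (hp'.trans e2.symm)
  have hval : ∀ (a : Elem M₁) (b : Elem M₂), adjoint (V 1) ∘L V (toSpatial M₁ M₂ (a ⊗ₜ b)) =
      opTensor (op Φ₁ a) (op Φ₂ b) := by
    intro a b
    refine (congrArg₂ (fun X Y => adjoint X ∘L Y) h0 (hV (a ⊗ₜ b))).trans ?_
    refine (adjoint_stineTensor_comp Φ₁ Φ₂ 1 a 1 b).trans ?_
    rw [star_one, one_mul, star_one, one_mul]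
  have h2 : ∀ x, adjoint (V 1) ∘L V x ∈ (vnTensor N₁ N₂).toStarSubalgebra := by
    intro x
    refine comp_mem_of_tmul V (adjoint (V 1)) (toSpatial M₁ M₂) ?_
      (vnTensor N₁ N₂).toStarSubalgebra inferInstance (fun a b => ?_) x
    · exact denseRange_toSpatial
    · exact (hval a b).symm ▸ opTensor_mem_vnTensor (Φ₁ a) (Φ₂ b)
  exact ⟨cpOfDilation V.toLinearMap h1 h2, fun a b => hval a b⟩

theorem isCstarTensorMap_cstarTensorMap (Φ₁ : Elem M₁ →CP Elem N₁) (Φ₂ : Elem M₂ →CP Elem N₂) :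
    IsCstarTensorMap Φ₁ Φ₂ (cstarTensorMap Φ₁ Φ₂) := by
  have h := exists_isCstarTensorMap Φ₁ Φ₂
  rw [cstarTensorMap, dif_pos h]
  exact h.choose_spec

theorem continuous_op {A : Type*} [CStarAlgebra A] [PartialOrder A] [StarOrderedRing A]
    {K : Type*} [NormedAddCommGroup K] [InnerProductSpace ℂ K] [CompleteSpace K]
    {N : VonNeumannAlgebra K} (Φ : A →CP Elem N) : Continuous (op Φ) :=
  OpAlg.continuous_val.comp (map_continuous Φ)

theorem op_add {A : Type*} [CStarAlgebra A] [PartialOrder A] [StarOrderedRing A]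
    {K : Type*} [NormedAddCommGroup K] [InnerProductSpace ℂ K] [CompleteSpace K]
    {N : VonNeumannAlgebra K} (Φ : A →CP Elem N) (x y : A) : op Φ (x + y) = op Φ x + op Φ y := by
  rw [op, map_add, map_add]

theorem op_smul {A : Type*} [CStarAlgebra A] [PartialOrder A] [StarOrderedRing A]
    {K : Type*} [NormedAddCommGroup K] [InnerProductSpace ℂ K] [CompleteSpace K]
    {N : VonNeumannAlgebra K} (Φ : A →CP Elem N) (c : ℂ) (x : A) : op Φ (c • x) = c • op Φ x := by
  rw [op, map_smul, map_smul]

theorem op_zero {A : Type*} [CStarAlgebra A] [PartialOrder A] [StarOrderedRing A]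
    {K : Type*} [NormedAddCommGroup K] [InnerProductSpace ℂ K] [CompleteSpace K]
    {N : VonNeumannAlgebra K} (Φ : A →CP Elem N) : op Φ 0 = 0 := by
  rw [op, map_zero, map_zero]

theorem IsCstarTensorMap.unique {Φ₁ : Elem M₁ →CP Elem N₁} {Φ₂ : Elem M₂ →CP Elem N₂}
    {Φ Φ' : OpAlg (cstarTensor M₁ M₂) →CP Elem (vnTensor N₁ N₂)}
    (h : IsCstarTensorMap Φ₁ Φ₂ Φ) (h' : IsCstarTensorMap Φ₁ Φ₂ Φ') : Φ = Φ' := by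
  refine op_ext fun x => denseRange_toSpatial.induction_on x
    (isClosed_eq (continuous_op Φ) (continuous_op Φ')) fun z => ?_
  induction z with
  | zero => rw [map_zero, op_zero, op_zero]
  | add z₁ z₂ h₁ h₂ => rw [map_add, op_add, op_add, h₁, h₂]
  | tmul a b => rw [toSpatial_tmul, h, h']

end Spatial

/-! ### Amplifications and the density theorem -/

section Amplification

open ContinuousLinearMap (adjoint)
open Filter Topology

/-- The Hilbert sum of copies of `H`. -/
abbrev Amp (κ H : Type*) [NormedAddCommGroup H] : Type _ := lp (fun _ : κ => H) 2

section

variable {κ H : Type*} [NormedAddCommGroup H]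

theorem summable_norm_sq_amp (Ξ : Amp κ H) : Summable fun i => ‖Ξ i‖ ^ 2 := by
  simpa using (lp.memℓp Ξ).summable (by norm_num)

theorem memℓp_of_summable_sq {ξ : κ → H} (h : Summable fun i => ‖ξ i‖ ^ 2) :
    Memℓp (E := fun _ : κ => H) ξ 2 := memℓp_gen (by simpa using h)

theorem hasSum_norm_sq_amp (Ξ : Amp κ H) : HasSum (fun i => ‖Ξ i‖ ^ 2) (‖Ξ‖ ^ 2) := by
  simpa using lp.hasSum_norm (p := 2) (by norm_num) Ξ

end

variable {κ H : Type*} [NormedAddCommGroup H] [InnerProductSpace ℂ H]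

/-- The amplification of an operator, as a linear map. -/
def amplAux (κ : Type*) (x : H →L[ℂ] H) : Amp κ H →ₗ[ℂ] Amp κ H where
  toFun Ξ := ⟨fun i => x (Ξ i), memℓp_of_summable_sq <| by
    refine Summable.of_nonneg_of_le (fun _ => by positivity) (fun i => ?_)
      ((summable_norm_sq_amp Ξ).mul_left (‖x‖ ^ 2))
    rw [← mul_pow]
    exact pow_le_pow_left₀ (norm_nonneg _) (x.le_opNorm _) 2⟩
  map_add' Ξ Ξ' := lp.ext (funext fun i => x.map_add (Ξ i) (Ξ' i))
  map_smul' c Ξ := lp.ext (funext fun i => x.map_smul c (Ξ i))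

theorem norm_amplAux_le (x : H →L[ℂ] H) (Ξ : Amp κ H) : ‖amplAux κ x Ξ‖ ≤ ‖x‖ * ‖Ξ‖ := by
  refine le_of_sq_le_sq ?_ (by positivity)
  rw [mul_pow]
  refine hasSum_le (fun i => ?_) (hasSum_norm_sq_amp (amplAux κ x Ξ))
    ((hasSum_norm_sq_amp Ξ).mul_left (‖x‖ ^ 2))
  rw [← mul_pow]
  exact pow_le_pow_left₀ (norm_nonneg _) (x.le_opNorm _) 2

/-- The amplification `x ⊗ 1` of an operator to a Hilbert sum of copies of the space. -/
def ampl (κ : Type*) (x : H →L[ℂ] H) : Amp κ H →L[ℂ] Amp κ H :=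
  (amplAux κ x).mkContinuous ‖x‖ (norm_amplAux_le x)

theorem ampl_apply (x : H →L[ℂ] H) (Ξ : Amp κ H) (i : κ) : ampl κ x Ξ i = x (Ξ i) := rfl

theorem norm_ampl_le (x : H →L[ℂ] H) (Ξ : Amp κ H) : ‖ampl κ x Ξ‖ ≤ ‖x‖ * ‖Ξ‖ :=
  norm_amplAux_le x Ξ

theorem hasSum_inner_ampl (x : H →L[ℂ] H) (Ξ Ξ' : Amp κ H) :
    HasSum (fun i => inner ℂ (Ξ' i) (x (Ξ i))) (inner ℂ Ξ' (ampl κ x Ξ)) :=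
  lp.hasSum_inner Ξ' (ampl κ x Ξ)

theorem inner_ampl [CompleteSpace H] (x : H →L[ℂ] H) (Ξ Ξ' : Amp κ H) :
    inner ℂ Ξ' (ampl κ (star x) Ξ) = inner ℂ (ampl κ x Ξ') Ξ := by
  rw [lp.inner_eq_tsum, lp.inner_eq_tsum]
  exact tsum_congr fun i => ContinuousLinearMap.adjoint_inner_right x _ _

/-- The amplification as a representation. -/
def amplHom (κ H : Type*) [NormedAddCommGroup H] [InnerProductSpace ℂ H] [CompleteSpace H] :
    (H →L[ℂ] H) →⋆ₐ[ℂ] (Amp κ H →L[ℂ] Amp κ H) where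
  toFun := ampl κ
  map_one' := rfl
  map_mul' _ _ := rfl
  map_zero' := rfl
  map_add' _ _ := rfl
  commutes' _ := rfl
  map_star' x := ContinuousLinearMap.ext fun Ξ => ext_inner_left ℂ fun Ξ' =>
    (inner_ampl x Ξ Ξ').trans (ContinuousLinearMap.adjoint_inner_right _ _ _).symm

theorem ampl_single [DecidableEq κ] (x : H →L[ℂ] H) (i : κ) (ξ : H) :
    ampl κ x (lp.single 2 i ξ) = lp.single 2 i (x ξ) := by
  refine lp.ext (funext fun j => ?_)
  rw [ampl_apply]
  by_cases h : j = i
  · subst h; rw [lp.single_apply_self, lp.single_apply_self]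
  · rw [lp.single_apply_ne _ _ _ h, lp.single_apply_ne _ _ _ h, map_zero]

open Classical in
/-- If `x` commutes with the commutant of `S`, then its amplification commutes with the commutant
of the amplification of `S`. -/
theorem ampl_commute {S : Set (H →L[ℂ] H)} {x : H →L[ℂ] H}
    (hx : ∀ T : H →L[ℂ] H, (∀ s ∈ S, Commute s T) → Commute x T)
    {T : Amp κ H →L[ℂ] Amp κ H} (hT : ∀ s ∈ S, Commute (ampl κ s) T) :
    Commute (ampl κ x) T := by
  have hE : ∀ i j (s : H →L[ℂ] H) (ξ : H), Commute (ampl κ s) T →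
      s (T (lp.single 2 i ξ) j) = T (lp.single 2 i (s ξ)) j := fun i j s ξ h => by
    rw [← ampl_single, ← ampl_apply]
    exact congrArg (fun R : Amp κ H →L[ℂ] Amp κ H => R (lp.single 2 i ξ) j) h.eq
  refine lp.ext_continuousLinearMap (p := 2) (by norm_num) fun i => ?_
  refine ContinuousLinearMap.ext fun ξ => lp.ext (funext fun j => ?_)
  change x (T (lp.single 2 i ξ) j) = T (ampl κ x (lp.single 2 i ξ)) j
  rw [ampl_single]
  -- `R` is the `(j, i)` entry of the operator matrix of `T`; it commutes with `S` because
  -- amplifications are diagonal.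
  let R : H →L[ℂ] H := (lp.evalCLM ℂ (fun _ : κ => H) 2 j) ∘L T ∘L
    (lp.singleContinuousLinearMap ℂ (fun _ : κ => H) 2 i)
  have hR := hx R fun s hs => ContinuousLinearMap.ext fun ξ => hE i j s ξ (hT s hs)
  exact congrArg (fun R : H →L[ℂ] H => R ξ) hR.eq

variable [CompleteSpace H]

/-- A vector form of von Neumann's density theorem. -/
theorem mem_closure_of_commute (S : StarSubalgebra ℂ (H →L[ℂ] H)) {x : H →L[ℂ] H}
    (hx : ∀ T : H →L[ℂ] H, (∀ s ∈ S, Commute s T) → Commute x T) (ξ : H) :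
    x ξ ∈ closure ((fun s : H →L[ℂ] H => s ξ) '' S) := by
  let P₀ : Submodule ℂ H :=
    S.toSubalgebra.toSubmodule.map (ContinuousLinearMap.apply ℂ H ξ : (H →L[ℂ] H) →ₗ[ℂ] H)
  let P := P₀.topologicalClosure
  have : CompleteSpace P := P₀.isClosed_topologicalClosure.completeSpace_coe
  have hP0 : ∀ s ∈ S, ∀ v ∈ P₀, s v ∈ P₀ := by
    rintro s hs _ ⟨t, ht, rfl⟩
    exact ⟨s * t, S.mul_mem hs ht, rfl⟩
  have hP : ∀ s ∈ S, ∀ v ∈ P, s v ∈ P := fun s hs v hv =>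
    map_mem_closure s.continuous hv (hP0 s hs)
  have hPo : ∀ s ∈ S, ∀ v ∈ Pᗮ, s v ∈ Pᗮ := fun s hs v hv => by
    rw [Submodule.mem_orthogonal] at hv ⊢
    intro u hu
    rw [← ContinuousLinearMap.adjoint_inner_left]
    exact hv _ (hP _ (star_mem hs) u hu)
  -- The closure `P` of `S ξ` and its orthogonal complement are both invariant under `S`, so the
  -- projection commutes with `S`, hence with `x`; since `ξ ∈ P`, also `x ξ ∈ P`.
  have hcomm := hx P.starProjection fun s hs => ContinuousLinearMap.ext fun v => by
    change s (P.starProjection v) = P.starProjection (s v)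
    refine (Submodule.eq_starProjection_of_mem_of_inner_eq_zero (hP s hs _ ?_) ?_).symm
    · exact Submodule.starProjection_apply_mem P v
    · intro w hw
      rw [← map_sub]
      have := hPo s hs _ (Submodule.sub_starProjection_mem_orthogonal (K := P) v)
      exact Submodule.inner_left_of_mem_orthogonal hw this
  have hξ : ξ ∈ P := subset_closure ⟨1, one_mem S, rfl⟩
  have h1 : P.starProjection (x ξ) = x ξ := by
    have := congrArg (fun R : H →L[ℂ] H => R ξ) hcomm.eq
    change x (P.starProjection ξ) = P.starProjection (x ξ) at this
    rw [← this, Submodule.starProjection_eq_self_iff.2 hξ]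
  have h2 : x ξ ∈ P := by rw [← h1]; exact Submodule.starProjection_apply_mem P _
  exact h2

/-- The filter `l` on operators converges to `x` in the ultrastrong topology. -/
def UltrastrongLim {ι : Type*} (f : ι → H →L[ℂ] H) (l : Filter ι) (x : H →L[ℂ] H) : Prop :=
  ∀ Ξ : Amp ℕ H, Tendsto (fun z => ampl ℕ (f z) Ξ) l (𝓝 (ampl ℕ x Ξ))

/-- Von Neumann's density theorem: every element of the double commutant of `S` is an ultrastrong
limit of elements of `S`. -/
theorem exists_ultrastrongLim (S : StarSubalgebra ℂ (H →L[ℂ] H)) {x : H →L[ℂ] H}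
    (hx : ∀ T : H →L[ℂ] H, (∀ s ∈ S, Commute s T) → Commute x T) :
    ∃ l : Filter S, l.NeBot ∧ UltrastrongLim (fun s : S => (s : H →L[ℂ] H)) l x := by
  let F : S → Amp ℕ H → Amp ℕ H := fun s Ξ => ampl ℕ (s : H →L[ℂ] H) Ξ
  let G : Amp ℕ H → Amp ℕ H := fun Ξ => ampl ℕ x Ξ
  -- The coarsest filter on `S` along which all amplified orbits converge to those of `x`. The
  -- content is that it is proper.
  refine ⟨(𝓝 G).comap F, ?_, fun Ξ => ((continuous_apply Ξ).tendsto G).comp tendsto_comap⟩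
  rw [comap_neBot_iff]
  intro t ht
  rw [nhds_pi, Filter.mem_pi] at ht
  obtain ⟨I, hI, u, hu, hut⟩ := ht
  have := hI.to_subtype
  -- Finitely many conditions become one condition at a single vector of a second, finite
  -- amplification, where the vector form of the density theorem applies.
  let Ω : Amp I (Amp ℕ H) := ⟨fun i => i.1, Memℓp.all _⟩
  let S₂ : StarSubalgebra ℂ (Amp I (Amp ℕ H) →L[ℂ] Amp I (Amp ℕ H)) :=
    S.map ((amplHom I (Amp ℕ H)).comp (amplHom ℕ H))
  have h2 := mem_closure_of_commute S₂ (x := ampl I (ampl ℕ x)) (fun T hT => by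
    refine ampl_commute (S := ampl ℕ '' (S : Set (H →L[ℂ] H))) (fun R hR => ?_) ?_
    · exact ampl_commute (S := S) hx fun s hs => hR _ ⟨s, hs, rfl⟩
    · rintro _ ⟨s, hs, rfl⟩
      exact hT _ ⟨s, hs, rfl⟩) Ω
  have hnb : {Θ : Amp I (Amp ℕ H) | ∀ i : I, Θ i ∈ u i} ∈ 𝓝 (ampl I (ampl ℕ x) Ω) := by
    rw [Set.ofPred_forall]
    refine (Filter.iInter_mem).2 fun i => ?_
    exact (lp.evalCLM ℂ (fun _ : I => Amp ℕ H) 2 i).continuous.continuousAt.preimage_mem_nhds (hu i)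
  obtain ⟨_, h3, _, ⟨s, hs, rfl⟩, rfl⟩ := mem_closure_iff_nhds.1 h2 _ hnb
  exact ⟨⟨s, hs⟩, hut fun Ξ hΞ => h3 ⟨Ξ, hΞ⟩⟩

end Amplification

/-! ### Dominated positive functionals -/

section Dominated

variable {A 𝓛 : Type*} [Ring A] [StarRing A] [Algebra ℂ A]
  [NormedAddCommGroup 𝓛] [InnerProductSpace ℂ 𝓛] [CompleteSpace 𝓛]

/-- The linear map `x ↦ ρ(x) Ξ`. -/
def repVec (ρ : A →⋆ₐ[ℂ] (𝓛 →L[ℂ] 𝓛)) (Ξ : 𝓛) : A →ₗ[ℂ] 𝓛 where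
  toFun x := ρ x Ξ
  map_add' x y := by rw [map_add, add_apply]
  map_smul' c x := by rw [map_smul, smul_apply]; rfl

theorem repVec_apply (ρ : A →⋆ₐ[ℂ] (𝓛 →L[ℂ] 𝓛)) (Ξ : 𝓛) (x : A) : repVec ρ Ξ x = ρ x Ξ := rfl

theorem inner_repVec (ρ : A →⋆ₐ[ℂ] (𝓛 →L[ℂ] 𝓛)) (Ξ : 𝓛) (x y : A) :
    inner ℂ Ξ (repVec ρ Ξ (star y * x)) = inner ℂ (ρ y Ξ) (ρ x Ξ) := by
  rw [repVec_apply, map_mul, map_star, mul_apply_eq_comp, ContinuousLinearMap.star_eq_adjoint,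
    ContinuousLinearMap.adjoint_inner_right]

variable [StarModule ℂ A]

/-- The form `(x, y) ↦ φ(y⋆ x)` of a positive functional. -/
def functionalForm (φ : A →ₗ[ℂ] ℂ) (h : ∀ x, 0 ≤ φ (star x * x)) : PosForm A where
  form := LinearMap.mk₂'ₛₗ (RingHom.id ℂ) (starRingEnd ℂ) (fun x y => φ (star y * x))
    (fun x x' y => by rw [mul_add, map_add])
    (fun c x y => by rw [mul_smul_comm, map_smul]; rfl)
    (fun x y y' => by rw [star_add, add_mul, map_add])
    (fun c x y => by rw [star_smul, smul_mul_assoc, map_smul]; rfl)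
  nonneg := h

/-- A positive functional dominated by a vector functional of a representation is a vector
functional of that representation. -/
theorem exists_vector_of_le (ρ : A →⋆ₐ[ℂ] (𝓛 →L[ℂ] 𝓛)) (φ : A →ₗ[ℂ] ℂ) (Ξ : 𝓛)
    (h0 : ∀ x, 0 ≤ φ (star x * x)) (hle : ∀ x, (φ (star x * x)).re ≤ ‖ρ x Ξ‖ ^ 2) :
    ∃ Ξ' : 𝓛, ∀ x, φ x = inner ℂ Ξ' (ρ x Ξ') := by
  let v : A →ₗ[ℂ] ℂ := (innerSL ℂ Ξ : 𝓛 →ₗ[ℂ] ℂ) ∘ₗ repVec ρ Ξ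
  have hv : ∀ x y, v (star y * x) = inner ℂ (ρ y Ξ) (ρ x Ξ) := inner_repVec ρ Ξ
  have hv' : ∀ x, v (star x * x) = ((‖ρ x Ξ‖ ^ 2 : ℝ) : ℂ) := fun x => by
    rw [hv, inner_self_eq_norm_sq_to_K]; norm_cast
  let α := functionalForm φ h0
  let β := functionalForm (v - φ) fun x => by
    rw [LinearMap.sub_apply, hv']
    have h1 := Complex.nonneg_iff.1 (h0 x)
    refine Complex.nonneg_iff.2 ⟨?_, ?_⟩
    · rw [Complex.sub_re, Complex.ofReal_re]; exact sub_nonneg.2 (hle x)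
    · rw [Complex.sub_im, Complex.ofReal_im, ← h1.2, sub_zero]
  have hγ : ∀ x y, (α + β).form x y = inner ℂ (ρ y Ξ) (ρ x Ξ) := fun x y => by
    change φ (star y * x) + (v (star y * x) - φ (star y * x)) = _
    rw [hv]; ring
  have hn : ∀ x, ‖(α + β).h x‖ = ‖ρ x Ξ‖ := fun x => by
    have h := PosForm.norm_sq_h (α + β) x
    rw [hγ, inner_self_eq_norm_sq_to_K] at h
    norm_cast at h
    exact (sq_eq_sq₀ (norm_nonneg _) (norm_nonneg _)).1 h
  obtain ⟨W, hW⟩ := exists_clm_of_denseRange (α + β).hLin (repVec ρ Ξ)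
    (α + β).denseRange_h 1 (fun x => by rw [one_mul]; exact (hn x).ge)
  have hW1 : ∀ x, W ((α + β).h x) = ρ x Ξ := hW
  have hWi : ∀ u u', inner ℂ (W u) (W u') = inner ℂ u u' := fun u u' =>
    (α + β).denseRange_h.induction_on₂ (isClosed_eq (by fun_prop) (by fun_prop))
      (fun x y => by rw [hW1, hW1, PosForm.inner_h, hγ]) u u'
  -- `α + β` is the form of the vector functional at `Ξ`, so `C` is the Radon–Nikodym derivative of
  -- `φ`.
  set C := PosForm.reprOp α β with hC
  have hCs : IsSelfAdjoint C := PosForm.isSelfAdjoint_reprOp α β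
  have hD : cfc Real.sqrt C * cfc Real.sqrt C = C := by
    rw [← cfc_mul Real.sqrt Real.sqrt C]
    conv_rhs => rw [← cfc_id ℝ C]
    exact cfc_congr fun t ht => Real.mul_self_sqrt (PosForm.spectrum_reprOp α β ht).1
  set D := cfc Real.sqrt C with hDdef
  have hDs : IsSelfAdjoint D := IsSelfAdjoint.cfc
  -- The vector is the image of `C ^ (1/2) h(1)` under the isometry `W`.
  refine ⟨W (D ((α + β).h 1)), fun a => ?_⟩
  -- `U` is left multiplication by `a`. It commutes with `C`, hence with its square root `D`, which
  -- lets both copies of `D` meet.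
  obtain ⟨U, hU⟩ := exists_clm_of_denseRange (α + β).hLin
    ((α + β).hLin ∘ₗ LinearMap.mulLeft ℂ a) (α + β).denseRange_h ‖ρ a‖ (fun x => by
      change ‖(α + β).h (a * x)‖ ≤ _ * ‖(α + β).h x‖
      rw [hn, hn, map_mul]
      exact (ρ a).le_opNorm _)
  have hU1 : ∀ x, U ((α + β).h x) = (α + β).h (a * x) := hU
  have hUa : ∀ y u, inner ℂ ((α + β).h y) (U u) = inner ℂ ((α + β).h (star a * y)) u := by
    intro y u
    refine (α + β).denseRange_h.induction_on u (isClosed_eq (by fun_prop) (by fun_prop)) fun x => ?_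
    rw [hU1, PosForm.inner_h, PosForm.inner_h, hγ, hγ, map_mul, map_mul, map_star, mul_apply_eq_comp,
      mul_apply_eq_comp, ContinuousLinearMap.star_eq_adjoint,
      ContinuousLinearMap.adjoint_inner_left]
  have hCU : Commute C U := PosForm.clm_ext_h fun x => PosForm.ext_inner_h fun y => by
    change inner ℂ _ (C (U _)) = inner ℂ _ (U (C _))
    rw [hU1, hUa, hC, PosForm.repr_left, PosForm.repr_left]
    change φ (star y * (a * x)) = φ (star (star a * y) * x)
    rw [star_mul, star_star, mul_assoc]
  have hDU : Commute D U := hCs.commute_cfc hCU _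
  have hρW : ∀ u, ρ a (W u) = W (U u) := fun u => by
    refine (α + β).denseRange_h.induction_on u (isClosed_eq (by fun_prop) (by fun_prop)) fun x => ?_
    rw [hU1, hW1, hW1, map_mul]; rfl
  have h1 : U (D ((α + β).h 1)) = D (U ((α + β).h 1)) :=
    (congrArg (fun R : (α + β).Hilbert →L[ℂ] _ => R ((α + β).h 1)) hDU.eq).symm
  have h2 : D (D ((α + β).h a)) = C ((α + β).h a) :=
    congrArg (fun R : (α + β).Hilbert →L[ℂ] _ => R ((α + β).h a)) hD
  have h3 : inner ℂ (D ((α + β).h 1)) (D ((α + β).h a)) =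
      inner ℂ ((α + β).h 1) (D (D ((α + β).h a))) := hDs.isSymmetric _ _
  rw [hρW, hWi, h1, hU1, mul_one, h3, h2, hC, PosForm.repr_left]
  change φ a = φ (star 1 * a)
  rw [star_one, one_mul]

end Dominated

/-! ### Ultraweakly continuous functionals -/

section Ultraweak

variable {A H : Type*} [NormedAddCommGroup H] [InnerProductSpace ℂ H]

/-- `ω` is given by square summable sequences of vectors, by way of `ρ`. -/
def IsUW (ρ : A → H →L[ℂ] H) (ω : A → ℂ) : Prop :=
  ∃ Ξ Ξ' : Amp ℕ H, ∀ x, ω x = inner ℂ Ξ' (ampl ℕ (ρ x) Ξ)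

/-- The sequences `Ξ k` are concatenated into one along the bijection `ℕ × ℕ ≃ ℕ`; square
summability and the value of the sum are then statements about iterated sums. -/
theorem isUW_of_hasSum_family {ρ : A → H →L[ℂ] H} {ω : A → ℂ} (Ξ Ξ' : ℕ → Amp ℕ H)
    (hΞ : Summable fun k => ‖Ξ k‖ ^ 2) (hΞ' : Summable fun k => ‖Ξ' k‖ ^ 2)
    (h : ∀ x, HasSum (fun k => inner ℂ (Ξ' k) (ampl ℕ (ρ x) (Ξ k))) (ω x)) : IsUW ρ ω := by
  have hsum : ∀ Θ : ℕ → Amp ℕ H, (Summable fun k => ‖Θ k‖ ^ 2) →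
      Summable fun n => ‖Θ (Nat.pairEquiv.symm n).1 (Nat.pairEquiv.symm n).2‖ ^ 2 := by
    intro Θ hΘ
    rw [← Nat.pairEquiv.summable_iff]
    simp only [Function.comp_def, Equiv.symm_apply_apply]
    rw [summable_prod_of_nonneg (fun _ => by positivity)]
    exact ⟨fun k => summable_norm_sq_amp (Θ k), by
      simpa only [(hasSum_norm_sq_amp _).tsum_eq] using hΘ⟩
  refine ⟨⟨_, memℓp_of_summable_sq (hsum Ξ hΞ)⟩, ⟨_, memℓp_of_summable_sq (hsum Ξ' hΞ')⟩,
    fun x => ?_⟩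
  have h1 := lp.hasSum_inner (𝕜 := ℂ) (G := fun _ : ℕ => H)
    (⟨_, memℓp_of_summable_sq (hsum Ξ' hΞ')⟩ : Amp ℕ H)
    (ampl ℕ (ρ x) ⟨_, memℓp_of_summable_sq (hsum Ξ hΞ)⟩)
  rw [← Nat.pairEquiv.hasSum_iff] at h1
  refine (h x).unique (h1.prod_fiberwise fun k => ?_)
  have h2 := lp.hasSum_inner (𝕜 := ℂ) (Ξ' k) (ampl ℕ (ρ x) (Ξ k))
  convert h2 using 2 with n
  change inner ℂ (Ξ' (Nat.pairEquiv.symm (Nat.pairEquiv (k, n))).1 _) (ρ x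
    (Ξ (Nat.pairEquiv.symm (Nat.pairEquiv (k, n))).1
      (Nat.pairEquiv.symm (Nat.pairEquiv (k, n))).2)) = _
  rw [Equiv.symm_apply_apply]
  rfl

theorem IsUW.zero {ρ : A → H →L[ℂ] H} : IsUW ρ fun _ => 0 :=
  ⟨0, 0, fun x => by rw [inner_zero_left]⟩

theorem IsUW.smul {ρ : A → H →L[ℂ] H} {ω : A → ℂ} (h : IsUW ρ ω) (c : ℂ) :
    IsUW ρ fun x => c * ω x := by
  obtain ⟨Ξ, Ξ', h⟩ := h
  exact ⟨c • Ξ, Ξ', fun x => by rw [map_smul, inner_smul_right, ← h]⟩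

theorem IsUW.add {ρ : A → H →L[ℂ] H} {ω ω' : A → ℂ} (h : IsUW ρ ω) (h' : IsUW ρ ω') :
    IsUW ρ fun x => ω x + ω' x := by
  obtain ⟨Ξ₁, Ξ₁', h⟩ := h
  obtain ⟨Ξ₂, Ξ₂', h'⟩ := h'
  have hz : ∀ (Θ Θ' : Amp ℕ H) k, k ∉ Finset.range 2 →
      (if k = 0 then Θ else if k = 1 then Θ' else 0) = 0 := fun Θ Θ' k hk => by
    rw [Finset.mem_range] at hk
    rw [if_neg (by omega), if_neg (by omega)]
  have hs : ∀ Θ Θ' : Amp ℕ H,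
      Summable fun k : ℕ => ‖if k = 0 then Θ else if k = 1 then Θ' else 0‖ ^ 2 := fun Θ Θ' =>
    summable_of_ne_finset_zero (s := Finset.range 2) (L := .unconditional ℕ)
      fun k hk => by simp [hz _ _ k hk]
  refine isUW_of_hasSum_family (fun k => if k = 0 then Ξ₁ else if k = 1 then Ξ₂ else 0)
    (fun k => if k = 0 then Ξ₁' else if k = 1 then Ξ₂' else 0)
    (hs _ _) (hs _ _) fun x => ?_
  have := hasSum_sum_of_ne_finset_zero (s := Finset.range 2) (L := .unconditional ℕ)
    (f := fun k => inner ℂ (if k = 0 then Ξ₁' else if k = 1 then Ξ₂' else 0)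
      (ampl ℕ (ρ x) (if k = 0 then Ξ₁ else if k = 1 then Ξ₂ else 0)))
    (fun k hk => by rw [hz _ _ k hk, inner_zero_left])
  rwa [Finset.sum_range_succ, Finset.sum_range_one, if_pos rfl, if_pos rfl,
    if_neg (by norm_num), if_pos rfl, if_neg (by norm_num), if_pos rfl, ← h, ← h'] at this

theorem isUW_vector (ρ : A → H →L[ℂ] H) (ξ η : H) : IsUW ρ fun x => inner ℂ η (ρ x ξ) :=
  ⟨lp.single 2 0 ξ, lp.single 2 0 η, fun x => by
    rw [ampl_single, lp.inner_single_left, lp.single_apply_self]⟩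

theorem isUltraweak_iff [CompleteSpace H] {M : VonNeumannAlgebra H} {ω : Elem M → ℂ} :
    IsUltraweak M ω ↔ IsUW (fun x : Elem M => x.val) ω := by
  constructor
  · rintro ⟨ξ, η, hξ, hη, h⟩
    refine ⟨⟨ξ, memℓp_of_summable_sq hξ⟩, ⟨η, memℓp_of_summable_sq hη⟩, fun x => ?_⟩
    exact (h x).unique (lp.hasSum_inner _ _)
  · rintro ⟨Ξ, Ξ', h⟩
    exact ⟨Ξ, Ξ', summable_norm_sq_amp Ξ, summable_norm_sq_amp Ξ', fun x => by
      rw [h]; exact lp.hasSum_inner _ _⟩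

variable [Ring A] [StarRing A] [Algebra ℂ A] [StarModule ℂ A] [CompleteSpace H]

/-- A positive functional that is dominated by an ultraweakly continuous functional is a vector
functional of the amplification. -/
theorem exists_vector_of_le_isUW (ρ : A →⋆ₐ[ℂ] (H →L[ℂ] H)) (φ : A →ₗ[ℂ] ℂ) {ω : A → ℂ}
    (hω : IsUW ρ ω) (h0 : ∀ x, 0 ≤ φ (star x * x))
    (hle : ∀ x, (φ (star x * x)).re ≤ (ω (star x * x)).re) :
    ∃ Ξ : Amp ℕ H, ∀ x, φ x = inner ℂ Ξ (ampl ℕ (ρ x) Ξ) := by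
  obtain ⟨Ξ, Ξ', h⟩ := hω
  -- The half-sum comes from polarization: `re ⟪b, a⟫ ≤ ‖(a + b) / 2‖ ^ 2`. It replaces two
  -- different vectors by one.
  refine exists_vector_of_le ((amplHom ℕ H).comp ρ) φ ((2⁻¹ : ℝ) • (Ξ + Ξ')) h0 fun x => ?_
  refine (hle x).trans ?_
  rw [h]
  have h1 : inner ℂ Ξ' (ampl ℕ (ρ (star x * x)) Ξ) =
      inner ℂ (ampl ℕ (ρ x) Ξ') (ampl ℕ (ρ x) Ξ) := by
    rw [map_mul, map_star]
    exact inner_ampl (ρ x) (ampl ℕ (ρ x) Ξ) Ξ'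
  rw [h1]
  change _ ≤ ‖ampl ℕ (ρ x) _‖ ^ 2
  rw [ContinuousLinearMap.map_smul_of_tower, norm_smul, mul_pow, map_add]
  set a := ampl ℕ (ρ x) Ξ
  set b := ampl ℕ (ρ x) Ξ'
  have h2 := parallelogram_law_with_norm ℂ a b
  have h3 := norm_add_sq (𝕜 := ℂ) b a
  have h4 : RCLike.re (inner ℂ b a) = (inner ℂ b a).re := rfl
  have h5 := norm_sub_sq (𝕜 := ℂ) b a
  rw [add_comm a b, Real.norm_eq_abs, sq_abs]
  nlinarith [sq_nonneg ‖b - a‖]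

end Ultraweak

/-! ### Normal completely positive maps -/

section Normal

open ContinuousLinearMap (adjoint)
open Filter Topology

variable {A : Type*} [CStarAlgebra A] [PartialOrder A] [StarOrderedRing A]
variable {H K : Type*} [NormedAddCommGroup H] [InnerProductSpace ℂ H] [CompleteSpace H]
  [NormedAddCommGroup K] [InnerProductSpace ℂ K] [CompleteSpace K]
variable {N : VonNeumannAlgebra K}

/-- The functional `x ↦ ⟨ζ, Φ(x) ζ⟩`. -/
def vectorFunctional (Φ : A →CP Elem N) (ζ : K) : A →ₗ[ℂ] ℂ where
  toFun x := inner ℂ ζ (op Φ x ζ)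
  map_add' x y := by rw [op_add, add_apply, inner_add_right]
  map_smul' c x := by rw [op_smul, smul_apply, inner_smul_right]; rfl

theorem vectorFunctional_apply (Φ : A →CP Elem N) (ζ : K) (x : A) :
    vectorFunctional Φ ζ x = inner ℂ ζ (op Φ x ζ) := rfl

theorem vectorFunctional_star_mul (Φ : A →CP Elem N) (ζ : K) (x : A) :
    vectorFunctional Φ ζ (star x * x) = ((‖stine Φ x ζ‖ ^ 2 : ℝ) : ℂ) := by
  rw [vectorFunctional_apply, ← inner_stine, inner_self_eq_norm_sq_to_K]
  norm_cast

/-- All the functionals `x ↦ ⟨ζ, Φ(x) ζ⟩` are vector functionals of the amplification of `ρ`. -/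
def IsUWMap (ρ : A →⋆ₐ[ℂ] (H →L[ℂ] H)) (Φ : A →CP Elem N) : Prop :=
  ∀ ζ : K, ∃ Ξ : Amp ℕ H, ∀ x, inner ℂ ζ (op Φ x ζ) = inner ℂ Ξ (ampl ℕ (ρ x) Ξ)

variable {ρ : A →⋆ₐ[ℂ] (H →L[ℂ] H)}

theorem isUWMap_of_le {Φ : A →CP Elem N}
    (h : ∀ ζ, ∃ ω, IsUW ρ ω ∧ ∀ x, ‖stine Φ x ζ‖ ^ 2 ≤ (ω (star x * x)).re) : IsUWMap ρ Φ := by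
  intro ζ
  obtain ⟨ω, hω, hle⟩ := h ζ
  refine exists_vector_of_le_isUW ρ (vectorFunctional Φ ζ) hω (fun x => ?_) fun x => ?_
  · rw [vectorFunctional_star_mul]
    exact Complex.zero_le_real.2 (by positivity)
  · rw [vectorFunctional_star_mul, Complex.ofReal_re]
    exact hle x

theorem inner_stine_eq_of_vector {Φ : A →CP Elem N} {ζ : K} {Ξ : Amp ℕ H}
    (h : ∀ x, inner ℂ ζ (op Φ x ζ) = inner ℂ Ξ (ampl ℕ (ρ x) Ξ)) (w x : A) :
    inner ℂ (stine Φ w ζ) (stine Φ x ζ) = inner ℂ (ampl ℕ (ρ w) Ξ) (ampl ℕ (ρ x) Ξ) := by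
  rw [inner_stine, h, map_mul, map_star, ← inner_ampl]
  rfl

theorem norm_stine_eq_of_vector {Φ : A →CP Elem N} {ζ : K} {Ξ : Amp ℕ H}
    (h : ∀ x, inner ℂ ζ (op Φ x ζ) = inner ℂ Ξ (ampl ℕ (ρ x) Ξ)) (x : A) :
    ‖stine Φ x ζ‖ = ‖ampl ℕ (ρ x) Ξ‖ := by
  have h1 := inner_stine_eq_of_vector h x x
  rw [inner_self_eq_norm_sq_to_K, inner_self_eq_norm_sq_to_K] at h1
  norm_cast at h1
  exact (sq_eq_sq₀ (norm_nonneg _) (norm_nonneg _)).1 h1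

theorem norm_vector_eq {Φ : A →CP Elem N} {ζ : K} {Ξ : Amp ℕ H}
    (h : ∀ x, inner ℂ ζ (op Φ x ζ) = inner ℂ Ξ (ampl ℕ (ρ x) Ξ)) : ‖Ξ‖ = ‖stine Φ 1 ζ‖ := by
  rw [norm_stine_eq_of_vector h, map_one]
  rfl

/-- Square summable sequences of vectors give ultraweakly continuous functionals. -/
theorem IsUWMap.isUW_of_hasSum {Φ : A →CP Elem N} (hΦ : IsUWMap ρ Φ) {ζ : ℕ → K}
    (hζ : Summable fun k => ‖ζ k‖ ^ 2) {ω : A → ℂ}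
    (h : ∀ x, HasSum (fun k => inner ℂ (ζ k) (op Φ x (ζ k))) (ω x)) : IsUW ρ ω := by
  choose Ξ hΞ using fun k => hΦ (ζ k)
  have hs : Summable fun k => ‖Ξ k‖ ^ 2 := by
    refine Summable.of_nonneg_of_le (fun _ => by positivity) (fun k => ?_)
      (hζ.mul_left (‖stine Φ 1‖ ^ 2))
    rw [norm_vector_eq (hΞ k), ← mul_pow]
    exact pow_le_pow_left₀ (norm_nonneg _) ((stine Φ 1).le_opNorm _) 2
  refine isUW_of_hasSum_family Ξ Ξ hs hs fun x => ?_
  simpa only [hΞ] using h x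

theorem IsUWMap.isUW_ampl {Φ : A →CP Elem N} (hΦ : IsUWMap ρ Φ) (Z : Amp ℕ K) :
    IsUW ρ fun x => inner ℂ Z (ampl ℕ (op Φ x) Z) :=
  hΦ.isUW_of_hasSum (summable_norm_sq_amp Z) fun x => hasSum_inner_ampl (op Φ x) Z Z

theorem inner_polarization {E : Type*} [NormedAddCommGroup E] [InnerProductSpace ℂ E]
    (T : E →L[ℂ] E) (x y : E) : inner ℂ y (T x) = 4⁻¹ * inner ℂ (x + y) (T (x + y)) +
      (-4⁻¹ * inner ℂ (x - y) (T (x - y)) +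
      (4⁻¹ * Complex.I * inner ℂ (x + Complex.I • y) (T (x + Complex.I • y)) +
        -4⁻¹ * Complex.I * inner ℂ (x - Complex.I • y) (T (x - Complex.I • y)))) := by
  simp only [map_add, map_sub, map_smul, inner_add_left, inner_add_right, inner_sub_left,
    inner_sub_right, inner_smul_left, inner_smul_right, Complex.conj_I]
  ring_nf
  simp only [Complex.I_sq]
  ring

/-- Polarization reduces a general ultraweakly continuous functional to diagonal ones, for which
`IsUWMap` supplies vectors. -/
theorem IsUWMap.comp {Φ : A →CP Elem N} (hΦ : IsUWMap ρ Φ) {ω : Elem N → ℂ}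
    (hω : IsUW (fun y : Elem N => y.val) ω) : IsUW ρ fun x => ω (Φ x) := by
  obtain ⟨Z, Z', h⟩ := hω
  have h1 : (fun x => ω (Φ x)) = fun x => inner ℂ Z' (ampl ℕ (op Φ x) Z) := funext fun x => h _
  rw [h1]
  simp only [inner_polarization (ampl ℕ (op Φ _)) Z Z']
  exact ((hΦ.isUW_ampl _).smul _).add (((hΦ.isUW_ampl _).smul _).add
    (((hΦ.isUW_ampl _).smul _).add ((hΦ.isUW_ampl _).smul _)))

theorem IsUWMap.isUW {Φ : A →CP Elem N} (hΦ : IsUWMap ρ Φ) (ξ η : K) :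
    IsUW ρ fun x => inner ℂ η (op Φ x ξ) :=
  hΦ.comp (isUW_vector (fun y : Elem N => y.val) ξ η)

/-- If `Φ` is normal, each `⟨ζ, Φ(x) ζ⟩` is positive and ultraweakly continuous; being dominated by
itself, it is given by a single vector. The converse is `IsUWMap.comp`. -/
theorem isNormal_iff {M : VonNeumannAlgebra H} {Φ : Elem M →CP Elem N} :
    IsNormal Φ ↔ IsUWMap OpAlg.val Φ := by
  constructor
  · intro h
    refine isUWMap_of_le fun ζ => ⟨fun x => inner ℂ ζ (op Φ x ζ), ?_, fun x => ?_⟩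
    · exact isUltraweak_iff.1 (h _ (isUltraweak_iff.2 (isUW_vector _ ζ ζ)))
    · exact ((congrArg Complex.re (vectorFunctional_star_mul Φ ζ x)).trans
        (Complex.ofReal_re _)).ge
  · intro h ω hω
    exact isUltraweak_iff.2 (h.comp (isUltraweak_iff.1 hω))

theorem norm_sq_h_add_tmul (Φ Ψ : A →CP Elem N) (x : A) (ζ : K) :
    ‖(cpForm Φ + cpForm Ψ).h (x ⊗ₜ ζ)‖ ^ 2 = ‖stine Φ x ζ‖ ^ 2 + ‖stine Ψ x ζ‖ ^ 2 := by
  rw [stine_apply, stine_apply, PosForm.norm_sq_h, PosForm.norm_sq_h, PosForm.norm_sq_h,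
    PosForm.add_form, Complex.add_re]

/-- `powerFun α` is at most `1` on `[0, 1]`, so the form of the mean is dominated by the sum of the
two forms. -/
theorem norm_stine_powerMean_le {α : ℝ} (hα : α ∈ Set.Icc (0 : ℝ) 1) (Φ Ψ : A →CP Elem N) (x : A)
    (ζ : K) : ‖stine (powerMean α Φ Ψ) x ζ‖ ^ 2 ≤ ‖stine Φ x ζ‖ ^ 2 + ‖stine Ψ x ζ‖ ^ 2 := by
  rw [← norm_sq_h_add_tmul, stine_apply, PosForm.norm_sq_h, cpForm_powerMean Φ Ψ hα]
  set v := (cpForm Φ + cpForm Ψ).h (x ⊗ₜ ζ)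
  set C := PosForm.reprOp (cpForm Φ) (cpForm Ψ)
  have h2 : ‖cfc (powerFun α) C‖ ≤ 1 := norm_cfc_le zero_le_one fun t ht => by
    have ht' := PosForm.spectrum_reprOp _ _ ht
    rw [Real.norm_of_nonneg (powerFun_nonneg ht')]
    exact powerFun_le_one hα ht'
  refine (Complex.re_le_norm _).trans ((norm_inner_le_norm _ _).trans ?_)
  have h3 := (cfc (powerFun α) C).le_of_opNorm_le h2 v
  rw [one_mul] at h3
  exact (mul_le_mul_of_nonneg_left h3 (norm_nonneg v)).trans_eq (sq ‖v‖).symm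

theorem IsUWMap.powerMean {α : ℝ} (hα : α ∈ Set.Icc (0 : ℝ) 1) {Φ Ψ : A →CP Elem N}
    (hΦ : IsUWMap ρ Φ) (hΨ : IsUWMap ρ Ψ) : IsUWMap ρ (powerMean α Φ Ψ) :=
  isUWMap_of_le fun ζ => ⟨_, (hΦ.isUW ζ ζ).add (hΨ.isUW ζ ζ), fun x => by
    refine (norm_stine_powerMean_le hα Φ Ψ x ζ).trans_eq ?_
    rw [← vectorFunctional_apply, ← vectorFunctional_apply, vectorFunctional_star_mul,
      vectorFunctional_star_mul, Complex.add_re, Complex.ofReal_re, Complex.ofReal_re]⟩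

end Normal

/-! ### Normal extensions -/

section Extension

open ContinuousLinearMap (adjoint)
open Filter Topology

variable {H K : Type*} [NormedAddCommGroup H] [InnerProductSpace ℂ H] [CompleteSpace H]
  [NormedAddCommGroup K] [InnerProductSpace ℂ K] [CompleteSpace K]
variable {N : VonNeumannAlgebra K} {S : StarSubalgebra ℂ (H →L[ℂ] H)}
  [IsClosed (S : Set (H →L[ℂ] H))]

/-- An element of a concrete algebra, given by an operator. -/
def OpAlg.mk {S : StarSubalgebra ℂ (H →L[ℂ] H)} (x : H →L[ℂ] H) (hx : x ∈ S) : OpAlg S := ⟨x, hx⟩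

/-- Ultrastrong convergence of elements of `S`. -/
def UltrastrongTo (l : Filter (OpAlg S)) (x : H →L[ℂ] H) : Prop :=
  ∀ Ξ : Amp ℕ H, Tendsto (fun z : OpAlg S => ampl ℕ z.val Ξ) l (𝓝 (ampl ℕ x Ξ))

theorem exists_ultrastrongTo {x : H →L[ℂ] H}
    (hx : ∀ T : H →L[ℂ] H, (∀ s ∈ S, Commute s T) → Commute x T) :
    ∃ l : Filter (OpAlg S), l.NeBot ∧ UltrastrongTo l x := exists_ultrastrongLim S hx

theorem ultrastrongTo_pure (x : OpAlg S) : UltrastrongTo (pure x) x.val :=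
  fun _ => tendsto_pure_nhds _ _

theorem UltrastrongTo.add {l l' : Filter (OpAlg S)} {x y : H →L[ℂ] H} (hx : UltrastrongTo l x)
    (hy : UltrastrongTo l' y) :
    UltrastrongTo ((l ×ˢ l').map fun p => p.1 + p.2) (x + y) := fun Ξ => by
  rw [tendsto_map'_iff]
  exact ((hx Ξ).comp tendsto_fst).add ((hy Ξ).comp tendsto_snd)

theorem UltrastrongTo.smul {l : Filter (OpAlg S)} {x : H →L[ℂ] H} (hx : UltrastrongTo l x)
    (c : ℂ) : UltrastrongTo (l.map fun z => c • z) (c • x) := fun Ξ => by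
  rw [tendsto_map'_iff]
  exact (hx Ξ).const_smul c

variable {Φ : OpAlg S →CP Elem N}

theorem dist_stine_eq {ζ : K} {Ξ : Amp ℕ H}
    (h : ∀ x : OpAlg S, inner ℂ ζ (op Φ x ζ) = inner ℂ Ξ (ampl ℕ x.val Ξ)) (z w : OpAlg S) :
    dist (stine Φ z ζ) (stine Φ w ζ) = dist (ampl ℕ z.val Ξ) (ampl ℕ w.val Ξ) := by
  have h1 := norm_stine_eq_of_vector (ρ := OpAlg.val) h (z - w)
  rw [map_sub, sub_apply] at h1
  rw [dist_eq_norm, h1, dist_eq_norm]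
  rfl

/-- The Stinespring family converges along ultrastrongly convergent filters, to a limit which
depends only on the limit of the filter. -/
theorem exists_tendsto_stine (hΦ : IsUWMap OpAlg.val Φ) {x : H →L[ℂ] H}
    (hx : ∃ l : Filter (OpAlg S), l.NeBot ∧ UltrastrongTo l x) (ζ : K) :
    ∃ v, ∀ l : Filter (OpAlg S), UltrastrongTo l x →
      Tendsto (fun z => stine Φ z ζ) l (𝓝 v) := by
  obtain ⟨Ξ, hΞ⟩ := hΦ ζ
  -- Allowing two different filters gives both facts at once: `l = l'` yields the Cauchy property,
  -- `l ≠ l'` the independence of the limit.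
  have hd : ∀ l l' : Filter (OpAlg S), UltrastrongTo l x → UltrastrongTo l' x →
      Tendsto (fun p : OpAlg S × OpAlg S => dist (stine Φ p.1 ζ) (stine Φ p.2 ζ)) (l ×ˢ l')
        (𝓝 0) := fun l l' hl hl' => by
    simp only [dist_stine_eq hΞ]
    rw [← dist_self (ampl ℕ x Ξ)]
    exact ((hl Ξ).comp tendsto_fst).dist ((hl' Ξ).comp tendsto_snd)
  obtain ⟨l, hlb, hl⟩ := hx
  have hc : Cauchy (l.map fun z => stine Φ z ζ) := by
    rw [cauchy_map_iff, uniformity_eq_comap_nhds_zero, tendsto_comap_iff]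
    refine ⟨hlb, ?_⟩
    rw [tendsto_zero_iff_norm_tendsto_zero]
    simpa [Function.comp_def, dist_eq_norm, norm_sub_rev] using hd l l hl hl
  obtain ⟨v, hv⟩ := cauchy_iff_exists_le_nhds.1 hc
  refine ⟨v, fun l' hl' => ?_⟩
  have h1 : Tendsto (fun p : OpAlg S × OpAlg S => stine Φ p.2 ζ) (l ×ˢ l') (𝓝 v) := by
    have h0 : Tendsto (fun z => stine Φ z ζ) l (𝓝 v) := hv
    exact (tendsto_iff_of_dist (hd l l' hl hl')).1 (h0.comp tendsto_fst)
  have h2 : (l ×ˢ l').map Prod.snd = l' := map_snd_prod l l'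
  rw [← h2]
  exact h1

variable {M : VonNeumannAlgebra H}

/-- The continuous extension of the Stinespring family. -/
theorem exists_stine_extension (hΦ : IsUWMap OpAlg.val Φ)
    (hM : ∀ x : Elem M, ∃ l : Filter (OpAlg S), l.NeBot ∧ UltrastrongTo l x.val) :
    ∃ V : Elem M →ₗ[ℂ] K →L[ℂ] (cpForm Φ).Hilbert, ∀ x ζ (l : Filter (OpAlg S)),
      UltrastrongTo l x.val → Tendsto (fun z => stine Φ z ζ) l (𝓝 (V x ζ)) := by
  choose v hv using fun (x : Elem M) ζ => exists_tendsto_stine hΦ (hM x) ζ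
  have hadd : ∀ x ζ ζ', v x (ζ + ζ') = v x ζ + v x ζ' := fun x ζ ζ' => by
    obtain ⟨l, hl, hlx⟩ := hM x
    refine tendsto_nhds_unique (hv x _ l hlx) ?_
    simpa only [map_add] using (hv x ζ l hlx).add (hv x ζ' l hlx)
  have hsmul : ∀ x (c : ℂ) ζ, v x (c • ζ) = c • v x ζ := fun x c ζ => by
    obtain ⟨l, hl, hlx⟩ := hM x
    refine tendsto_nhds_unique (hv x _ l hlx) ?_
    simpa only [map_smul] using (hv x ζ l hlx).const_smul c
  have hbound : ∀ x ζ, ‖v x ζ‖ ≤ ‖x.val‖ * ‖stine Φ 1‖ * ‖ζ‖ := fun x ζ => by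
    obtain ⟨l, hl, hlx⟩ := hM x
    obtain ⟨Ξ, hΞ⟩ := hΦ ζ
    have h1 : Tendsto (fun z => ‖stine Φ z ζ‖) l (𝓝 ‖ampl ℕ x.val Ξ‖) := by
      simp only [norm_stine_eq_of_vector hΞ]
      exact (hlx Ξ).norm
    rw [tendsto_nhds_unique (hv x ζ l hlx).norm h1, mul_assoc]
    refine (norm_ampl_le _ _).trans (mul_le_mul_of_nonneg_left ?_ (norm_nonneg _))
    rw [norm_vector_eq hΞ]
    exact (stine Φ 1).le_opNorm ζ
  refine ⟨⟨⟨fun x => LinearMap.mkContinuous ⟨⟨v x, hadd x⟩, hsmul x⟩ _ (hbound x), fun x y => ?_⟩,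
    fun c x => ?_⟩, hv⟩
  · ext ζ
    change v (x + y) ζ = v x ζ + v y ζ
    obtain ⟨l, hl, hlx⟩ := hM x
    obtain ⟨l', hl', hly⟩ := hM y
    -- Additivity rests on the independence of the filter: the sums along `l ×ˢ l'` form one
    -- admissible filter for `x + y`.
    have h1 := hv (x + y) ζ _ (by rw [map_add]; exact hlx.add hly)
    rw [tendsto_map'_iff] at h1
    refine tendsto_nhds_unique h1 ?_
    simpa only [Function.comp_def, map_add, add_apply] using
      ((hv x ζ l hlx).comp tendsto_fst).add ((hv y ζ l' hly).comp tendsto_snd)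
  · ext ζ
    change v (c • x) ζ = c • v x ζ
    obtain ⟨l, hl, hlx⟩ := hM x
    have h1 := hv (c • x) ζ _ (by rw [map_smul]; exact hlx.smul c)
    rw [tendsto_map'_iff] at h1
    refine tendsto_nhds_unique h1 ?_
    simpa only [Function.comp_def, map_smul, smul_apply] using (hv x ζ l hlx).const_smul c

/-- A completely positive map whose vector functionals are ultraweakly continuous extends to a
normal completely positive map on the ultrastrong closure. -/
theorem exists_isUWMap_extension (hΦ : IsUWMap OpAlg.val Φ)
    (hSM : ∀ z : OpAlg S, z.val ∈ M.toStarSubalgebra)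
    (hM : ∀ x : Elem M, ∃ l : Filter (OpAlg S), l.NeBot ∧ UltrastrongTo l x.val) :
    ∃ Φ' : Elem M →CP Elem N, IsUWMap OpAlg.val Φ' ∧ ∀ z, op Φ' (OpAlg.mk z.val (hSM z)) = op Φ z := by
  obtain ⟨V, hV⟩ := exists_stine_extension hΦ hM
  have hVS : ∀ z : OpAlg S, V (OpAlg.mk z.val (hSM z)) = stine Φ z := fun z => by
    ext ζ
    exact tendsto_nhds_unique (hV (OpAlg.mk z.val (hSM z)) ζ _ (ultrastrongTo_pure z)) (tendsto_pure_nhds _ _)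
  have hV1 : V 1 = stine Φ 1 := hVS 1
  have hin : ∀ ζ (Ξ : Amp ℕ H),
      (∀ z : OpAlg S, inner ℂ ζ (op Φ z ζ) = inner ℂ Ξ (ampl ℕ z.val Ξ)) → ∀ w x : Elem M,
      inner ℂ (V w ζ) (V x ζ) = inner ℂ (ampl ℕ w.val Ξ) (ampl ℕ x.val Ξ) := by
    intro ζ Ξ hΞ w x
    obtain ⟨l, hl, hlw⟩ := hM w
    obtain ⟨l', hl', hlx⟩ := hM x
    have h1 := ((hV w ζ l hlw).comp (tendsto_fst (g := l'))).inner (𝕜 := ℂ)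
      ((hV x ζ l' hlx).comp (tendsto_snd (f := l)))
    have h2 := ((hlw Ξ).comp (tendsto_fst (g := l'))).inner (𝕜 := ℂ)
      ((hlx Ξ).comp (tendsto_snd (f := l)))
    refine tendsto_nhds_unique h1 (h2.congr fun p => ?_)
    exact (inner_stine_eq_of_vector (ρ := OpAlg.val) hΞ p.1 p.2).symm
  -- Over `ℂ` an operator is determined by its quadratic form, so one `ζ` at a time suffices, with
  -- the vector `Ξ` that belongs to it.
  have hdil : ∀ w x, adjoint (V w) ∘L V x = adjoint (V 1) ∘L V (star w * x) := by
    intro w x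
    have h1 : ∀ T : K →L[ℂ] K, ∀ ζ, inner ℂ ((T : K →ₗ[ℂ] K) ζ) ζ = inner ℂ (T ζ) ζ :=
      fun _ _ => rfl
    refine ContinuousLinearMap.coe_injective ((ext_inner_map _ _).1 fun ζ => ?_)
    rw [h1, h1, ContinuousLinearMap.comp_apply, ContinuousLinearMap.comp_apply,
      ContinuousLinearMap.adjoint_inner_left, ContinuousLinearMap.adjoint_inner_left]
    obtain ⟨Ξ, hΞ⟩ := hΦ ζ
    rw [hin ζ Ξ hΞ, hin ζ Ξ hΞ, map_mul, map_star]
    have h2 := inner_ampl (star w.val) (ampl ℕ x.val Ξ) Ξ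
    rw [star_star] at h2
    rw [← inner_conj_symm, ← inner_conj_symm (ampl ℕ (star w.val * x.val) Ξ)]
    refine congrArg _ ?_
    rw [← inner_ampl]
    rfl
  have hN : ∀ x, adjoint (V 1) ∘L V x ∈ N.toStarSubalgebra := by
    intro x
    refine mem_of_commute_unitary fun u _ huN => ?_
    obtain ⟨l, hl, hlx⟩ := hM x
    have hlim : ∀ η ζ, Tendsto (fun z => inner ℂ η (op Φ z ζ)) l
        (𝓝 (inner ℂ η ((adjoint (V 1) ∘L V x) ζ))) := fun η ζ => by
      rw [ContinuousLinearMap.comp_apply, ContinuousLinearMap.adjoint_inner_right, hV1]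
      refine ((tendsto_const_nhds (x := stine Φ 1 η)).inner (hV x ζ l hlx)).congr fun z => ?_
      rw [inner_stine, star_one, one_mul]
    ext ζ
    refine ext_inner_left ℂ fun η => ?_
    change inner ℂ η (u ((adjoint (V 1) ∘L V x) ζ)) = inner ℂ η ((adjoint (V 1) ∘L V x) (u ζ))
    rw [← ContinuousLinearMap.adjoint_inner_left]
    refine tendsto_nhds_unique (hlim _ _) ((hlim η (u ζ)).congr fun z => ?_)
    rw [ContinuousLinearMap.adjoint_inner_left]
    have := VonNeumannAlgebra.mem_commutant_iff.1 huN (op Φ z) (Φ z).2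
    exact congrArg (fun T : K →L[ℂ] K => inner ℂ η (T ζ)) this
  refine ⟨cpOfDilation V hdil hN, fun ζ => ?_, fun z => ?_⟩
  · obtain ⟨Ξ, hΞ⟩ := hΦ ζ
    refine ⟨Ξ, fun x => ?_⟩
    rw [op_cpOfDilation, ContinuousLinearMap.comp_apply, ContinuousLinearMap.adjoint_inner_right,
      hin ζ Ξ hΞ, map_one]
    rfl
  · rw [op_cpOfDilation, hVS, hV1, adjoint_stine_comp, star_one, one_mul]

/-- Normal maps are determined by their values on an ultrastrongly dense subalgebra. -/
theorem eq_of_isUWMap {Φ Φ' : Elem M →CP Elem N} (hΦ : IsUWMap OpAlg.val Φ)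
    (hΦ' : IsUWMap OpAlg.val Φ') (hSM : ∀ z : OpAlg S, z.val ∈ M.toStarSubalgebra)
    (hM : ∀ x : Elem M, ∃ l : Filter (OpAlg S), l.NeBot ∧ UltrastrongTo l x.val)
    (h : ∀ z : OpAlg S, op Φ (OpAlg.mk z.val (hSM z)) = op Φ' (OpAlg.mk z.val (hSM z))) : Φ = Φ' := by
  refine op_ext fun x => ContinuousLinearMap.coe_injective ((ext_inner_map _ _).1 fun ζ => ?_)
  change inner ℂ (op Φ x ζ) ζ = inner ℂ (op Φ' x ζ) ζ
  obtain ⟨Ξ, hΞ⟩ := hΦ ζ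
  obtain ⟨Ξ', hΞ'⟩ := hΦ' ζ
  obtain ⟨l, hl, hlx⟩ := hM x
  rw [← inner_conj_symm, ← inner_conj_symm (op Φ' x ζ), hΞ, hΞ']
  refine congrArg _ (tendsto_nhds_unique ((tendsto_const_nhds (x := Ξ)).inner (hlx Ξ))
    (((tendsto_const_nhds (x := Ξ')).inner (hlx Ξ')).congr fun z => ?_))
  have h1 := hΞ (OpAlg.mk z.val (hSM z))
  rw [h, hΞ'] at h1
  exact h1

end Extension

/-! ### Checking the vector functionals on a dense set of vectors -/

section NormalDense

open Filter Topology

variable {A : Type*} [CStarAlgebra A] [PartialOrder A] [StarOrderedRing A]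
variable {H K : Type*} [NormedAddCommGroup H] [InnerProductSpace ℂ H] [CompleteSpace H]
  [NormedAddCommGroup K] [InnerProductSpace ℂ K] [CompleteSpace K]
variable {N : VonNeumannAlgebra K} {ρ : A →⋆ₐ[ℂ] (H →L[ℂ] H)}

/-- Iterate `‖u + v‖ ^ 2 ≤ 2 * ‖u‖ ^ 2 + 2 * ‖v‖ ^ 2`, splitting off the first term each time; this
produces the weights `2 ^ (k + 1)`. -/
theorem norm_sum_range_sq_le {E : Type*} [SeminormedAddCommGroup E] [InnerProductSpace ℂ E] (n : ℕ)
    (v : ℕ → E) : ‖∑ k ∈ Finset.range n, v k‖ ^ 2 ≤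
      ∑ k ∈ Finset.range n, 2 ^ (k + 1) * ‖v k‖ ^ 2 := by
  induction n generalizing v with
  | zero => simp
  | succ n ih =>
    rw [Finset.sum_range_succ', Finset.sum_range_succ']
    have h1 := ih fun k => v (k + 1)
    have h2 := parallelogram_law_with_norm ℂ (∑ k ∈ Finset.range n, v (k + 1)) (v 0)
    have h3 : ∑ k ∈ Finset.range n, (2 : ℝ) ^ (k + 1 + 1) * ‖v (k + 1)‖ ^ 2 =
        2 * ∑ k ∈ Finset.range n, (2 : ℝ) ^ (k + 1) * ‖v (k + 1)‖ ^ 2 := by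
      rw [Finset.mul_sum]
      exact Finset.sum_congr rfl fun k _ => by ring
    rw [h3]
    have h4 := mul_self_nonneg ‖∑ k ∈ Finset.range n, v (k + 1) - v 0‖
    simp only [zero_add, pow_one, sq] at *
    linarith

/-- The vector functionals of a completely positive map need only be checked on a dense
subgroup. -/
theorem isUWMap_of_dense {Φ : A →CP Elem N} (D : AddSubgroup K) (hD : Dense (D : Set K))
    (h : ∀ ζ ∈ D, IsUW ρ fun x => inner ℂ ζ (op Φ x ζ)) : IsUWMap ρ Φ := by
  refine isUWMap_of_le fun ζ => ?_
  -- Write `ζ` as a series of vectors of `D` that decays fast enough for the weights `2 ^ (k + 1)`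
  -- to be harmless.
  obtain ⟨v, hv, hvD, -, hvb⟩ := controlled_sum_of_mem_closure (hD ζ)
    (b := fun n => (2⁻¹ : ℝ) ^ n) (fun n => by positivity)
  have hvec : ∀ k, ∃ Ξ : Amp ℕ H, ∀ x,
      inner ℂ (v k) (op Φ x (v k)) = inner ℂ Ξ (ampl ℕ (ρ x) Ξ) := fun k => by
    refine exists_vector_of_le_isUW ρ (vectorFunctional Φ (v k)) (h _ (hvD k))
      (fun x => ?_) fun x => le_rfl
    rw [vectorFunctional_star_mul]
    exact Complex.zero_le_real.2 (by positivity)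
  choose Ξ hΞ using hvec
  have hsum : Summable fun k => (2 : ℝ) ^ (k + 1) * ‖v k‖ ^ 2 := by
    -- The first term of the series has no bound, hence the shift by one.
    rw [← summable_nat_add_iff 1]
    refine Summable.of_nonneg_of_le (fun k => by positivity) (fun k => ?_)
      (summable_geometric_of_lt_one (r := (2⁻¹ : ℝ)) (by norm_num) (by norm_num))
    have h1 := pow_le_pow_left₀ (norm_nonneg _) (hvb (k + 1) (Nat.succ_pos k)).le 2
    calc (2 : ℝ) ^ (k + 1 + 1) * ‖v (k + 1)‖ ^ 2
        ≤ 2 ^ (k + 1 + 1) * ((2⁻¹ : ℝ) ^ (k + 1)) ^ 2 := by gcongr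
      _ = (2⁻¹ : ℝ) ^ k := by
        rw [← pow_mul, inv_pow, inv_pow, ← div_eq_mul_inv, div_eq_iff (by positivity),
          eq_comm, inv_mul_eq_iff_eq_mul₀ (by positivity), ← pow_add]
        congr 1; ring
  have hstine : ∀ x k, (2 : ℝ) ^ (k + 1) * ‖stine Φ x (v k)‖ ^ 2 ≤
      ‖stine Φ x‖ ^ 2 * (2 ^ (k + 1) * ‖v k‖ ^ 2) := fun x k => by
    rw [mul_left_comm, ← mul_pow]
    gcongr
    exact (stine Φ x).le_opNorm _
  have hstineSum : ∀ x, Summable fun k => (2 : ℝ) ^ (k + 1) * ‖stine Φ x (v k)‖ ^ 2 := fun x =>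
    Summable.of_nonneg_of_le (fun k => by positivity) (hstine x) (hsum.mul_left _)
  -- The weights go into the vectors, so that the functional given by all the `Θ k` dominates the
  -- one of `ζ`.
  let Θ : ℕ → Amp ℕ H := fun k => (√((2 : ℝ) ^ (k + 1)) : ℂ) • Ξ k
  have hΘ : ∀ k x, inner ℂ (Θ k) (ampl ℕ (ρ x) (Θ k)) =
      ((2 : ℝ) ^ (k + 1) : ℝ) * inner ℂ (v k) (op Φ x (v k)) := fun k x => by
    rw [map_smul, inner_smul_left, inner_smul_right, ← mul_assoc, Complex.conj_ofReal,
      ← Complex.ofReal_mul, Real.mul_self_sqrt (by positivity), hΞ]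
  have hΘs : Summable fun k => ‖Θ k‖ ^ 2 := by
    refine (hstineSum 1).congr fun k => ?_
    rw [norm_smul, mul_pow, Complex.norm_real, Real.norm_eq_abs, sq_abs,
      Real.sq_sqrt (by positivity), norm_vector_eq (hΞ k)]
  have hω : ∀ x, Summable fun k => inner ℂ (Θ k) (ampl ℕ (ρ x) (Θ k)) := fun x => by
    refine Summable.of_norm_bounded (hΘs.mul_left ‖ρ x‖) fun k => ?_
    refine (norm_inner_le_norm _ _).trans ?_
    rw [sq, mul_left_comm]
    exact mul_le_mul_of_nonneg_left (norm_ampl_le _ _) (norm_nonneg _)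
  refine ⟨_, isUW_of_hasSum_family Θ Θ hΘs hΘs fun x => (hω x).hasSum, fun x => ?_⟩
  have h1 : ∀ k, inner ℂ (Θ k) (ampl ℕ (ρ (star x * x)) (Θ k)) =
      (((2 : ℝ) ^ (k + 1) * ‖stine Φ x (v k)‖ ^ 2 : ℝ) : ℂ) := fun k => by
    rw [hΘ, ← vectorFunctional_apply, vectorFunctional_star_mul, ← Complex.ofReal_mul]
  rw [tsum_congr h1, ← Complex.ofReal_tsum, Complex.ofReal_re]
  refine le_of_tendsto ((((stine Φ x).continuous.tendsto ζ).comp hv).norm.pow 2)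
    (Eventually.of_forall fun n => ?_)
  rw [Function.comp_apply, map_sum]
  exact (norm_sum_range_sq_le _ _).trans
    ((hstineSum x).sum_le_tsum _ fun k _ => by positivity)

end NormalDense

/-! ### The tensor product of normal maps -/

section NormalTensor

open Filter Topology

variable {H₁ H₂ K₁ K₂ : Type*}
  [NormedAddCommGroup H₁] [InnerProductSpace ℂ H₁] [CompleteSpace H₁]
  [NormedAddCommGroup H₂] [InnerProductSpace ℂ H₂] [CompleteSpace H₂]
  [NormedAddCommGroup K₁] [InnerProductSpace ℂ K₁] [CompleteSpace K₁]
  [NormedAddCommGroup K₂] [InnerProductSpace ℂ K₂] [CompleteSpace K₂]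
variable {M₁ : VonNeumannAlgebra H₁} {M₂ : VonNeumannAlgebra H₂}
  {N₁ : VonNeumannAlgebra K₁} {N₂ : VonNeumannAlgebra K₂}

theorem cstarTensor_le_vnTensor (z : OpAlg (cstarTensor M₁ M₂)) :
    z.val ∈ (vnTensor M₁ M₂).toStarSubalgebra := by
  have h1 : StarAlgebra.adjoin ℂ (elementary M₁ M₂) ≤ (vnTensor M₁ M₂).toStarSubalgebra := by
    refine StarAlgebra.adjoin_le ?_
    rintro _ ⟨a, ha, b, hb, rfl⟩
    exact opTensor_mem_vnTensor (⟨a, ha⟩ : Elem M₁) (⟨b, hb⟩ : Elem M₂)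
  have h2 : IsClosed ((vnTensor M₁ M₂).toStarSubalgebra :
    Set (HTensor H₁ H₂ →L[ℂ] HTensor H₁ H₂)) := inferInstance
  exact StarSubalgebra.topologicalClosure_minimal h1 h2 z.2

theorem exists_ultrastrongTo_vnTensor (x : Elem (vnTensor M₁ M₂)) :
    ∃ l : Filter (OpAlg (cstarTensor M₁ M₂)), l.NeBot ∧ UltrastrongTo l x.val := by
  refine exists_ultrastrongTo fun T hT => ?_
  have hT' : T ∈ StarSubalgebra.centralizer ℂ (elementary M₁ M₂) := by
    rw [StarSubalgebra.mem_centralizer_iff]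
    rintro _ ⟨a, ha, b, hb, rfl⟩
    have hab : opTensor a b ∈ cstarTensor M₁ M₂ :=
      opTensor_mem_cstarTensor (⟨a, ha⟩ : Elem M₁) (⟨b, hb⟩ : Elem M₂)
    exact ⟨(hT _ hab).eq, (hT _ (star_mem hab)).eq⟩
  exact ((StarSubalgebra.mem_centralizer_iff ℂ).1 x.2 T hT').1.symm

theorem spatial_induction {p : OpAlg (cstarTensor M₁ M₂) → Prop} (hp : IsClosed {x | p x})
    (h0 : p 0) (hadd : ∀ x y, p x → p y → p (x + y))
    (htmul : ∀ a b, p (toSpatial M₁ M₂ (a ⊗ₜ b))) (x) : p x := by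
  refine denseRange_toSpatial.induction_on x hp fun z => ?_
  induction z with
  | zero => rw [map_zero]; exact h0
  | add z₁ z₂ h₁ h₂ => rw [map_add]; exact hadd _ _ h₁ h₂
  | tmul a b => exact htmul a b

/-- The doubly indexed families of tensors of the components are square summable, and the double sum
of coefficients factors. -/
theorem exists_vectors_tensor {E₁ E₂ : Type*} [NormedAddCommGroup E₁] [InnerProductSpace ℂ E₁]
    [NormedAddCommGroup E₂] [InnerProductSpace ℂ E₂] (Ξ₁ Ξ₁' : Amp ℕ E₁) (Ξ₂ Ξ₂' : Amp ℕ E₂) :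
    ∃ Θ Θ' : Amp ℕ (HTensor E₁ E₂), ∀ a b, inner ℂ Θ' (ampl ℕ (opTensor a b) Θ) =
      inner ℂ Ξ₁' (ampl ℕ a Ξ₁) * inner ℂ Ξ₂' (ampl ℕ b Ξ₂) := by
  have hs : ∀ (ξ : E₁) (Ξ : Amp ℕ E₂), HasSum (fun j => ‖HTensor.tmul ξ (Ξ j)‖ ^ 2)
      (‖ξ‖ ^ 2 * ‖Ξ‖ ^ 2) := fun ξ Ξ => by
    simp only [norm_htmul, mul_pow]
    exact (hasSum_norm_sq_amp Ξ).mul_left _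
  let τ : E₁ → Amp ℕ E₂ → Amp ℕ (HTensor E₁ E₂) := fun ξ Ξ =>
    ⟨fun j => HTensor.tmul ξ (Ξ j), memℓp_of_summable_sq (hs ξ Ξ).summable⟩
  have hτ : ∀ ξ Ξ, ‖τ ξ Ξ‖ ^ 2 = ‖ξ‖ ^ 2 * ‖Ξ‖ ^ 2 := fun ξ Ξ =>
    (hasSum_norm_sq_amp (τ ξ Ξ)).unique (hs ξ Ξ)
  have hsum : ∀ (Ξ : Amp ℕ E₁) (Ξ' : Amp ℕ E₂), Summable fun k => ‖τ (Ξ k) Ξ'‖ ^ 2 :=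
    fun Ξ Ξ' => by
      simp only [hτ]
      exact (summable_norm_sq_amp Ξ).mul_right _
  obtain ⟨Θ, Θ', h⟩ := isUW_of_hasSum_family
    (ρ := fun p : (E₁ →L[ℂ] E₁) × (E₂ →L[ℂ] E₂) => opTensor p.1 p.2)
    (ω := fun p => inner ℂ Ξ₁' (ampl ℕ p.1 Ξ₁) * inner ℂ Ξ₂' (ampl ℕ p.2 Ξ₂))
    (fun k => τ (Ξ₁ k) Ξ₂) (fun k => τ (Ξ₁' k) Ξ₂') (hsum _ _) (hsum _ _) (fun p => by
      refine ((hasSum_inner_ampl p.1 Ξ₁ Ξ₁').mul_right _).congr_fun fun k => ?_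
      refine HasSum.unique ?_ ((hasSum_inner_ampl p.2 Ξ₂ Ξ₂').mul_left _)
      refine (hasSum_inner_ampl (opTensor p.1 p.2) (τ (Ξ₁ k) Ξ₂) (τ (Ξ₁' k) Ξ₂')).congr_fun
        fun j => ?_
      change _ = inner ℂ (HTensor.tmul _ _) (opTensor _ _ (HTensor.tmul _ _))
      rw [opTensor_tmul, inner_htmul])
  exact ⟨Θ, Θ', fun a b => (h (a, b)).symm⟩

theorem continuous_ampl_apply {E : Type*} [NormedAddCommGroup E] [InnerProductSpace ℂ E]
    [CompleteSpace E] (Ξ : Amp ℕ E) : Continuous fun x : E →L[ℂ] E => ampl ℕ x Ξ :=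
  AddMonoidHomClass.continuous_of_bound (repVec (amplHom ℕ E) Ξ) ‖Ξ‖ fun x => by
    rw [mul_comm]; exact norm_ampl_le x Ξ

/-- On elementary tensors the functional is a product of two ultraweakly continuous ones, for which
`exists_vectors_tensor` gives vectors; both sides are norm continuous, so they agree on the spatial
tensor product. -/
theorem isUW_cstarTensorMap_tmul {Φ₁ : Elem M₁ →CP Elem N₁} {Φ₂ : Elem M₂ →CP Elem N₂}
    (h₁ : IsUWMap OpAlg.val Φ₁) (h₂ : IsUWMap OpAlg.val Φ₂) (ξ₁ η₁ : K₁) (ξ₂ η₂ : K₂) :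
    IsUW (fun z : OpAlg (cstarTensor M₁ M₂) => z.val) fun z =>
      inner ℂ (HTensor.tmul η₁ η₂) (op (cstarTensorMap Φ₁ Φ₂) z (HTensor.tmul ξ₁ ξ₂)) := by
  obtain ⟨Ξ₁, Ξ₁', e₁⟩ := h₁.isUW ξ₁ η₁
  obtain ⟨Ξ₂, Ξ₂', e₂⟩ := h₂.isUW ξ₂ η₂
  obtain ⟨Θ, Θ', e⟩ := exists_vectors_tensor Ξ₁ Ξ₁' Ξ₂ Ξ₂'
  beta_reduce at e₁ e₂
  refine ⟨Θ, Θ', fun z => ?_⟩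
  beta_reduce
  refine spatial_induction (p := fun z => inner ℂ (HTensor.tmul η₁ η₂)
    (op (cstarTensorMap Φ₁ Φ₂) z (HTensor.tmul ξ₁ ξ₂)) = inner ℂ Θ' (ampl ℕ z.val Θ))
    (isClosed_eq ?_ ?_) ?_ (fun x y hx hy => ?_) (fun a b => ?_) z
  · have := continuous_op (cstarTensorMap Φ₁ Φ₂)
    fun_prop
  · exact continuous_const.inner ((continuous_ampl_apply Θ).comp OpAlg.continuous_val)
  · rw [op_zero, map_zero, zero_apply, inner_zero_right]
    exact (inner_zero_right (𝕜 := ℂ) Θ').symm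
  · rw [op_add, map_add, add_apply, inner_add_right, hx, hy, ← inner_add_right]
    rfl
  · rw [val_toSpatial, spatialRep_tmul, e, ← e₁, ← e₂, toSpatial_tmul,
      isCstarTensorMap_cstarTensorMap, opTensor_tmul, inner_htmul]

theorem isUWMap_cstarTensorMap {Φ₁ : Elem M₁ →CP Elem N₁} {Φ₂ : Elem M₂ →CP Elem N₂}
    (h₁ : IsUWMap OpAlg.val Φ₁) (h₂ : IsUWMap OpAlg.val Φ₂) :
    IsUWMap OpAlg.val (cstarTensorMap Φ₁ Φ₂) := by
  refine isUWMap_of_dense (LinearMap.range (toHT (E₁ := K₁) (E₂ := K₂))).toAddSubgroup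
    (denseRange_toHT (E₁ := K₁) (E₂ := K₂)) ?_
  rintro _ ⟨t, rfl⟩
  suffices ∀ s t : K₁ ⊗[ℂ] K₂, IsUW (fun z : OpAlg (cstarTensor M₁ M₂) => z.val) fun z =>
      inner ℂ (toHT s) (op (cstarTensorMap Φ₁ Φ₂) z (toHT t)) from this t t
  intro s t
  induction s with
  | zero => simpa only [map_zero, inner_zero_left] using IsUW.zero
  | add s₁ s₂ hs₁ hs₂ => simpa only [map_add, inner_add_left] using hs₁.add hs₂
  | tmul η₁ η₂ =>
    induction t with
    | zero => simpa only [map_zero, inner_zero_right] using IsUW.zero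
    | add t₁ t₂ ht₁ ht₂ => simpa only [map_add, inner_add_right] using ht₁.add ht₂
    | tmul ξ₁ ξ₂ => exact isUW_cstarTensorMap_tmul h₁ h₂ ξ₁ η₁ ξ₂ η₂

/-- The map on the spatial tensor product has ultraweakly continuous vector functionals, so it
extends normally to the ultrastrong closure. -/
theorem isNormalTensorMap_normalTensorMap {Φ₁ : Elem M₁ →CP Elem N₁} {Φ₂ : Elem M₂ →CP Elem N₂}
    (h₁ : IsNormal Φ₁) (h₂ : IsNormal Φ₂) : IsNormalTensorMap Φ₁ Φ₂ (normalTensorMap Φ₁ Φ₂) := by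
  obtain ⟨Φ, hΦ, hΦS⟩ := exists_isUWMap_extension
    (isUWMap_cstarTensorMap (isNormal_iff.1 h₁) (isNormal_iff.1 h₂)) cstarTensor_le_vnTensor
    exists_ultrastrongTo_vnTensor
  have h : ∃ Φ, IsNormalTensorMap Φ₁ Φ₂ Φ := ⟨Φ, isNormal_iff.2 hΦ, fun a b =>
    (hΦS (toSpatial M₁ M₂ (a ⊗ₜ b))).trans (isCstarTensorMap_cstarTensorMap Φ₁ Φ₂ a b)⟩
  rw [normalTensorMap, dif_pos h]
  exact h.choose_spec

theorem IsNormalTensorMap.unique {Φ₁ : Elem M₁ →CP Elem N₁} {Φ₂ : Elem M₂ →CP Elem N₂}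
    {Φ Φ' : Elem (vnTensor M₁ M₂) →CP Elem (vnTensor N₁ N₂)}
    (h : IsNormalTensorMap Φ₁ Φ₂ Φ) (h' : IsNormalTensorMap Φ₁ Φ₂ Φ') : Φ = Φ' := by
  refine eq_of_isUWMap (S := cstarTensor M₁ M₂) (isNormal_iff.1 h.1) (isNormal_iff.1 h'.1)
    cstarTensor_le_vnTensor exists_ultrastrongTo_vnTensor ?_
  let j : OpAlg (cstarTensor M₁ M₂) →ₗ[ℂ] Elem (vnTensor M₁ M₂) :=
    { toFun := fun z => OpAlg.mk z.val (cstarTensor_le_vnTensor z)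
      map_add' := fun _ _ => rfl
      map_smul' := fun _ _ => rfl }
  have hj : Continuous j := AddMonoidHomClass.continuous_of_bound j 1 fun z =>
    (one_mul ‖z‖).ge
  refine spatial_induction (p := fun z => op Φ (j z) = op Φ' (j z))
    (isClosed_eq ((continuous_op Φ).comp hj) ((continuous_op Φ').comp hj)) ?_
    (fun x y hx hy => ?_) fun a b => ?_
  · rw [map_zero, op_zero, op_zero]
  · rw [map_add, op_add, op_add, hx, hy]
  · exact (h.2 a b).trans (h'.2 a b).symm

end NormalTensor

/-! ### The functional calculus in a tensor product representation -/

section PowerFun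

open Filter Topology

/-- For a rational exponent a power of `powerFun` is a monomial, within reach of algebraic
identities for conjugates. -/
theorem powerFun_div_pow {j k n : ℕ} (hn : j + k = n + 1) {t : ℝ} (ht : t ∈ Set.Icc (0 : ℝ) 1) :
    powerFun (k / (n + 1 : ℕ)) t ^ (n + 1) = t ^ j * (1 - t) ^ k := by
  have hn0 : ((n + 1 : ℕ) : ℝ) ≠ 0 := Nat.cast_ne_zero.2 (Nat.succ_ne_zero n)
  have hj : (1 - (k : ℝ) / (n + 1 : ℕ)) * (n + 1 : ℕ) = j := by
    rw [sub_mul, div_mul_cancel₀ _ hn0, one_mul, ← hn]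
    push_cast
    ring
  rw [powerFun, mul_pow, ← Real.rpow_mul_natCast ht.1, ← Real.rpow_mul_natCast (sub_nonneg.2 ht.2),
    hj, div_mul_cancel₀ _ hn0, Real.rpow_natCast, Real.rpow_natCast]

/-- The endpoint exponents are excluded: `t ^ s` is not jointly continuous at `(t, s) = (0, 0)`. -/
theorem continuousOn_powerFun : ContinuousOn (Function.uncurry powerFun)
    (Set.Ioo (0 : ℝ) 1 ×ˢ Set.Icc (0 : ℝ) 1) := by
  rintro ⟨α, t⟩ ⟨hα, -⟩
  refine ContinuousAt.continuousWithinAt (ContinuousAt.mul ?_ ?_)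
  · exact ContinuousAt.rpow continuousAt_snd (continuousAt_const.sub continuousAt_fst)
      (Or.inr (sub_pos.2 hα.2))
  · exact ContinuousAt.rpow (continuousAt_const.sub continuousAt_snd) continuousAt_fst
      (Or.inr hα.1)

variable {E : Type*} [NormedAddCommGroup E] [InnerProductSpace ℂ E] [CompleteSpace E]

theorem cfc_powerFun_pow {C : E →L[ℂ] E} (hC : IsSelfAdjoint C)
    (hs : spectrum ℝ C ⊆ Set.Icc 0 1) {j k n : ℕ} (hn : j + k = n + 1) :
    cfc (powerFun (k / (n + 1 : ℕ))) C ^ (n + 1) = C ^ j * (1 - C) ^ k := by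
  have hα : (k : ℝ) / (n + 1 : ℕ) ∈ Set.Icc (0 : ℝ) 1 := by
    refine ⟨by positivity, div_le_one_of_le₀ ?_ (by positivity)⟩
    exact_mod_cast (by omega : k ≤ n + 1)
  rw [← cfc_pow _ _ C (continuous_powerFun hα).continuousOn,
    cfc_congr fun t ht => powerFun_div_pow hn (hs ht), cfc_mul _ _ C, cfc_pow _ _ C, cfc_pow _ _ C,
    cfc_sub _ _ C, cfc_const_one ℝ C, cfc_id' ℝ C]

theorem cfc_powerFun_nonneg {C : E →L[ℂ] E} (hs : spectrum ℝ C ⊆ Set.Icc 0 1) (α : ℝ) :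
    0 ≤ cfc (powerFun α) C := cfc_nonneg fun _ ht => powerFun_nonneg (hs ht)

theorem continuousOn_cfc_powerFun {C : E →L[ℂ] E} (hs : spectrum ℝ C ⊆ Set.Icc 0 1) :
    ContinuousOn (fun α => cfc (powerFun α) C) (Set.Ioo (0 : ℝ) 1) := fun α hα => by
  refine tendsto_cfc_fun (fun u hu => ?_) ?_
  · obtain ⟨v, hv, h⟩ := isCompact_Icc.mem_uniformity_of_prod continuousOn_powerFun hα
      (symm_le_uniformity hu)
    filter_upwards [hv] with p hp t ht using h p hp t (hs ht)
  · filter_upwards [self_mem_nhdsWithin] with p hp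
    exact (continuous_powerFun (Set.Ioo_subset_Icc_self hp)).continuousOn

theorem continuousOn_inner_cfc_powerFun {C : E →L[ℂ] E} (hs : spectrum ℝ C ⊆ Set.Icc 0 1)
    (x y : E) : ContinuousOn (fun α => (inner ℂ x (cfc (powerFun α) C y) : ℂ)) (Set.Ioo (0 : ℝ) 1) :=
  continuousOn_const.inner ((continuousOn_cfc_powerFun hs).clm_apply continuousOn_const)

/-- Uniqueness of positive roots. -/
theorem eq_of_pow_eq {a b : E →L[ℂ] E} (ha : 0 ≤ a) (hb : 0 ≤ b) {n : ℕ}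
    (h : a ^ (n + 1) = b ^ (n + 1)) : a = b := by
  have key : ∀ c : E →L[ℂ] E, 0 ≤ c → (c ^ (n + 1)) ^ (((n + 1 : ℕ) : ℝ)⁻¹) = c := fun c hc => by
    rw [← CFC.rpow_natCast c (n + 1) hc, CFC.rpow_rpow_of_exponent_nonneg c _ _ (by positivity)
      (by positivity) hc, mul_inv_cancel₀ (Nat.cast_ne_zero.2 (Nat.succ_ne_zero n)),
      CFC.rpow_one c hc]
  rw [← key a ha, h, key b hb]

end PowerFun

/-! ### Powers in a tensor product representation -/

section TensorCalculus

theorem opTensor_pow {E₁ E₂ : Type*} [NormedAddCommGroup E₁] [InnerProductSpace ℂ E₁]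
    [NormedAddCommGroup E₂] [InnerProductSpace ℂ E₂]
    (a : E₁ →L[ℂ] E₁) (b : E₂ →L[ℂ] E₂) (n : ℕ) :
    opTensor a b ^ n = opTensor (a ^ n) (b ^ n) := by
  induction n with
  | zero => rw [pow_zero, pow_zero, pow_zero, opTensor_one]
  | succ n ih => rw [pow_succ, pow_succ, pow_succ, ih, opTensor_mul]

variable {E₁ E₂ F : Type*} [NormedAddCommGroup E₁] [InnerProductSpace ℂ E₁] [CompleteSpace E₁]
  [NormedAddCommGroup E₂] [InnerProductSpace ℂ E₂] [CompleteSpace E₂]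
  [NormedAddCommGroup F] [InnerProductSpace ℂ F] [CompleteSpace F]

theorem opTensor_nonneg {a : E₁ →L[ℂ] E₁} {b : E₂ →L[ℂ] E₂} (ha : 0 ≤ a) (hb : 0 ≤ b) :
    0 ≤ opTensor a b := by
  obtain ⟨s, rfl⟩ := exists_eq_star_mul ha
  obtain ⟨t, rfl⟩ := exists_eq_star_mul hb
  rw [← opTensor_mul, ← star_opTensor]
  exact star_mul_self_nonneg _

variable {C₁ : E₁ →L[ℂ] E₁} {C₂ : E₂ →L[ℂ] E₂} {C : F →L[ℂ] F} {T : HTensor E₁ E₂ →L[ℂ] F}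

/-- `C₁ ⊗ C₂` commutes with `(1 - C₁) ⊗ (1 - C₂)`, so `conjOp T C` commutes with `conjOp T 1`, and
`commute_of_commute_conjOp` applies. -/
theorem commute_of_tensor_representation (hT : DenseRange T)
    (h1 : conjOp T 1 = opTensor C₁ C₂ + opTensor (1 - C₁) (1 - C₂))
    (hA : conjOp T C = opTensor C₁ C₂) :
    Commute C (T ∘L ContinuousLinearMap.adjoint T) := by
  refine commute_of_commute_conjOp hT ?_
  have hc₁ : Commute C₁ (1 - C₁) := (Commute.one_right _).sub_right (Commute.refl _)
  have hc₂ : Commute C₂ (1 - C₂) := (Commute.one_right _).sub_right (Commute.refl _)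
  rw [h1, hA]
  refine (Commute.refl _).add_right ?_
  rw [commute_iff_eq, opTensor_mul, opTensor_mul, hc₁.eq, hc₂.eq]

/-- Both sides are positive, so their `(n + 1)`-st powers decide. On the left this power is `(T⋆ T)
^ n * (T⋆ C ^ j (1 - C) ^ k T)`, which is also `(T⋆ C T) ^ j * (T⋆ (1 - C) T) ^ k`, a product of
powers of elementary tensors; on the right it is the tensor product of the corresponding monomials.
-/
theorem conjOp_cfc_powerFun_div (hT : DenseRange T) (hC : IsSelfAdjoint C)
    (hC₁ : IsSelfAdjoint C₁) (hC₂ : IsSelfAdjoint C₂) (hs : spectrum ℝ C ⊆ Set.Icc 0 1)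
    (hs₁ : spectrum ℝ C₁ ⊆ Set.Icc 0 1) (hs₂ : spectrum ℝ C₂ ⊆ Set.Icc 0 1)
    (h1 : conjOp T 1 = opTensor C₁ C₂ + opTensor (1 - C₁) (1 - C₂))
    (hA : conjOp T C = opTensor C₁ C₂) (hB : conjOp T (1 - C) = opTensor (1 - C₁) (1 - C₂))
    {j k n : ℕ} (hn : j + k = n + 1) :
    conjOp T (cfc (powerFun (k / (n + 1 : ℕ))) C) =
      opTensor (cfc (powerFun (k / (n + 1 : ℕ))) C₁) (cfc (powerFun (k / (n + 1 : ℕ))) C₂) := by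
  have hc := commute_of_tensor_representation hT h1 hA
  have hc1 : Commute (1 - C) (T ∘L ContinuousLinearMap.adjoint T) :=
    (Commute.one_left _).sub_left hc
  refine eq_of_pow_eq (n := n) (conjOp_nonneg T (cfc_powerFun_nonneg hs _))
    (opTensor_nonneg (cfc_powerFun_nonneg hs₁ _) (cfc_powerFun_nonneg hs₂ _)) ?_
  rw [conjOp_pow_succ (hC.commute_cfc hc _), cfc_powerFun_pow hC hs hn,
    ← conjOp_pow_mul_pow hc hc1 hn, hA, hB, opTensor_pow, opTensor_pow, opTensor_pow,
    cfc_powerFun_pow hC₁ hs₁ hn, cfc_powerFun_pow hC₂ hs₂ hn, opTensor_mul]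

theorem inner_cfc_powerFun_tensor (hT : DenseRange T) (hC : IsSelfAdjoint C)
    (hC₁ : IsSelfAdjoint C₁) (hC₂ : IsSelfAdjoint C₂) (hs : spectrum ℝ C ⊆ Set.Icc 0 1)
    (hs₁ : spectrum ℝ C₁ ⊆ Set.Icc 0 1) (hs₂ : spectrum ℝ C₂ ⊆ Set.Icc 0 1)
    (h1 : conjOp T 1 = opTensor C₁ C₂ + opTensor (1 - C₁) (1 - C₂))
    (hA : conjOp T C = opTensor C₁ C₂) (hB : conjOp T (1 - C) = opTensor (1 - C₁) (1 - C₂))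
    {α : ℝ} (hα : α ∈ Set.Icc (0 : ℝ) 1) (u u' : E₁) (v v' : E₂) :
    inner ℂ (T (HTensor.tmul u' v')) (cfc (powerFun α) C (T (HTensor.tmul u v))) =
      inner ℂ u' (cfc (powerFun α) C₁ u) * inner ℂ v' (cfc (powerFun α) C₂ v) := by
  have hrat : ∀ j k n : ℕ, j + k = n + 1 →
      inner ℂ (T (HTensor.tmul u' v'))
          (cfc (powerFun (k / (n + 1 : ℕ))) C (T (HTensor.tmul u v))) =
        inner ℂ u' (cfc (powerFun (k / (n + 1 : ℕ))) C₁ u) *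
          inner ℂ v' (cfc (powerFun (k / (n + 1 : ℕ))) C₂ v) := fun j k n hn => by
    rw [← inner_conjOp, conjOp_cfc_powerFun_div hT hC hC₁ hC₂ hs hs₁ hs₂ h1 hA hB hn,
      opTensor_tmul, inner_htmul]
  -- The endpoints are the rational cases with `n = 0`; they are separated because continuity in `α`
  -- is available only on the open interval.
  rcases eq_or_lt_of_le hα.1 with h0 | h0
  · simpa [← h0] using hrat 1 0 0 rfl
  rcases eq_or_lt_of_le hα.2 with h2 | h2
  · simpa [h2] using hrat 0 1 0 rfl
  have hdense : Set.Ioo (0 : ℝ) 1 ⊆ closure (Set.Ioo 0 1 ∩ Set.range ((↑) : ℚ → ℝ)) :=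
    Rat.denseRange_cast.open_subset_closure_inter isOpen_Ioo
  refine Set.EqOn.of_subset_closure (f := fun α => inner ℂ (T (HTensor.tmul u' v'))
    (cfc (powerFun α) C (T (HTensor.tmul u v)))) (g := fun α => inner ℂ u' (cfc (powerFun α) C₁ u) *
      inner ℂ v' (cfc (powerFun α) C₂ v)) ?_ ?_ ?_ Set.inter_subset_left hdense ⟨h0, h2⟩
  · rintro _ ⟨hq, q, rfl⟩
    have hq0 : 0 < q := by exact_mod_cast hq.1
    have hq1 : q < 1 := by exact_mod_cast hq.2
    obtain ⟨k, hk⟩ := Int.eq_ofNat_of_zero_le (Rat.num_nonneg.2 hq0.le)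
    obtain ⟨n, hn⟩ := Nat.exists_eq_succ_of_ne_zero q.den_nz
    have hkn : k ≤ n + 1 := by
      have := Rat.num_le_denom_iff.2 hq1.le
      rw [hk, hn] at this
      exact_mod_cast this
    have hqc : (q : ℝ) = (k : ℝ) / (n + 1 : ℕ) := by
      rw [Rat.cast_def, hk, hn]
      simp
    have := hrat (n + 1 - k) k n (by omega)
    rw [← hqc] at this
    exact this
  · exact continuousOn_inner_cfc_powerFun hs _ _
  · have c₁ := continuousOn_inner_cfc_powerFun hs₁ u' u
    have c₂ := continuousOn_inner_cfc_powerFun hs₂ v' v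
    exact c₁.mul c₂

end TensorCalculus

/-! ### Power means of tensor products -/

section DenseTensor

variable {V₁ V₂ E₁ E₂ : Type*} [AddCommGroup V₁] [Module ℂ V₁] [AddCommGroup V₂] [Module ℂ V₂]
  [NormedAddCommGroup E₁] [InnerProductSpace ℂ E₁] [NormedAddCommGroup E₂] [InnerProductSpace ℂ E₂]

theorem continuous_htmul_left (η : E₂) : Continuous fun ξ : E₁ => HTensor.tmul ξ η :=
  AddMonoidHomClass.continuous_of_bound
    (toHT ∘ₗ (TensorProduct.mk ℂ E₁ E₂).flip η) ‖η‖ fun ξ => by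
      rw [mul_comm]; exact (norm_htmul ξ η).le

theorem continuous_htmul_right (ξ : E₁) : Continuous fun η : E₂ => HTensor.tmul ξ η :=
  AddMonoidHomClass.continuous_of_bound
    (toHT ∘ₗ TensorProduct.mk ℂ E₁ E₂ ξ) ‖ξ‖ fun η => (norm_htmul ξ η).le

/-- Dense maps into two Hilbert spaces give a dense map into the tensor product. -/
theorem denseRange_toHT_map {f : V₁ →ₗ[ℂ] E₁} {g : V₂ →ₗ[ℂ] E₂} (hf : DenseRange f)
    (hg : DenseRange g) : DenseRange (toHT ∘ₗ TensorProduct.map f g) := by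
  let P := (LinearMap.range (toHT ∘ₗ TensorProduct.map f g)).topologicalClosure
  have hPc : IsClosed (P : Set (HTensor E₁ E₂)) := Submodule.isClosed_topologicalClosure _
  have h1 : ∀ ξ η, HTensor.tmul ξ η ∈ P := fun ξ η => by
    refine hf.induction_on ξ (hPc.preimage (continuous_htmul_left η)) fun x => ?_
    refine hg.induction_on η (hPc.preimage (continuous_htmul_right (f x))) fun y => ?_
    exact subset_closure ⟨x ⊗ₜ y, rfl⟩
  intro u
  change u ∈ P
  refine denseRange_toHT.induction_on u hPc fun ζ => ?_
  induction ζ with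
  | zero => rw [map_zero]; exact zero_mem P
  | add x y hx hy => rw [map_add]; exact add_mem hx hy
  | tmul ξ η => exact h1 ξ η

end DenseTensor

/-! ### The power mean on elementary tensors -/

section TensorPower

open Filter Topology

theorem tensor_four_induction {A₁ K₁ A₂ K₂ : Type*} [AddCommMonoid A₁] [Module ℂ A₁]
    [AddCommMonoid K₁] [Module ℂ K₁] [AddCommMonoid A₂] [Module ℂ A₂] [AddCommMonoid K₂]
    [Module ℂ K₂] {p : (A₁ ⊗[ℂ] K₁) ⊗[ℂ] (A₂ ⊗[ℂ] K₂) → Prop} (zero : p 0)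
    (add : ∀ x y, p x → p y → p (x + y))
    (tmul : ∀ a ξ b η, p ((a ⊗ₜ ξ) ⊗ₜ (b ⊗ₜ η))) (w) : p w := by
  induction w with
  | zero => exact zero
  | add x y hx hy => exact add x y hx hy
  | tmul x y =>
    induction x with
    | zero => rw [TensorProduct.zero_tmul]; exact zero
    | add x x' hx hx' => rw [TensorProduct.add_tmul]; exact add _ _ hx hx'
    | tmul a ξ =>
      induction y with
      | zero => rw [TensorProduct.tmul_zero]; exact zero
      | add y y' hy hy' => rw [TensorProduct.tmul_add]; exact add _ _ hy hy'
      | tmul b η => exact tmul a ξ b η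

variable {A A₁ A₂ : Type*} [CStarAlgebra A] [PartialOrder A] [StarOrderedRing A]
  [CStarAlgebra A₁] [PartialOrder A₁] [StarOrderedRing A₁]
  [CStarAlgebra A₂] [PartialOrder A₂] [StarOrderedRing A₂]
variable {K₁ K₂ : Type*} [NormedAddCommGroup K₁] [InnerProductSpace ℂ K₁] [CompleteSpace K₁]
  [NormedAddCommGroup K₂] [InnerProductSpace ℂ K₂] [CompleteSpace K₂]
variable {N₁ : VonNeumannAlgebra K₁} {N₂ : VonNeumannAlgebra K₂}
  {N : VonNeumannAlgebra (HTensor K₁ K₂)}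

/-- The map `(a ⊗ ξ) ⊗ (b ⊗ η) ↦ τ(a ⊗ b) ⊗ (ξ ⊗ η)`. -/
def shuffle (τ : A₁ ⊗[ℂ] A₂ →ₗ[ℂ] A) :
    (A₁ ⊗[ℂ] K₁) ⊗[ℂ] (A₂ ⊗[ℂ] K₂) →ₗ[ℂ] A ⊗[ℂ] HTensor K₁ K₂ :=
  TensorProduct.map τ toHT ∘ₗ (TensorProduct.tensorTensorTensorComm ℂ A₁ K₁ A₂ K₂).toLinearMap

theorem shuffle_tmul (τ : A₁ ⊗[ℂ] A₂ →ₗ[ℂ] A) (a : A₁) (b : A₂) (ξ : K₁) (η : K₂) :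
    shuffle τ ((a ⊗ₜ ξ) ⊗ₜ (b ⊗ₜ η)) = τ (a ⊗ₜ b) ⊗ₜ HTensor.tmul ξ η := rfl

/-- `τ` is multiplicative on elementary tensors. -/
def IsTensorRep (τ : A₁ ⊗[ℂ] A₂ →ₗ[ℂ] A) : Prop := ∀ a b a' b',
  star (τ (a ⊗ₜ b)) * τ (a' ⊗ₜ b') = τ ((star a * a') ⊗ₜ (star b * b'))

theorem form_shuffle {γ₁ : PosForm (A₁ ⊗[ℂ] K₁)} {γ₂ : PosForm (A₂ ⊗[ℂ] K₂)}
    {τ : A₁ ⊗[ℂ] A₂ →ₗ[ℂ] A} (hτ : IsTensorRep τ) {Φ : A →CP Elem N} {Φ₁ : A₁ →CP Elem N₁}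
    {Φ₂ : A₂ →CP Elem N₂}
    (hΦ : ∀ a b, op Φ (τ (a ⊗ₜ b)) = opTensor (op Φ₁ a) (op Φ₂ b))
    {C₁ : γ₁.Hilbert →L[ℂ] γ₁.Hilbert} {C₂ : γ₂.Hilbert →L[ℂ] γ₂.Hilbert}
    (h₁ : ∀ v w, inner ℂ (γ₁.h w) (C₁ (γ₁.h v)) = (cpForm Φ₁).form v w)
    (h₂ : ∀ v w, inner ℂ (γ₂.h w) (C₂ (γ₂.h v)) = (cpForm Φ₂).form v w)
    (v w : (A₁ ⊗[ℂ] K₁) ⊗[ℂ] (A₂ ⊗[ℂ] K₂)) :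
    (cpForm Φ).form (shuffle τ v) (shuffle τ w) =
      inner ℂ ((toHT ∘ₗ TensorProduct.map γ₁.hLin γ₂.hLin) w)
        (opTensor C₁ C₂ ((toHT ∘ₗ TensorProduct.map γ₁.hLin γ₂.hLin) v)) := by
  induction v using tensor_four_induction with
  | zero => simp only [map_zero, LinearMap.zero_apply, inner_zero_right]
  | add x y hx hy => simp only [map_add, LinearMap.add_apply, inner_add_right, hx, hy]
  | tmul a ξ b η =>
    induction w using tensor_four_induction with
    | zero => simp only [map_zero, inner_zero_left]
    | add x y hx hy => simp only [map_add, inner_add_left, hx, hy]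
    | tmul a' ξ' b' η' =>
      rw [shuffle_tmul, shuffle_tmul, cpForm_tmul, hτ, hΦ, opTensor_tmul, inner_htmul]
      change _ = inner ℂ (HTensor.tmul (γ₁.h _) (γ₂.h _))
        (opTensor C₁ C₂ (HTensor.tmul (γ₁.h _) (γ₂.h _)))
      rw [opTensor_tmul, inner_htmul, h₁, h₂, cpForm_tmul, cpForm_tmul]

/-- The products of the forms are represented by `C₁ ⊗ C₂` and `(1 - C₁) ⊗ (1 - C₂)`. The algebra
`A` enters only through `τ` and the density `hd`, so the spatial and the von Neumann case are
treated alike. -/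
theorem exists_tensor_intertwiner {τ : A₁ ⊗[ℂ] A₂ →ₗ[ℂ] A} (hτ : IsTensorRep τ)
    {Φ Ψ : A →CP Elem N} {Φ₁ Ψ₁ : A₁ →CP Elem N₁} {Φ₂ Ψ₂ : A₂ →CP Elem N₂}
    (hΦ : ∀ a b, op Φ (τ (a ⊗ₜ b)) = opTensor (op Φ₁ a) (op Φ₂ b))
    (hΨ : ∀ a b, op Ψ (τ (a ⊗ₜ b)) = opTensor (op Ψ₁ a) (op Ψ₂ b))
    (hd : DenseRange fun w : (A₁ ⊗[ℂ] K₁) ⊗[ℂ] (A₂ ⊗[ℂ] K₂) =>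
      (cpForm Φ + cpForm Ψ).h (shuffle τ w))
    {C₁ : (cpForm Φ₁ + cpForm Ψ₁).Hilbert →L[ℂ] (cpForm Φ₁ + cpForm Ψ₁).Hilbert}
    (hC₁ : C₁ = PosForm.reprOp (cpForm Φ₁) (cpForm Ψ₁))
    {C₂ : (cpForm Φ₂ + cpForm Ψ₂).Hilbert →L[ℂ] (cpForm Φ₂ + cpForm Ψ₂).Hilbert}
    (hC₂ : C₂ = PosForm.reprOp (cpForm Φ₂) (cpForm Ψ₂)) :
    ∃ T : HTensor (cpForm Φ₁ + cpForm Ψ₁).Hilbert (cpForm Φ₂ + cpForm Ψ₂).Hilbert →L[ℂ]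
        (cpForm Φ + cpForm Ψ).Hilbert, DenseRange T ∧
      (∀ (a : A₁) (ξ : K₁) (b : A₂) (η : K₂), T (HTensor.tmul ((cpForm Φ₁ + cpForm Ψ₁).h (a ⊗ₜ ξ))
        ((cpForm Φ₂ + cpForm Ψ₂).h (b ⊗ₜ η))) =
          (cpForm Φ + cpForm Ψ).h (τ (a ⊗ₜ b) ⊗ₜ HTensor.tmul ξ η)) ∧
      conjOp T 1 = opTensor C₁ C₂ + opTensor (1 - C₁) (1 - C₂) ∧
      conjOp T (PosForm.reprOp (cpForm Φ) (cpForm Ψ)) = opTensor C₁ C₂ ∧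
      conjOp T (1 - PosForm.reprOp (cpForm Φ) (cpForm Ψ)) = opTensor (1 - C₁) (1 - C₂) := by
  subst hC₁ hC₂
  obtain ⟨T, hT, hTe, h⟩ := PosForm.exists_intertwiner (cpForm Φ) (cpForm Ψ)
    (toHT ∘ₗ TensorProduct.map (cpForm Φ₁ + cpForm Ψ₁).hLin (cpForm Φ₂ + cpForm Ψ₂).hLin)
    (denseRange_toHT_map (PosForm.denseRange_h _) (PosForm.denseRange_h _)) (shuffle τ) hd
    (opTensor (PosForm.reprOp (cpForm Φ₁) (cpForm Ψ₁)) (PosForm.reprOp (cpForm Φ₂) (cpForm Ψ₂)))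
    (opTensor (1 - PosForm.reprOp (cpForm Φ₁) (cpForm Ψ₁))
      (1 - PosForm.reprOp (cpForm Φ₂) (cpForm Ψ₂)))
    (form_shuffle hτ hΦ (fun v w => PosForm.repr_left _ _ v w)
      (fun v w => PosForm.repr_left _ _ v w))
    (form_shuffle hτ hΨ (fun v w => PosForm.repr_right _ _ v w)
      (fun v w => PosForm.repr_right _ _ v w))
  exact ⟨T, hT, fun a ξ b η => hTe ((a ⊗ₜ ξ) ⊗ₜ (b ⊗ₜ η)), h⟩

theorem inner_op_powerMean {K : Type*} [NormedAddCommGroup K] [InnerProductSpace ℂ K]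
    [CompleteSpace K] {N : VonNeumannAlgebra K} (Φ Ψ : A →CP Elem N) {α : ℝ}
    (hα : α ∈ Set.Icc (0 : ℝ) 1) (a : A) (ξ η : K) :
    inner ℂ ((cpForm Φ + cpForm Ψ).h (1 ⊗ₜ η)) (cfc (powerFun α)
      (PosForm.reprOp (cpForm Φ) (cpForm Ψ)) ((cpForm Φ + cpForm Ψ).h (a ⊗ₜ ξ))) =
    inner ℂ η (op (powerMean α Φ Ψ) a ξ) := by
  rw [← cpForm_powerMean Φ Ψ hα, cpForm_tmul, star_one, one_mul]

/-- The power mean of tensor products is the tensor product of the power means, on elementary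
tensors. -/
theorem op_powerMean_tensor {τ : A₁ ⊗[ℂ] A₂ →ₗ[ℂ] A} (hτ : IsTensorRep τ)
    (hτ1 : τ (1 ⊗ₜ 1) = 1) {Φ Ψ : A →CP Elem N} {Φ₁ Ψ₁ : A₁ →CP Elem N₁} {Φ₂ Ψ₂ : A₂ →CP Elem N₂}
    (hΦ : ∀ a b, op Φ (τ (a ⊗ₜ b)) = opTensor (op Φ₁ a) (op Φ₂ b))
    (hΨ : ∀ a b, op Ψ (τ (a ⊗ₜ b)) = opTensor (op Ψ₁ a) (op Ψ₂ b))
    (hd : DenseRange fun w : (A₁ ⊗[ℂ] K₁) ⊗[ℂ] (A₂ ⊗[ℂ] K₂) =>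
      (cpForm Φ + cpForm Ψ).h (shuffle τ w))
    {α : ℝ} (hα : α ∈ Set.Icc (0 : ℝ) 1) (a : A₁) (b : A₂) :
    op (powerMean α Φ Ψ) (τ (a ⊗ₜ b)) =
      opTensor (op (powerMean α Φ₁ Ψ₁) a) (op (powerMean α Φ₂ Ψ₂) b) := by
  obtain ⟨T, hT, hTt, hT1, hTA, hTB⟩ := exists_tensor_intertwiner hτ hΦ hΨ hd rfl rfl
  refine ht_clm_ext fun ξ η => ht_ext_inner fun ξ' η' => ?_
  have h := inner_cfc_powerFun_tensor hT (PosForm.isSelfAdjoint_reprOp (cpForm Φ) (cpForm Ψ))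
    (PosForm.isSelfAdjoint_reprOp (cpForm Φ₁) (cpForm Ψ₁))
    (PosForm.isSelfAdjoint_reprOp (cpForm Φ₂) (cpForm Ψ₂))
    (PosForm.spectrum_reprOp _ _) (PosForm.spectrum_reprOp _ _) (PosForm.spectrum_reprOp _ _)
    hT1 hTA hTB hα ((cpForm Φ₁ + cpForm Ψ₁).h (a ⊗ₜ ξ)) ((cpForm Φ₁ + cpForm Ψ₁).h (1 ⊗ₜ ξ'))
    ((cpForm Φ₂ + cpForm Ψ₂).h (b ⊗ₜ η)) ((cpForm Φ₂ + cpForm Ψ₂).h (1 ⊗ₜ η'))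
  have e1 := hTt 1 ξ' 1 η'
  rw [hτ1] at e1
  have e2 := hTt a ξ b η
  rw [e1, e2] at h
  have h0 := inner_op_powerMean Φ Ψ hα (τ (a ⊗ₜ b)) (HTensor.tmul ξ η) (HTensor.tmul ξ' η')
  have h1 := inner_op_powerMean Φ₁ Ψ₁ hα a ξ ξ'
  have h2 := inner_op_powerMean Φ₂ Ψ₂ hα b η η'
  have h3 := inner_htmul ξ' (op (powerMean α Φ₁ Ψ₁) a ξ) η' (op (powerMean α Φ₂ Ψ₂) b η)
  rw [opTensor_tmul]
  exact h0.symm.trans (h.trans ((congrArg₂ (· * ·) h1 h2).trans h3.symm))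

/-- A criterion for the density in `op_powerMean_tensor`. -/
theorem denseRange_h_shuffle {τ : A₁ ⊗[ℂ] A₂ →ₗ[ℂ] A} {γ : PosForm (A ⊗[ℂ] HTensor K₁ K₂)}
    (hγ : ∀ x, ∃ c, ∀ ζ, ‖γ.h (x ⊗ₜ ζ)‖ ≤ c * ‖ζ‖)
    (hd : ∀ x ζ, γ.h (x ⊗ₜ ζ) ∈ closure (Set.range fun z => γ.h (τ z ⊗ₜ ζ))) :
    DenseRange fun w : (A₁ ⊗[ℂ] K₁) ⊗[ℂ] (A₂ ⊗[ℂ] K₂) => γ.h (shuffle τ w) := by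
  let P := (LinearMap.range (γ.hLin ∘ₗ
    (shuffle τ : (A₁ ⊗[ℂ] K₁) ⊗[ℂ] (A₂ ⊗[ℂ] K₂) →ₗ[ℂ] _))).topologicalClosure
  have hPc : IsClosed (P : Set γ.Hilbert) := Submodule.isClosed_topologicalClosure _
  have h1 : ∀ z t, γ.h (τ z ⊗ₜ toHT t) ∈ P := fun z t =>
    subset_closure ⟨(TensorProduct.tensorTensorTensorComm ℂ A₁ A₂ K₁ K₂) (z ⊗ₜ t), by
      change γ.h (TensorProduct.map τ toHT (TensorProduct.tensorTensorTensorComm ℂ A₁ K₁ A₂ K₂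
        (TensorProduct.tensorTensorTensorComm ℂ A₁ A₂ K₁ K₂ (z ⊗ₜ t)))) = _
      rw [← TensorProduct.tensorTensorTensorComm_symm, LinearEquiv.symm_apply_apply]
      rfl⟩
  have h2 : ∀ z ζ, γ.h (τ z ⊗ₜ ζ) ∈ P := fun z ζ =>
    denseRange_toHT.induction_on ζ (hPc.preimage (formFamily γ hγ (τ z)).continuous) (h1 z)
  have h3 : ∀ x ζ, γ.h (x ⊗ₜ ζ) ∈ P := fun x ζ =>
    closure_minimal (by rintro _ ⟨z, rfl⟩; exact h2 z ζ) hPc (hd x ζ)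
  intro u
  change u ∈ P
  refine γ.denseRange_h.induction_on u hPc fun v => ?_
  induction v with
  | zero => rw [PosForm.h_zero]; exact zero_mem P
  | add x y hx hy => rw [PosForm.h_add]; exact add_mem hx hy
  | tmul x ζ => exact h3 x ζ

/-- Approximation in the Hilbert space of the sum of two forms. -/
theorem h_mem_closure_of_tendsto {ι : Type*} {l : Filter ι} [l.NeBot] (Φ Ψ : A →CP Elem N) {x : A}
    {f : ι → A} {ζ : HTensor K₁ K₂} (hΦ : Tendsto (fun i => ‖stine Φ (f i - x) ζ‖) l (𝓝 0))
    (hΨ : Tendsto (fun i => ‖stine Ψ (f i - x) ζ‖) l (𝓝 0)) {S : Set (cpForm Φ + cpForm Ψ).Hilbert}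
    (hS : ∀ i, (cpForm Φ + cpForm Ψ).h (f i ⊗ₜ ζ) ∈ S) :
    (cpForm Φ + cpForm Ψ).h (x ⊗ₜ ζ) ∈ closure S := by
  refine mem_closure_of_tendsto (f := fun i => (cpForm Φ + cpForm Ψ).h (f i ⊗ₜ ζ)) (b := l) ?_
    (Eventually.of_forall hS)
  rw [tendsto_iff_norm_sub_tendsto_zero]
  have h1 := ((hΦ.pow 2).add (hΨ.pow 2)).sqrt
  rw [zero_pow two_ne_zero, add_zero, Real.sqrt_zero] at h1
  refine h1.congr fun i => ?_
  rw [← norm_sq_h_add_tmul, Real.sqrt_sq (norm_nonneg _), TensorProduct.sub_tmul]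
  exact congrArg norm ((cpForm Φ + cpForm Ψ).hLin.map_sub _ _)

end TensorPower

/-! ### The two identities -/

section Main

open Filter Topology

theorem tendsto_stine_sub {A : Type*} [CStarAlgebra A] [PartialOrder A] [StarOrderedRing A]
    {K : Type*} [NormedAddCommGroup K] [InnerProductSpace ℂ K] [CompleteSpace K]
    {N : VonNeumannAlgebra K} (Φ : A →CP Elem N) {ι : Type*} {l : Filter ι} {f : ι → A} {x : A}
    (hf : Tendsto f l (𝓝 x)) (ζ : K) : Tendsto (fun i => ‖stine Φ (f i - x) ζ‖) l (𝓝 0) := by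
  have h1 : Continuous fun y : A => √(‖inner ℂ ζ (op Φ (star y * y) ζ)‖) := by
    have := continuous_op Φ
    fun_prop
  have h2 := ((h1.tendsto 0).comp (tendsto_sub_nhds_zero_iff.2 hf))
  rw [mul_zero, op_zero, zero_apply, inner_zero_right, norm_zero, Real.sqrt_zero] at h2
  refine h2.congr fun i => ?_
  rw [Function.comp_apply, ← inner_stine, inner_self_eq_norm_sq_to_K, norm_pow, RCLike.norm_ofReal,
    abs_norm, Real.sqrt_sq (norm_nonneg _)]

theorem comap_nhds_neBot_of_denseRange {X Y : Type*} [TopologicalSpace Y] {f : X → Y}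
    (hf : DenseRange f) (y : Y) : (comap f (𝓝 y)).NeBot :=
  comap_neBot fun t ht => by
    obtain ⟨_, h, x, rfl⟩ := mem_closure_iff_nhds.1 (hf y) t ht
    exact ⟨x, h⟩

variable {H₁ H₂ K₁ K₂ : Type*}
  [NormedAddCommGroup H₁] [InnerProductSpace ℂ H₁] [CompleteSpace H₁]
  [NormedAddCommGroup H₂] [InnerProductSpace ℂ H₂] [CompleteSpace H₂]
  [NormedAddCommGroup K₁] [InnerProductSpace ℂ K₁] [CompleteSpace K₁]
  [NormedAddCommGroup K₂] [InnerProductSpace ℂ K₂] [CompleteSpace K₂]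
variable {M₁ : VonNeumannAlgebra H₁} {M₂ : VonNeumannAlgebra H₂}
  {N₁ : VonNeumannAlgebra K₁} {N₂ : VonNeumannAlgebra K₂}

theorem isTensorRep_toSpatial : IsTensorRep (toSpatial M₁ M₂) := fun a b a' b' => by
  rw [star_toSpatial_tmul, toSpatial_tmul_mul]

theorem powerMean_cstarTensorMap {α : ℝ} (hα : α ∈ Set.Icc (0 : ℝ) 1)
    (Φ₁ Ψ₁ : Elem M₁ →CP Elem N₁) (Φ₂ Ψ₂ : Elem M₂ →CP Elem N₂) :
    powerMean α (cstarTensorMap Φ₁ Φ₂) (cstarTensorMap Ψ₁ Ψ₂) =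
      cstarTensorMap (powerMean α Φ₁ Ψ₁) (powerMean α Φ₂ Ψ₂) := by
  refine IsCstarTensorMap.unique (fun a b => ?_) (isCstarTensorMap_cstarTensorMap _ _)
  refine op_powerMean_tensor isTensorRep_toSpatial toSpatial_one
    (isCstarTensorMap_cstarTensorMap Φ₁ Φ₂) (isCstarTensorMap_cstarTensorMap Ψ₁ Ψ₂)
    (denseRange_h_shuffle (cpForm_add_bound _ _) fun x ζ => ?_) hα a b
  have := comap_nhds_neBot_of_denseRange (denseRange_toSpatial (M₁ := M₁) (M₂ := M₂)) x
  exact h_mem_closure_of_tendsto _ _ (tendsto_stine_sub _ tendsto_comap ζ)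
    (tendsto_stine_sub _ tendsto_comap ζ) fun z => ⟨z, rfl⟩

/-- The inclusion of the spatial C⋆-tensor product into the von Neumann algebra tensor product. -/
def cstarToVN (M₁ : VonNeumannAlgebra H₁) (M₂ : VonNeumannAlgebra H₂) :
    OpAlg (cstarTensor M₁ M₂) →ₗ[ℂ] Elem (vnTensor M₁ M₂) where
  toFun z := OpAlg.mk z.val (cstarTensor_le_vnTensor z)
  map_add' _ _ := rfl
  map_smul' _ _ := rfl

theorem continuous_cstarToVN : Continuous (cstarToVN M₁ M₂) :=
  AddMonoidHomClass.continuous_of_bound _ 1 fun z => (one_mul ‖z‖).ge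

theorem isTensorRep_cstarToVN : IsTensorRep (cstarToVN M₁ M₂ ∘ₗ toSpatial M₁ M₂) :=
  fun a b a' b' => congrArg (cstarToVN M₁ M₂) (isTensorRep_toSpatial a b a' b')

/-- For a normal map the Stinespring norm is the norm of an amplified orbit, which ultrastrong
convergence controls. -/
theorem tendsto_stine_sub_of_ultrastrongTo {M : VonNeumannAlgebra H₁} {N : VonNeumannAlgebra K₁}
    {S : StarSubalgebra ℂ (H₁ →L[ℂ] H₁)} [IsClosed (S : Set (H₁ →L[ℂ] H₁))]
    {Φ : Elem M →CP Elem N} (hΦ : IsNormal Φ) {l : Filter (OpAlg S)} {x : Elem M}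
    (hl : UltrastrongTo l x.val) (hS : ∀ z : OpAlg S, z.val ∈ M.toStarSubalgebra) (ζ : K₁) :
    Tendsto (fun z => ‖stine Φ (OpAlg.mk z.val (hS z) - x) ζ‖) l (𝓝 0) := by
  obtain ⟨Ξ, hΞ⟩ := isNormal_iff.1 hΦ ζ
  have h := tendsto_iff_norm_sub_tendsto_zero.1 (hl Ξ)
  refine h.congr fun z => ?_
  rw [norm_stine_eq_of_vector hΞ, map_sub]
  change _ = ‖(ampl ℕ (z.val - x.val)) Ξ‖
  exact congrArg norm ((repVec (amplHom ℕ H₁) Ξ).map_sub z.val x.val).symm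

theorem powerMean_normalTensorMap {α : ℝ} (hα : α ∈ Set.Icc (0 : ℝ) 1)
    {Φ₁ Ψ₁ : Elem M₁ →CP Elem N₁} {Φ₂ Ψ₂ : Elem M₂ →CP Elem N₂} (hΦ₁ : IsNormal Φ₁)
    (hΨ₁ : IsNormal Ψ₁) (hΦ₂ : IsNormal Φ₂) (hΨ₂ : IsNormal Ψ₂) :
    powerMean α (normalTensorMap Φ₁ Φ₂) (normalTensorMap Ψ₁ Ψ₂) =
      normalTensorMap (powerMean α Φ₁ Ψ₁) (powerMean α Φ₂ Ψ₂) := by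
  have hΦ := isNormalTensorMap_normalTensorMap hΦ₁ hΦ₂
  have hΨ := isNormalTensorMap_normalTensorMap hΨ₁ hΨ₂
  refine IsNormalTensorMap.unique ⟨isNormal_iff.2 (IsUWMap.powerMean hα (isNormal_iff.1 hΦ.1)
    (isNormal_iff.1 hΨ.1)), fun a b => ?_⟩ (isNormalTensorMap_normalTensorMap (isNormal_iff.2
      (IsUWMap.powerMean hα (isNormal_iff.1 hΦ₁) (isNormal_iff.1 hΨ₁))) (isNormal_iff.2
      (IsUWMap.powerMean hα (isNormal_iff.1 hΦ₂) (isNormal_iff.1 hΨ₂))))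
  refine op_powerMean_tensor isTensorRep_cstarToVN (congrArg (cstarToVN M₁ M₂) toSpatial_one)
    hΦ.2 hΨ.2 (denseRange_h_shuffle (cpForm_add_bound _ _) fun x ζ => ?_) hα a b
  obtain ⟨l, hl, hlx⟩ := exists_ultrastrongTo_vnTensor x
  -- Two approximations are composed: ultrastrongly by the spatial tensor product, where normality
  -- is used, then in norm by the algebraic tensor product.
  rw [← closure_closure]
  refine h_mem_closure_of_tendsto _ _
    (tendsto_stine_sub_of_ultrastrongTo hΦ.1 hlx cstarTensor_le_vnTensor ζ)
    (tendsto_stine_sub_of_ultrastrongTo hΨ.1 hlx cstarTensor_le_vnTensor ζ) fun z => ?_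
  have := comap_nhds_neBot_of_denseRange (denseRange_toSpatial (M₁ := M₁) (M₂ := M₂)) z
  have hz : Tendsto (cstarToVN M₁ M₂ ∘ toSpatial M₁ M₂) (comap (toSpatial M₁ M₂) (𝓝 z))
    (𝓝 (cstarToVN M₁ M₂ z)) := (continuous_cstarToVN.tendsto z).comp tendsto_comap
  exact h_mem_closure_of_tendsto _ _ (tendsto_stine_sub _ hz ζ) (tendsto_stine_sub _ hz ζ)
    fun w => ⟨w, rfl⟩

end Main

end CPMean

end

open CPMean in
theorem mainTheorem10
    {H₁ H₂ K₁ K₂ : Type*}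
    [NormedAddCommGroup H₁] [InnerProductSpace ℂ H₁] [CompleteSpace H₁]
    [NormedAddCommGroup H₂] [InnerProductSpace ℂ H₂] [CompleteSpace H₂]
    [NormedAddCommGroup K₁] [InnerProductSpace ℂ K₁] [CompleteSpace K₁]
    [NormedAddCommGroup K₂] [InnerProductSpace ℂ K₂] [CompleteSpace K₂]
    (M₁ : VonNeumannAlgebra H₁) (M₂ : VonNeumannAlgebra H₂)
    (N₁ : VonNeumannAlgebra K₁) (N₂ : VonNeumannAlgebra K₂)
    (α : ℝ) (hα : α ∈ Set.Icc (0 : ℝ) 1)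
    (Φ₁ Ψ₁ : Elem M₁ →CP Elem N₁) (Φ₂ Ψ₂ : Elem M₂ →CP Elem N₂) :
    powerMean α (cstarTensorMap Φ₁ Φ₂) (cstarTensorMap Ψ₁ Ψ₂) =
        cstarTensorMap (powerMean α Φ₁ Ψ₁) (powerMean α Φ₂ Ψ₂) ∧
      (IsNormal Φ₁ → IsNormal Ψ₁ → IsNormal Φ₂ → IsNormal Ψ₂ →
        powerMean α (normalTensorMap Φ₁ Φ₂) (normalTensorMap Ψ₁ Ψ₂) =
          normalTensorMap (powerMean α Φ₁ Ψ₁) (powerMean α Φ₂ Ψ₂)) := ⟨powerMean_cstarTensorMap hα Φ₁ Ψ₁ Φ₂ Ψ₂,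
    fun hΦ₁ hΨ₁ hΦ₂ hΨ₂ => powerMean_normalTensorMap hα hΦ₁ hΨ₁ hΦ₂ hΨ₂⟩
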